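/- For $(X,Y)\in\mathbb R^2$ let $u=u_{X,Y}(t,x)$ be the real-valued smooth solution of the focusing cubic wave equation $$\partial_t^2u-\Delta u=u^3\quad (x\in\mathbb R^3),\qquad u(0,x)=\frac{2X}{1+|x|^2},\quad \partial_tu(0,x)=\frac{4Y}{(1+|x|^2)^2},$$ and let $t_+=t_+(X,Y)\in(0,\infty]$ be its maximal forward time of existence, i.e. the supremum of the $b>0$ such that a smooth solution exists on $(a,b)\times\mathbb R^3$ for some $a<0$. Threshold function. Put $E_{X,Y}=\frac{Y^2}{2}+\frac{X^2}{2}-\frac{X^4}{4}$ and $$R(X,Y)=\int_X^\infty\frac{dv}{\sqrt{2E_{X,Y}-v^2+\frac12v^4}}\quad(Y\ge0),\qquad S(X,Y)=\Big(\int_m^{|X|}+\int_m^\infty\Big)\frac{dv}{\sqrt{2E_{X,Y}-v^2+\frac12v^4}},\quad m=\sqrt{1+\sqrt{1-4E_{X,Y}}},$$ with the convention that these equal $+\infty$ when an integral diverges or a square root has a negative argument. Let $X_C$ be the unique number $X>1$ with $R(X,0)=\pi$. For $X\le X_C$ let $\beta(X)$ be the unique $Y\ge0$ with $R(X,Y)=\pi$;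 for $X>X_C$ let $\beta(X)$ be the unique $Y<0$ with $S(X,Y)=\pi$. Theorem. Let $(X,Y)\in\mathbb R^2$ be such that $Y>\beta(X)$ or $Y<-\beta(-X)$. Then $0<t_+<\infty$, a smooth solution $u$ as above exists on $(a,t_+)\times\mathbb R^3$ for some $a<0$, and every such solution satisfies, as $t\nearrow t_+$ (in particular all the norms below are finite for $t<t_+$ close to $t_+$): - $\displaystyle \|u(t)\|_{L^3(\mathbb R^3)}=\frac{C_0^{1/3}}{(t_+-t)^{1/2}}+O(1)$; - $\displaystyle \|u(t)\|_{\dot H^{1/2}(\mathbb R^3)}\approx\frac{1}{(t_+-t)^{1/2}}$; - $\displaystyle \|\partial_tu(t)\|_{L^{3/2}(\mathbb R^3)}=\frac{2^{-1/2}C_0^{2/3}}{t_+-t}+O(1)$; - $\displaystyle \|\partial_tu(t)\|_{\dot H^{-1/2}(\mathbb R^3)}=O\Big(\frac1{t_+-t}\Big)$, where $C_0$ depends only on $t_+$ and is given by $$C_0=2^{7/2}\pi\int_0^\infty\Big(1+\frac{\rho^2t_+}{1+t_+^2}\Big)^{-3}\rho^2\,d\rho .$$ Here $\|f\|_{\dot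 H^s}=\big(\int_{\mathbb R^3}|\xi|^{2s}|\hat f(\xi)|^2d\xi\big)^{1/2}$, and $f\approx g$ means $f=O(g)$ and $g=O(f)$; the implied constants do not depend on $t$. -/

import Mathlib

open MeasureTheory Set Filter Topology Asymptotics
open scoped ENNReal ContDiff SchwartzMap FourierTransform Laplacian

noncomputable section

namespace CubicWave

/-- Physical space `ℝ³`, with its Euclidean norm. -/
abbrev Space : Type := EuclideanSpace ℝ (Fin 3)

/-! ### The family of solutions and its maximal forward time of existence -/

/-- `u` is a smooth solution of `∂ₜ²u - Δu = u³` on `I × ℝ³` (`I` an open time interval containing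
`0`), with initial data
`(u, ∂ₜu)|_{t = 0} = (2 X / (1 + |x|²), 4 Y / (1 + |x|²)²)`. -/
structure IsSolution (X Y : ℝ) (I : Set ℝ) (u : ℝ → Space → ℝ) : Prop where
  smooth : ContDiffOn ℝ ∞ (fun p : ℝ × Space => u p.1 p.2) (I ×ˢ univ)
  wave_eq : ∀ t ∈ I, ∀ x : Space,
    iteratedDeriv 2 (fun s => u s x) t - Δ (u t) x = u t x ^ 3
  init_pos : ∀ x : Space, u 0 x = 2 * X / (1 + ‖x‖ ^ 2)
  init_vel : ∀ x : Space, deriv (fun s => u s x) 0 = 4 * Y / (1 + ‖x‖ ^ 2) ^ 2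

/-- The maximal forward time of existence `t₊(X, Y) ∈ (0, ∞]`: the supremum of the times `b > 0`
such that a solution exists on `(a, b) × ℝ³` for some `a < 0`. -/
def maximalTime (X Y : ℝ) : EReal :=
  sSup {T : EReal | ∃ a b : ℝ, a < 0 ∧ 0 < b ∧ T = (b : EReal) ∧
    ∃ u : ℝ → Space → ℝ, IsSolution X Y (Ioo a b) u}

/-! ### The threshold function `β` -/

/-- The conserved energy `E = Y²/2 + X²/2 - X⁴/4` of `U'' + U = U³`, `U(0) = X`, `U'(0) = Y`. -/
def energy (X Y : ℝ) : ℝ := Y ^ 2 / 2 + X ^ 2 / 2 - X ^ 4 / 4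

/-- The integrand `1 / √(2E - v² + v⁴/2)`, with the value `+∞` where the radicand is not positive.
Thus an integral over a set of positive measure on which the radicand is negative is `+∞`, and so
is a divergent integral. -/
def integrand (E v : ℝ) : ℝ≥0∞ := (ENNReal.ofReal (√(2 * E - v ^ 2 + v ^ 4 / 2)))⁻¹

/-- `R(X, Y) = ∫_X^∞ dv / √(2E - v² + v⁴/2)`, for `Y ≥ 0` (the only case used). -/
def R (X Y : ℝ) : ℝ≥0∞ := ∫⁻ v in Ioi X, integrand (energy X Y) v

open Classical in
/-- `S(X, Y) = (∫_m^|X| + ∫_m^∞) dv / √(2E - v² + v⁴/2)` with `m = √(1 + √(1 - 4E))`, and `+∞` if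
`1 - 4E < 0`. -/
def S (X Y : ℝ) : ℝ≥0∞ :=
  if 4 * energy X Y ≤ 1 then
    (∫⁻ v in uIoc (√(1 + √(1 - 4 * energy X Y))) |X|, integrand (energy X Y) v)
      + ∫⁻ v in Ioi (√(1 + √(1 - 4 * energy X Y))), integrand (energy X Y) v
  else ⊤

/-- The unique `X > 1` such that `R(X, 0) = π`. -/
def criticalX : ℝ := sSup {X : ℝ | 1 < X ∧ R X 0 = ENNReal.ofReal Real.pi}

open Classical in
/-- The threshold function: for `X ≤ X_C`, `β(X)` is the unique `Y ≥ 0` with `R(X, Y) = π`; for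
`X > X_C`, `β(X)` is the unique `Y < 0` with `S(X, Y) = π`. -/
def threshold (X : ℝ) : ℝ :=
  if X ≤ criticalX then sSup {Y : ℝ | 0 ≤ Y ∧ R X Y = ENNReal.ofReal Real.pi}
  else sSup {Y : ℝ | Y < 0 ∧ S X Y = ENNReal.ofReal Real.pi}

/-! ### Homogeneous Sobolev norms -/

/-- The function `g` is the Fourier transform of the function `f` in the sense of tempered
distributions: both define tempered distributions by integration, and `⟨f, 𝓕 φ⟩ = ⟨g, φ⟩` for all
Schwartz functions `φ`. -/
def IsFourierTransform (f g : Space → ℂ) : Prop :=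
  (∀ φ : 𝓢(Space, ℂ), Integrable (fun x => f x * φ x)) ∧
  (∀ φ : 𝓢(Space, ℂ), Integrable (fun ξ => g ξ * φ ξ)) ∧
  ∀ φ : 𝓢(Space, ℂ), ∫ x, f x * (𝓕 φ) x = ∫ ξ, g ξ * φ ξ

/-- The norm of `f` in `Ḣˢ(ℝ³)`, i.e. `(∫ |ξ|^{2s} |f̂(ξ)|² dξ)^{1/2}`, where `f̂` is the tempered
Fourier transform of `f`. It is `+∞` if `f` is not a tempered distribution or `f̂` is not a locally
integrable function. As `f̂` is unique up to null sets, the infimum ranges over at most one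
value. -/
def homSobolevNorm (s : ℝ) (f : Space → ℝ) : ℝ≥0∞ :=
  ⨅ (g : Space → ℂ) (_ : IsFourierTransform (fun x => (f x : ℂ)) g),
    (∫⁻ ξ, ENNReal.ofReal (‖ξ‖ ^ (2 * s)) * ‖g ξ‖ₑ ^ 2) ^ (1 / 2 : ℝ)

/-- The constant `C₀ = 2^{7/2} π ∫₀^∞ (1 + ρ² t₊ / (1 + t₊²))⁻³ ρ² dρ`. -/
def C₀ (tPlus : ℝ) : ℝ :=
  2 ^ (7 / 2 : ℝ) * Real.pi *
    ∫ ρ in Ioi (0 : ℝ), (1 + ρ ^ 2 * tPlus / (1 + tPlus ^ 2)) ^ (-3 : ℤ) * ρ ^ 2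

end CubicWave

end

noncomputable section

namespace CubicWave

/-! The equation is conformally invariant, and the Penrose transform turns the data into constants.
With `Ω = 2/√((1+(t+|x|)²)(1+(t-|x|)²))` and conformal time `s = arctan(t+|x|) + arctan(t-|x|)`, the
function `Ω U(s)` solves the wave equation whenever `U'' + U = U³`, and has the prescribed data when
`U(0) = X`, `U'(0) = Y` (`IsProfile.isSolution`). Everything reduces to a scalar equation with a
conserved energy.

Conservation reads `U'² = 2E - U² + U⁴/2`, so `R` (monotone motion) and `S` (descent to the turning
point `m`, then ascent) are the times at which `U` reaches `+∞`. This time decreases as `Y` grows,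
and `Y > β(X)` makes it a number `τ < π` (`exists_isProfile`). The substitutions `U = tan θ` and `U
= m / cos θ` make infinity and the turning point regular points of the motion.

At fixed `t ≥ 0` the conformal time is largest at `x = 0`, where it is `2 arctan t`. Hence the
solution lives up to `T = tan(τ/2)` and becomes infinite at the origin there. A weighted energy
estimate in backward light cones (`IsSolution.eq_of_nonneg`) identifies every smooth solution with
this one for `0 ≤ t < T`, which also gives `t₊ = T`.

For the rates, `U` and `U'` differ by `O(1)` from `√2/sin(τ-s)` and its derivative
(`blowup_asymptotics`). This comparison function is the zero-energy solution, and its Penrose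
transform is the explicit `√2/(c + κ|x|²)` with `κ = T/(1+T²)` and `c = (T-t)(1-κ(T-t))`. The decay
of `Ω` keeps the remainders bounded in the relevant Lebesgue spaces (`IsProfile.bounds`), and
scaling computes the norms of powers of `c + κ|x|²`, which produces `C₀`. In `Ḣ^{1/2}` the upper
bound is interpolation between `L²` and `H¹`, the lower bound is duality with a bump at scale
`√(T-t)`; in `Ḣ^{-1/2}` frequencies are split at `(T-t)^{-1/2}`. The case `Y < -β(-X)` follows from
the symmetry `u ↦ -u`. -/

/-! ### Flows of autonomous scalar equations -/

theorem exists_Icc_subset_of_isOpen {s : Set ℝ} (hs : IsOpen s) {a b : ℝ} (hab : a < b)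
    (hsub : Icc a b ⊆ s) : ∃ c < a, ∃ d > b, Icc c d ⊆ s := by
  obtain ⟨ε₁, h₁, H₁⟩ := Metric.isOpen_iff.1 hs a (hsub ⟨le_rfl, hab.le⟩)
  obtain ⟨ε₂, h₂, H₂⟩ := Metric.isOpen_iff.1 hs b (hsub ⟨hab.le, le_rfl⟩)
  refine ⟨a - ε₁ / 2, by linarith, b + ε₂ / 2, by linarith, fun x hx => ?_⟩
  rcases lt_or_ge x a with h | h
  · exact H₁ (by rw [Metric.mem_ball, Real.dist_eq, abs_lt]; constructor <;> linarith [hx.1])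
  rcases le_or_gt x b with h' | h'
  · exact hsub ⟨h, h'⟩
  · exact H₂ (by rw [Metric.mem_ball, Real.dist_eq, abs_lt]; constructor <;> linarith [hx.2])

/-- A solution of an autonomous scalar equation with smooth right-hand side is smooth. -/
theorem contDiffOn_of_hasDerivAt_comp {f θ : ℝ → ℝ} {s I : Set ℝ} (hI : IsOpen I)
    (hf : ContDiffOn ℝ ∞ f s) (hθ : ∀ t ∈ I, θ t ∈ s)
    (hd : ∀ t ∈ I, HasDerivAt θ (f (θ t)) t) : ContDiffOn ℝ ∞ θ I := by
  have key : ∀ n : ℕ, ContDiffOn ℝ n θ I := by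
    intro n
    induction n with
    | zero =>
      exact contDiffOn_zero.2 fun t ht => (hd t ht).continuousAt.continuousWithinAt
    | succ n ih =>
      have : ((n + 1 : ℕ) : WithTop ℕ∞) = (n : WithTop ℕ∞) + 1 := by norm_cast
      rw [this, contDiffOn_succ_iff_deriv_of_isOpen hI]
      refine ⟨fun t ht => (hd t ht).differentiableAt.differentiableWithinAt, by simp, ?_⟩
      have h1 : ContDiffOn ℝ n (fun t => f (θ t)) I :=
        (hf.of_le (by exact_mod_cast le_top)).comp ih hθ
      exact h1.congr fun t ht => (hd t ht).deriv
  exact contDiffOn_infty.2 key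

/-- Separation of variables: `θ` is the inverse of the primitive of `1/f`. Since `f` stays positive
slightly beyond `[a, b]`, the flow is smooth past both end times; the margin at the start makes
profiles smooth for small negative times. -/
theorem exists_flow {f : ℝ → ℝ} {s : Set ℝ} (hs : IsOpen s) {a b : ℝ} (hab : a < b)
    (hsub : Icc a b ⊆ s) (hf : ContDiffOn ℝ ∞ f s) (hpos : ∀ x ∈ Icc a b, 0 < f x) :
    0 < (∫ x in a..b, (f x)⁻¹) ∧
    ∃ θ : ℝ → ℝ, ∃ ε > 0, StrictMono θ ∧ Continuous θ ∧ θ 0 = a ∧ θ (∫ x in a..b, (f x)⁻¹) = b ∧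
      ContDiffOn ℝ ∞ θ (Ioo (-ε) ((∫ x in a..b, (f x)⁻¹) + ε)) ∧
      ∀ t ∈ Ioo (-ε) ((∫ x in a..b, (f x)⁻¹) + ε), θ t ∈ s ∧ HasDerivAt θ (f (θ t)) t := by
  have hs' : IsOpen (s ∩ f ⁻¹' Ioi 0) := hf.continuousOn.isOpen_inter_preimage hs isOpen_Ioi
  obtain ⟨c, hc, d, hd, hcd⟩ := exists_Icc_subset_of_isOpen hs' hab
    fun x hx => ⟨hsub hx, hpos x hx⟩
  have hmem : ∀ x, max c (min x d) ∈ Icc c d := fun x =>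
    ⟨le_max_left _ _, max_le (by linarith) (min_le_right _ _)⟩
  -- Clamping the argument to `[c, d]` bounds the reciprocal below by `M⁻¹`, so that the primitive
  -- becomes a bijection of the whole line.
  set k : ℝ → ℝ := fun x => (f (max c (min x d)))⁻¹ with hk
  have hfc : ContinuousOn f (Icc c d) := hf.continuousOn.mono fun x hx => (hcd hx).1
  have hkpos : ∀ x, 0 < k x := fun x => inv_pos.2 (hcd (hmem x)).2
  have hkc : Continuous k := by
    refine Continuous.inv₀ ?_ fun x => (hcd (hmem x)).2.ne'
    exact hfc.comp_continuous (by fun_prop) hmem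
  obtain ⟨M, hM⟩ := isCompact_Icc.exists_bound_of_continuousOn hfc
  have hM0 : 0 < M := lt_of_lt_of_le (hcd (hmem 0)).2 ((le_abs_self _).trans (hM _ (hmem 0)))
  have hkM : ∀ x, M⁻¹ ≤ k x := fun x =>
    inv_anti₀ (hcd (hmem x)).2 ((le_abs_self _).trans (hM _ (hmem x)))
  set F : ℝ → ℝ := fun x => ∫ y in a..x, k y with hF
  have hFd : ∀ x, HasDerivAt F (k x) x := fun x =>
    (hkc.integral_hasStrictDerivAt a x).hasDerivAt
  have hFm : StrictMono F := strictMono_of_deriv_pos fun x => by rw [(hFd x).deriv]; exact hkpos x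
  have hFc : Continuous F := continuous_iff_continuousAt.2 fun x => (hFd x).continuousAt
  have hmono : Monotone fun x => F x - M⁻¹ * x := by
    have hd2 : ∀ x, HasDerivAt (fun x => F x - M⁻¹ * x) (k x - M⁻¹ * 1) x := fun x =>
      (hFd x).sub ((hasDerivAt_id x).const_mul _)
    refine monotone_of_deriv_nonneg (fun x => (hd2 x).differentiableAt) fun x => ?_
    rw [(hd2 x).deriv]
    linarith [hkM x]
  have hsurj : Function.Surjective F := by
    refine hFc.surjective ?_ ?_
    · have h1 : Tendsto (fun x => M⁻¹ * x + (F 0 - M⁻¹ * 0)) atTop atTop :=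
        tendsto_atTop_add_const_right _ _ (tendsto_id.const_mul_atTop (inv_pos.2 hM0))
      refine tendsto_atTop_mono' _ ?_ h1
      filter_upwards [eventually_ge_atTop 0] with x hx
      have := hmono hx
      simp only at this; linarith
    · have h1 : Tendsto (fun x => M⁻¹ * x + (F 0 - M⁻¹ * 0)) atBot atBot :=
        tendsto_atBot_add_const_right _ _ (tendsto_id.const_mul_atBot (inv_pos.2 hM0))
      refine tendsto_atBot_mono' _ ?_ h1
      filter_upwards [eventually_le_atBot 0] with x hx
      have := hmono hx
      simp only at this; linarith
  set e := hFm.orderIsoOfSurjective F hsurj with he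
  have hFe : ∀ x, F (e.symm x) = x := fun x => e.apply_symm_apply x
  have heF : ∀ x, e.symm (F x) = x := fun x => e.symm_apply_apply x
  have hFa : F a = 0 := by simp [hF]
  have hFb : F b = ∫ x in a..b, (f x)⁻¹ := by
    refine intervalIntegral.integral_congr fun x hx => ?_
    rw [uIcc_of_le hab.le] at hx
    have : max c (min x d) = x := by
      rw [min_eq_left (by linarith [hx.2]), max_eq_right (by linarith [hx.1])]
    simp only [hk, this]
  rw [← hFb]
  refine ⟨by rw [← hFa]; exact hFm hab, e.symm, min (-F c) (F d - F b), ?_, e.symm.strictMono,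
    e.symm.continuous, ?_, heF b, ?_⟩
  · have := hFm hc; have := hFm hd
    exact lt_min (by linarith) (by linarith)
  · rw [← hFa]; exact heF a
  have hin : ∀ t ∈ Ioo (-min (-F c) (F d - F b)) (F b + min (-F c) (F d - F b)),
      e.symm t ∈ Ioo c d := by
    intro t ht
    have h1 := min_le_left (-F c) (F d - F b)
    have h2 := min_le_right (-F c) (F d - F b)
    constructor
    · rw [← heF c]; exact e.symm.strictMono (by linarith [ht.1])
    · rw [← heF d]; exact e.symm.strictMono (by linarith [ht.2])
  have hder : ∀ t ∈ Ioo (-min (-F c) (F d - F b)) (F b + min (-F c) (F d - F b)),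
      HasDerivAt e.symm (f (e.symm t)) t := by
    intro t ht
    have h1 := HasDerivAt.of_local_left_inverse (e.symm.continuous.continuousAt (x := t))
      (hFd (e.symm t)) (hkpos _).ne' (Eventually.of_forall hFe)
    have h2 := hin t ht
    have : max c (min (e.symm t) d) = e.symm t := by
      rw [min_eq_left h2.2.le, max_eq_right h2.1.le]
    simpa only [hk, this, inv_inv] using h1
  exact ⟨contDiffOn_of_hasDerivAt_comp isOpen_Ioo hf
    (fun t ht => (hcd (Ioo_subset_Icc_self (hin t ht))).1) hder,
    fun t ht => ⟨(hcd (Ioo_subset_Icc_self (hin t ht))).1, hder t ht⟩⟩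

/-! ### Blow-up asymptotics of the scalar equation -/

/-- Rationalising, the difference is `(2E - v²)/(√P + v²/√2)` with `P` the radicand, and the
numerator is `O(v²)`. -/
theorem abs_sqrt_radicand_sub_le {E v : ℝ} (hv : 1 ≤ v) :
    |√(2 * E - v ^ 2 + v ^ 4 / 2) - v ^ 2 / √2| ≤ √2 * (1 + 2 * |E|) ∨
      2 * E - v ^ 2 + v ^ 4 / 2 ≤ 0 := by
  rcases le_or_gt (2 * E - v ^ 2 + v ^ 4 / 2) 0 with h | h
  · exact Or.inr h
  left
  set P := 2 * E - v ^ 2 + v ^ 4 / 2 with hP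
  have h2 : (√2) ^ 2 = 2 := Real.sq_sqrt (by norm_num)
  have h2p : 0 < √2 := by positivity
  have hq : 0 < v ^ 2 / √2 := by positivity
  have hs : 0 < √P := Real.sqrt_pos.2 h
  have hv2 : 1 ≤ v ^ 2 := one_le_pow₀ hv
  have h1 : (√P - v ^ 2 / √2) * (√P + v ^ 2 / √2) = 2 * E - v ^ 2 := by
    have : (v ^ 2 / √2) ^ 2 = v ^ 4 / 2 := by rw [div_pow, h2]; ring
    have h3 : √P ^ 2 = P := Real.sq_sqrt h.le
    nlinarith
  have h3 : |√P - v ^ 2 / √2| * (√P + v ^ 2 / √2) = |2 * E - v ^ 2| := by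
    rw [← h1, abs_mul, abs_of_pos (add_pos hs hq)]
  have h4 : |2 * E - v ^ 2| ≤ (1 + 2 * |E|) * v ^ 2 := by
    rw [abs_le]
    constructor <;> nlinarith [neg_abs_le E, le_abs_self E, abs_nonneg E]
  have h5 : |√P - v ^ 2 / √2| * (v ^ 2 / √2) ≤ (√2 * (1 + 2 * |E|)) * (v ^ 2 / √2) := by
    have : (√2 * (1 + 2 * |E|)) * (v ^ 2 / √2) = (1 + 2 * |E|) * v ^ 2 := by field_simp
    rw [this]
    refine le_trans ?_ h4
    rw [← h3]
    exact mul_le_mul_of_nonneg_left (by linarith) (abs_nonneg _)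
  exact le_of_mul_le_mul_right h5 hq

/-- If `w` tends to `0` at `τ` and `|w' + 1/√2| ≤ C` on `[t, τ)`, then `w t` is within
`C (τ - t)` of `(τ - t)/√2`. -/
theorem abs_sub_le_of_deriv_near {w w' : ℝ → ℝ} {t τ C k : ℝ} (ht : t < τ)
    (hw : Tendsto w (𝓝[<] τ) (𝓝 0)) (hd : ∀ y ∈ Ico t τ, HasDerivAt w (w' y) y)
    (hC : ∀ y ∈ Ico t τ, |w' y + k| ≤ C) : |(τ - t) * k - w t| ≤ C * (τ - t) := by
  have h1 : ∀ y ∈ Ico t τ, |(w y + y * k) - (w t + t * k)| ≤ C * (y - t) := by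
    intro y hy
    have := (convex_Ico t τ).norm_image_sub_le_of_norm_hasDerivWithin_le
      (f := fun y => w y + y * k) (f' := fun y => w' y + 1 * k) (C := C)
      (fun z hz => (((hd z hz).add ((hasDerivAt_id z).mul_const k))).hasDerivWithinAt)
      (fun z hz => by rw [Real.norm_eq_abs, one_mul]; exact hC z hz)
      (x := t) (y := y) ⟨le_rfl, ht⟩ hy
    rw [Real.norm_eq_abs, Real.norm_eq_abs, abs_of_nonneg (sub_nonneg.2 hy.1)] at this
    exact this
  have hid : Tendsto (fun y : ℝ => y) (𝓝[<] τ) (𝓝 τ) := tendsto_id.mono_left nhdsWithin_le_nhds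
  have h2 : Tendsto (fun y => |(w y + y * k) - (w t + t * k)|) (𝓝[<] τ)
      (𝓝 |(0 + τ * k) - (w t + t * k)|) :=
    (((hw.add (hid.mul_const k)).sub_const _)).abs
  have h3 : Tendsto (fun y => C * (y - t)) (𝓝[<] τ) (𝓝 (C * (τ - t))) :=
    (hid.sub_const t).const_mul C
  have := le_of_tendsto_of_tendsto h2 h3 (by
    filter_upwards [Ico_mem_nhdsLT ht] with y hy using h1 y hy)
  rw [show (τ - t) * k - w t = (0 + τ * k) - (w t + t * k) by ring]
  exact this

/-- Here `σ` is the time left, `u` the value and `Q` the derivative. From `w = σ/√2 + O(σ³)` follows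
`u = √2/σ + O(σ)`, and `1/σ - 1/sin σ = O(σ)`. An error `O(σ)` in `u` is just small enough to keep
the error in `u²` bounded, since `u + √2/sin σ = O(1/σ)`. -/
theorem blowup_pointwise {L σ u w Q : ℝ} (hσ0 : 0 < σ) (hσ1 : σ ≤ 1) (hL1 : 1 ≤ L)
    (hw1 : 2 / 5 * σ ≤ w) (hUw : u = 1 / w)
    (hf : |σ * (1 / √2) - w| ≤ L * σ ^ 2 * σ) (hD1 : |Q - u ^ 2 / √2| ≤ L) :
    |u - √2 / Real.sin σ| ≤ 5 * (4 * L + 2) + L + 2 ∧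
      |Q - √2 * Real.cos σ / Real.sin σ ^ 2| ≤ 5 * (4 * L + 2) + L + 2 := by
  have h2 : (√2) ^ 2 = 2 := Real.sq_sqrt (by norm_num)
  have h2p : 0 < √2 := by positivity
  have h2u : √2 < 3 / 2 := by rw [Real.sqrt_lt' (by norm_num)]; norm_num
  have hwpos : 0 < w := by nlinarith
  have hUpos : 0 < u := by rw [hUw]; positivity
  have hs1 : σ - σ ^ 3 / 6 < Real.sin σ := Real.sin_gt_sub_cube hσ0
  have hs2 : Real.sin σ < σ := Real.sin_lt hσ0
  have hs3 : 3 / 4 * σ ≤ Real.sin σ := by nlinarith [mul_pos hσ0 hσ0]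
  have hs0 : 0 < Real.sin σ := by nlinarith
  have hA : |u - √2 / σ| ≤ 4 * L * σ := by
    have : u - √2 / σ = √2 * (σ * (1 / √2) - w) / (w * σ) := by
      rw [hUw]; field_simp
    rw [this, abs_div, abs_mul, abs_of_pos h2p, abs_of_pos (mul_pos hwpos hσ0),
      div_le_iff₀ (mul_pos hwpos hσ0)]
    calc √2 * |σ * (1 / √2) - w| ≤ 3 / 2 * (L * σ ^ 2 * σ) := by gcongr
      _ ≤ 4 * L * σ * ((2 / 5 * σ) * σ) := by
          have : 0 < L * σ ^ 3 := by positivity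
          nlinarith
      _ ≤ _ := by gcongr
  have hB : |√2 / σ - √2 / Real.sin σ| ≤ 2 * σ := by
    have : √2 / σ - √2 / Real.sin σ = -(√2 * (σ - Real.sin σ) / (σ * Real.sin σ)) := by
      field_simp; ring
    rw [this, abs_neg, abs_of_nonneg (by have : 0 ≤ σ - Real.sin σ := by linarith
                                         positivity), div_le_iff₀ (by positivity)]
    calc √2 * (σ - Real.sin σ) ≤ 3 / 2 * (σ ^ 3 / 4) := by
            have : 0 ≤ σ - Real.sin σ := by linarith
            gcongr
            linarith
      _ ≤ 2 * σ * (σ * (3 / 4 * σ)) := by have : 0 < σ ^ 3 := by positivity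
                                          nlinarith
      _ ≤ _ := by gcongr
  have hAB : |u - √2 / Real.sin σ| ≤ (4 * L + 2) * σ := by
    have := abs_sub_le (u) (√2 / σ) (√2 / Real.sin σ)
    linarith
  refine ⟨hAB.trans (by nlinarith), ?_⟩
  have hD2 : |u ^ 2 / √2 - √2 / Real.sin σ ^ 2| ≤ 5 * (4 * L + 2) := by
    have e : u ^ 2 / √2 - √2 / Real.sin σ ^ 2
        = (u - √2 / Real.sin σ) * (u + √2 / Real.sin σ) / √2 := by
      field_simp; ring
    have hp : 0 < u + √2 / Real.sin σ := by positivity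
    have hU1 : u ≤ 5 / (2 * σ) := by
      rw [hUw, div_le_div_iff₀ hwpos (by linarith)]; linarith
    have hU2 : √2 / Real.sin σ ≤ 2 / σ := by
      rw [div_le_div_iff₀ hs0 hσ0]; nlinarith
    rw [e, abs_div, abs_mul, abs_of_pos hp, abs_of_pos h2p, div_le_iff₀ h2p]
    calc _ ≤ (4 * L + 2) * σ * (5 / (2 * σ) + 2 / σ) := by gcongr
      _ = (4 * L + 2) * (9 / 2) := by field_simp; norm_num
      _ ≤ _ := by nlinarith
  have hD3 : |√2 / Real.sin σ ^ 2 - √2 * Real.cos σ / Real.sin σ ^ 2| ≤ 2 := by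
    rw [← sub_div, abs_of_nonneg (div_nonneg (by nlinarith [Real.cos_le_one σ]) (by positivity)),
      div_le_iff₀ (by positivity)]
    have hc := Real.one_sub_sq_div_two_le_cos (x := σ)
    have : (3 / 4 * σ) ^ 2 ≤ Real.sin σ ^ 2 := by gcongr
    nlinarith
  have := abs_sub_le Q (u ^ 2 / √2) (√2 * Real.cos σ / Real.sin σ ^ 2)
  have := abs_sub_le (u ^ 2 / √2) (√2 / Real.sin σ ^ 2) (√2 * Real.cos σ / Real.sin σ ^ 2)
  linarith

/-- Asymptotics of a solution of `U' = √(2E - U² + U⁴/2)` that blows up at `τ`. -/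
theorem blowup_asymptotics {U : ℝ → ℝ} {E τ : ℝ} (hU : Tendsto U (𝓝[<] τ) atTop)
    (hd : ∀ᶠ t in 𝓝[<] τ, HasDerivAt U (√(2 * E - U t ^ 2 + U t ^ 4 / 2)) t) :
    ∃ C, ∀ᶠ t in 𝓝[<] τ, |U t - √2 / Real.sin (τ - t)| ≤ C ∧
      |deriv U t - √2 * Real.cos (τ - t) / Real.sin (τ - t) ^ 2| ≤ C := by
  have h2 : (√2) ^ 2 = 2 := Real.sq_sqrt (by norm_num)
  have h2p : 0 < √2 := by positivity
  have h2u : √2 < 3 / 2 := by rw [Real.sqrt_lt' (by norm_num)]; norm_num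
  have h2l : 7 / 5 < √2 := by rw [Real.lt_sqrt (by norm_num)]; norm_num
  set L := √2 * (1 + 2 * |E|) with hL
  have hL1 : 1 ≤ L := by have := abs_nonneg E; nlinarith
  -- Beyond `4L` the radicand is positive, and with `w = 1/U` the error `L w²` is at most `1/(16L) ≤
  -- 1/4`.
  set N := 4 * L with hN
  obtain ⟨δ₀, hδ₀, H⟩ : ∃ l < τ, ∀ t ∈ Ioo l τ, N ≤ U t ∧
      HasDerivAt U (√(2 * E - U t ^ 2 + U t ^ 4 / 2)) t := by
    obtain ⟨l, hl, h⟩ := (mem_nhdsLT_iff_exists_Ioo_subset).1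
      ((hU.eventually_ge_atTop N).and hd)
    exact ⟨l, hl, h⟩
  set w : ℝ → ℝ := fun t => (U t)⁻¹ with hw
  have hw0 : Tendsto w (𝓝[<] τ) (𝓝 0) := hU.inv_tendsto_atTop
  have hPpos : ∀ v, N ≤ v → |√(2 * E - v ^ 2 + v ^ 4 / 2) - v ^ 2 / √2| ≤ L := by
    intro v hv
    have hv4 : 4 ≤ v := by linarith
    rcases abs_sqrt_radicand_sub_le (E := E) (v := v) (by linarith) with h | h
    · exact h
    · exfalso
      have : |E| * 2 ≤ v := by nlinarith [abs_nonneg E]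
      nlinarith [neg_abs_le E, sq_nonneg v, mul_self_nonneg (v ^ 2 - 4)]
  have hwd : ∀ t ∈ Ioo δ₀ τ,
      HasDerivAt w (-√(2 * E - U t ^ 2 + U t ^ 4 / 2) / U t ^ 2) t := fun t ht =>
    (H t ht).2.inv (by linarith [(H t ht).1])
  have hwk : ∀ t ∈ Ioo δ₀ τ,
      |-√(2 * E - U t ^ 2 + U t ^ 4 / 2) / U t ^ 2 + 1 / √2| ≤ L * w t ^ 2 := by
    intro t ht
    have hUp : 0 < U t := by linarith [(H t ht).1]
    have : -√(2 * E - U t ^ 2 + U t ^ 4 / 2) / U t ^ 2 + 1 / √2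
        = -((√(2 * E - U t ^ 2 + U t ^ 4 / 2) - U t ^ 2 / √2) * w t ^ 2) := by
      simp only [hw]; field_simp; ring
    rw [this, abs_neg, abs_mul, abs_of_nonneg (sq_nonneg (w t))]
    exact mul_le_mul_of_nonneg_right (hPpos _ (H t ht).1) (sq_nonneg _)
  -- Two passes: the crude error `1/4` makes `w` comparable to the time left, and inserting this
  -- into `L w²` improves the estimate to third order.
  have hcrude : ∀ t ∈ Ioo δ₀ τ, |(τ - t) * (1 / √2) - w t| ≤ 1 / 4 * (τ - t) := by
    intro t ht
    refine abs_sub_le_of_deriv_near ht.2 hw0 (fun y hy => hwd y ⟨ht.1.trans_le hy.1, hy.2⟩)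
      fun y hy => (hwk y ⟨ht.1.trans_le hy.1, hy.2⟩).trans ?_
    have hy' : N ≤ U y := (H y ⟨ht.1.trans_le hy.1, hy.2⟩).1
    have h1 : w y ≤ N⁻¹ := inv_anti₀ (by linarith) hy'
    have h0 : 0 ≤ w y := inv_nonneg.2 (by linarith)
    calc L * w y ^ 2 ≤ L * N⁻¹ ^ 2 := by gcongr
      _ = 1 / (16 * L) := by rw [hN]; field_simp; norm_num
      _ ≤ 1 / 4 := by rw [div_le_div_iff₀ (by linarith) (by norm_num)]; linarith
  have hk : 1 / √2 = √2 / 2 := by field_simp; linarith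
  have hwl : ∀ t ∈ Ioo δ₀ τ, 2 / 5 * (τ - t) ≤ w t ∧ w t ≤ τ - t := by
    intro t ht
    have h := abs_le.1 (hcrude t ht)
    rw [hk] at h
    have := ht.2
    constructor <;> nlinarith
  have hfine : ∀ t ∈ Ioo δ₀ τ, |(τ - t) * (1 / √2) - w t| ≤ L * (τ - t) ^ 2 * (τ - t) := by
    intro t ht
    refine abs_sub_le_of_deriv_near ht.2 hw0 (fun y hy => hwd y ⟨ht.1.trans_le hy.1, hy.2⟩)
      fun y hy => (hwk y ⟨ht.1.trans_le hy.1, hy.2⟩).trans ?_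
    have h1 := hwl y ⟨ht.1.trans_le hy.1, hy.2⟩
    have h3 : 0 ≤ w y := by linarith [hy.2]
    have h4 : w y ≤ τ - t := by linarith [hy.1]
    gcongr
  refine ⟨5 * (4 * L + 2) + L + 2, ?_⟩
  filter_upwards [Ioo_mem_nhdsLT hδ₀, Ioo_mem_nhdsLT (show τ - 1 < τ by linarith)] with t ht ht1
  set σ := τ - t with hσ
  have hσ0 : 0 < σ := by rw [hσ]; linarith [ht.2]
  have hσ1 : σ ≤ 1 := by rw [hσ]; linarith [ht1.1]
  obtain ⟨hw1, hw2⟩ := hwl t ht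
  rw [(H t ht).2.deriv]
  exact blowup_pointwise hσ0 hσ1 hL1 hw1 (by simp [hw]) (hfine t ht) (hPpos _ (H t ht).1)

/-- A solution `U` of `U'' + U = U³`, `U(0) = X`, `U'(0) = Y`, that blows up to `+∞` at the time
`τ < π`. -/
structure IsProfile (X Y ε τ : ℝ) (U : ℝ → ℝ) : Prop where
  eps_pos : 0 < ε
  pos : 0 < τ
  lt_pi : τ < Real.pi
  smooth : ContDiffOn ℝ ∞ U (Ioo (-ε) τ)
  ode : ∀ t ∈ Ioo (-ε) τ, HasDerivAt (deriv U) (U t ^ 3 - U t) t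
  init : U 0 = X
  init_deriv : deriv U 0 = Y
  bound : ∃ C, ∀ t ∈ Ico 0 τ, |U t - √2 / Real.sin (τ - t)| ≤ C ∧
    |deriv U t - √2 * Real.cos (τ - t) / Real.sin (τ - t) ^ 2| ≤ C

theorem exists_bound_Ico_of_eventually {g : ℝ → ℝ} {a b C : ℝ} (hg : ContinuousOn g (Ico a b))
    (hC : ∀ᶠ t in 𝓝[<] b, |g t| ≤ C) : ∃ C', ∀ t ∈ Ico a b, |g t| ≤ C' := by
  rcases le_or_gt b a with hab | hab
  · exact ⟨0, fun t ht => absurd (ht.1.trans_lt ht.2) (not_lt.2 hab)⟩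
  obtain ⟨l, hl, h⟩ := (mem_nhdsLT_iff_exists_Ioo_subset).1 hC
  obtain ⟨l', hl'⟩ := exists_between (show l < b from hl)
  obtain ⟨M, hM⟩ := (isCompact_Icc (a := a) (b := l')).exists_bound_of_continuousOn
    (hg.mono fun x hx => ⟨hx.1, hx.2.trans_lt hl'.2⟩)
  refine ⟨max C M, fun t ht => ?_⟩
  rcases le_or_gt t l' with h' | h'
  · exact (hM t ⟨ht.1, h'⟩).trans (le_max_right _ _)
  · exact (h ⟨hl'.1.trans h', ht.2⟩ : |g t| ≤ C).trans (le_max_left _ _)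

/-- The asymptotics hold near `τ`; on the rest of `[0, τ)` compactness suffices, as `sin (τ - t)`
has no zero there because `τ < π`. -/
theorem isProfile_of_blowup {X Y ε τ E : ℝ} {U : ℝ → ℝ} (hε : 0 < ε) (hτ : 0 < τ)
    (hπ : τ < Real.pi) (hsm : ContDiffOn ℝ ∞ U (Ioo (-ε) τ))
    (hode : ∀ t ∈ Ioo (-ε) τ, HasDerivAt (deriv U) (U t ^ 3 - U t) t) (h0 : U 0 = X)
    (h1 : deriv U 0 = Y) (hU : Tendsto U (𝓝[<] τ) atTop)
    (hd : ∀ᶠ t in 𝓝[<] τ, HasDerivAt U (√(2 * E - U t ^ 2 + U t ^ 4 / 2)) t) :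
    IsProfile X Y ε τ U := by
  refine ⟨hε, hτ, hπ, hsm, hode, h0, h1, ?_⟩
  obtain ⟨C, hC⟩ := blowup_asymptotics hU hd
  have hsub : Ico 0 τ ⊆ Ioo (-ε) τ := fun t ht => ⟨by linarith [ht.1], ht.2⟩
  have hUc : ContinuousOn U (Ico 0 τ) := hsm.continuousOn.mono hsub
  have hU'c : ContinuousOn (deriv U) (Ico 0 τ) := fun t ht =>
    (hode t (hsub ht)).continuousAt.continuousWithinAt
  have hsin : ∀ t ∈ Ico 0 τ, Real.sin (τ - t) ≠ 0 := fun t ht =>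
    (Real.sin_pos_of_pos_of_lt_pi (by linarith [ht.2]) (by linarith [ht.1])).ne'
  obtain ⟨C₁, h₁⟩ := exists_bound_Ico_of_eventually (a := 0)
    (g := fun t => U t - √2 / Real.sin (τ - t))
    (hUc.sub (ContinuousOn.div (by fun_prop) (by fun_prop) hsin)) (hC.mono fun t ht => ht.1)
  obtain ⟨C₂, h₂⟩ := exists_bound_Ico_of_eventually (a := 0)
    (g := fun t => deriv U t - √2 * Real.cos (τ - t) / Real.sin (τ - t) ^ 2)
    (hU'c.sub (ContinuousOn.div (by fun_prop) (by fun_prop) fun t ht => pow_ne_zero 2 (hsin t ht)))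
    (hC.mono fun t ht => ht.2)
  exact ⟨max C₁ C₂, fun t ht =>
    ⟨(h₁ t ht).trans (le_max_left _ _), (h₂ t ht).trans (le_max_right _ _)⟩⟩

/-! ### Quadrature for `U'² = 2E - U² + U⁴/2` -/

/-- The radicand `2E - v² + v⁴/2`, i.e. `(U')²` as a function of `U = v`. -/
def radicand (E v : ℝ) : ℝ := 2 * E - v ^ 2 + v ^ 4 / 2

theorem integrand_eq_ofReal {E v : ℝ} (h : 0 < radicand E v) :
    integrand E v = ENNReal.ofReal (√(radicand E v))⁻¹ := by
  rw [integrand, ENNReal.ofReal_inv_of_pos (Real.sqrt_pos.2 h)]; rfl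

theorem measurable_integrand (E : ℝ) : Measurable (integrand E) := by
  unfold integrand; fun_prop

theorem continuous_integrand_left (v : ℝ) : Continuous fun E => integrand E v := by
  unfold integrand
  exact (ENNReal.continuous_ofReal.comp (by fun_prop)).inv

theorem integrand_anti (v : ℝ) : Antitone fun E => integrand E v := by
  intro a b hab
  exact ENNReal.inv_le_inv.2 (ENNReal.ofReal_le_ofReal (Real.sqrt_le_sqrt (by linarith)))

/-- Change of variables in the quadrature integrals. -/
theorem lintegral_integrand_eq {E a b : ℝ} {g g' f : ℝ → ℝ} {S : Set ℝ} (hab : a ≤ b)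
    (hS : g '' Ioo a b = S) (hg : ∀ θ ∈ Ioo a b, HasDerivAt g (g' θ) θ)
    (hinj : InjOn g (Ioo a b)) (hfc : ContinuousOn f (Icc a b)) (hf : ∀ θ ∈ Icc a b, 0 < f θ)
    (hg' : ∀ θ ∈ Ioo a b, g' θ ≠ 0)
    (key : ∀ θ ∈ Ioo a b, √(radicand E (g θ)) = |g' θ| * f θ) :
    ∫⁻ v in S, integrand E v = ENNReal.ofReal (∫ θ in a..b, (f θ)⁻¹) := by
  have hint : IntegrableOn (fun θ => (f θ)⁻¹) (Icc a b) :=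
    (hfc.inv₀ fun θ hθ => (hf θ hθ).ne').integrableOn_compact isCompact_Icc
  rw [← hS, lintegral_image_eq_lintegral_abs_deriv_mul measurableSet_Ioo
    (fun θ hθ => (hg θ hθ).hasDerivWithinAt) hinj, intervalIntegral.integral_of_le hab,
    integral_Ioc_eq_integral_Ioo, ofReal_integral_eq_lintegral_ofReal
      (hint.mono_set Ioo_subset_Icc_self)]
  · refine setLIntegral_congr_fun measurableSet_Ioo fun θ hθ => ?_
    have hfp := hf θ (Ioo_subset_Icc_self hθ)
    have hgp : 0 < |g' θ| := abs_pos.2 (hg' θ hθ)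
    have hr : 0 < radicand E (g θ) := by
      rw [← Real.sqrt_pos, key θ hθ]; positivity
    rw [integrand_eq_ofReal hr, key θ hθ, ← ENNReal.ofReal_mul (abs_nonneg _)]
    congr 1
    field_simp
  · refine (ae_restrict_iff' measurableSet_Ioo).2 (Eventually.of_forall fun θ hθ => ?_)
    exact inv_nonneg.2 (hf θ (Ioo_subset_Icc_self hθ)).le

theorem hasDerivAt_radicand (E v : ℝ) : HasDerivAt (radicand E) (2 * (v ^ 3 - v)) v := by
  have : HasDerivAt (fun v => 2 * E - v ^ 2 + v ^ 4 / 2)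
      (0 - (2 : ℕ) * v ^ (2 - 1) + (4 : ℕ) * v ^ (4 - 1) / 2) v :=
    (((hasDerivAt_const v (2 * E)).sub (hasDerivAt_pow 2 v))).add
      ((hasDerivAt_pow 4 v).div_const 2)
  convert! this using 1
  push_cast; ring

theorem contDiff_radicand (E : ℝ) : ContDiff ℝ ∞ (radicand E) := by
  unfold radicand; fun_prop

theorem radicand_energy_self (X Y : ℝ) : radicand (energy X Y) X = Y ^ 2 := by
  unfold radicand energy; ring

/-! ### Monotone profiles: `U = tan θ` -/

/-- The square of the angular velocity of `U = tan θ`. -/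
def tanSpeedSq (E θ : ℝ) : ℝ :=
  (Real.sin θ ^ 4 - 2 * Real.sin θ ^ 2 * Real.cos θ ^ 2 + 4 * E * Real.cos θ ^ 4) / 2

theorem tanSpeedSq_eq {E θ : ℝ} (h : Real.cos θ ≠ 0) :
    tanSpeedSq E θ = Real.cos θ ^ 4 * radicand E (Real.tan θ) := by
  rw [tanSpeedSq, radicand, Real.tan_eq_sin_div_cos]
  field_simp
  ring

/-- At `θ = π/2` the value is `1/2`: infinity is a regular point in the variable `θ`, and the time
to reach it is a proper integral. -/
theorem tanSpeedSq_pos {E X : ℝ} (hP : ∀ v, X ≤ v → 0 < radicand E v) {θ : ℝ}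
    (hθ : θ ∈ Icc (Real.arctan X) (Real.pi / 2)) : 0 < tanSpeedSq E θ := by
  rcases eq_or_lt_of_le hθ.2 with h | h
  · rw [h, tanSpeedSq]; simp
  · have hc : 0 < Real.cos θ :=
      Real.cos_pos_of_mem_Ioo ⟨(Real.neg_pi_div_two_lt_arctan X).trans_le hθ.1, h⟩
    rw [tanSpeedSq_eq hc.ne']
    have : X ≤ Real.tan θ := by
      rw [← Real.tan_arctan X]
      rcases eq_or_lt_of_le hθ.1 with h' | h'
      · rw [h']
      · exact (Real.tan_lt_tan_of_lt_of_lt_pi_div_two (Real.neg_pi_div_two_lt_arctan X) h h').le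
    have := hP _ this
    positivity

theorem sqrt_radicand_tan {E θ : ℝ} (h : 0 < Real.cos θ) :
    √(radicand E (Real.tan θ)) = 1 / Real.cos θ ^ 2 * √(tanSpeedSq E θ) := by
  rw [tanSpeedSq_eq h.ne', Real.sqrt_mul (by positivity),
    show Real.cos θ ^ 4 = (Real.cos θ ^ 2) ^ 2 by ring, Real.sqrt_sq (by positivity)]
  field_simp

theorem image_tan_Ioo (X : ℝ) : Real.tan '' Ioo (Real.arctan X) (Real.pi / 2) = Ioi X := by
  ext v
  constructor
  · rintro ⟨θ, hθ, rfl⟩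
    rw [mem_Ioi]
    conv_lhs => rw [← Real.tan_arctan X]
    exact Real.tan_lt_tan_of_lt_of_lt_pi_div_two (Real.neg_pi_div_two_lt_arctan X) hθ.2 hθ.1
  · intro hv
    exact ⟨Real.arctan v, ⟨Real.arctan_strictMono hv, Real.arctan_lt_pi_div_two v⟩,
      Real.tan_arctan v⟩

theorem R_eq_of_radicand_pos {X Y : ℝ} (hP : ∀ v, X ≤ v → 0 < radicand (energy X Y) v) :
    R X Y = ENNReal.ofReal
      (∫ θ in (Real.arctan X)..(Real.pi / 2), (√(tanSpeedSq (energy X Y) θ))⁻¹) := by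
  have hcos : ∀ θ ∈ Ioo (Real.arctan X) (Real.pi / 2), 0 < Real.cos θ := fun θ hθ =>
    Real.cos_pos_of_mem_Ioo ⟨(Real.neg_pi_div_two_lt_arctan X).trans hθ.1, hθ.2⟩
  refine lintegral_integrand_eq (g' := fun θ => 1 / Real.cos θ ^ 2)
    (Real.arctan_lt_pi_div_two X).le (image_tan_Ioo X)
    (fun θ hθ => Real.hasDerivAt_tan (hcos θ hθ).ne') ?_ ?_ ?_ ?_ ?_
  · exact Real.injOn_tan.mono (Ioo_subset_Ioo_left (Real.neg_pi_div_two_lt_arctan X).le)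
  · unfold tanSpeedSq; fun_prop
  · exact fun θ hθ => Real.sqrt_pos.2 (tanSpeedSq_pos hP hθ)
  · exact fun θ hθ => by have := hcos θ hθ; positivity
  · intro θ hθ
    have := hcos θ hθ
    rw [sqrt_radicand_tan this, abs_of_pos (by positivity)]

/-- `θ = arctan U` moves with a speed that is positive up to and including `π/2`; it arrives there
at time `R`, and `U = tan θ` blows up. -/
theorem exists_isProfile_of_R_lt {X Y : ℝ} (hY : 0 < Y)
    (hP : ∀ v, X ≤ v → 0 < radicand (energy X Y) v) (hR : R X Y < ENNReal.ofReal Real.pi) :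
    ∃ ε τ U, IsProfile X Y ε τ U := by
  rw [R_eq_of_radicand_pos hP, ENNReal.ofReal_lt_ofReal_iff Real.pi_pos] at hR
  set E := energy X Y with hE
  have hgc : ContDiff ℝ ∞ (tanSpeedSq E) := by
    unfold tanSpeedSq
    exact ((((Real.contDiff_sin.pow 4).sub ((contDiff_const.mul (Real.contDiff_sin.pow 2)).mul
      (Real.contDiff_cos.pow 2))).add (contDiff_const.mul (Real.contDiff_cos.pow 4))).div_const 2)
  obtain ⟨hτ, θ, ε, hε, hmono, hcont, h0, h1, -, hd⟩ := exists_flow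
    (f := fun θ => √(tanSpeedSq E θ)) (s := {θ | -(Real.pi / 2) < θ} ∩ {θ | 0 < tanSpeedSq E θ})
    ((isOpen_Ioi).inter (isOpen_lt continuous_const hgc.continuous))
    (Real.arctan_lt_pi_div_two X)
    (fun θ hθ => ⟨(Real.neg_pi_div_two_lt_arctan X).trans_le hθ.1, tanSpeedSq_pos hP hθ⟩)
    (hgc.contDiffOn.sqrt fun θ hθ => hθ.2.ne')
    (fun θ hθ => Real.sqrt_pos.2 (tanSpeedSq_pos hP hθ))
  set τ := ∫ θ in (Real.arctan X)..(Real.pi / 2), (√(tanSpeedSq E θ))⁻¹ with hτd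
  have hsub : ∀ t ∈ Ioo (-ε) τ, t ∈ Ioo (-ε) (τ + ε) := fun t ht => ⟨ht.1, ht.2.trans (by linarith)⟩
  have hcos : ∀ t ∈ Ioo (-ε) τ, 0 < Real.cos (θ t) := fun t ht =>
    Real.cos_pos_of_mem_Ioo ⟨(hd t (hsub t ht)).1.1, by rw [← h1]; exact hmono ht.2⟩
  have hUd : ∀ t ∈ Ioo (-ε) τ, HasDerivAt (fun t => Real.tan (θ t))
      (√(radicand E (Real.tan (θ t)))) t := fun t ht => by
    rw [sqrt_radicand_tan (hcos t ht)]
    exact (Real.hasDerivAt_tan (hcos t ht).ne').comp t (hd t (hsub t ht)).2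
  have hrad : ∀ t ∈ Ioo (-ε) τ, 0 < radicand E (Real.tan (θ t)) := fun t ht => by
    have h := (hd t (hsub t ht)).1.2
    rw [mem_ofPred_eq, tanSpeedSq_eq (hcos t ht).ne'] at h
    exact pos_of_mul_pos_right h (by have := hcos t ht; positivity)
  have h0m : (0 : ℝ) ∈ Ioo (-ε) τ := ⟨by linarith, hτ⟩
  refine ⟨ε, τ, fun t => Real.tan (θ t), isProfile_of_blowup (E := E) hε hτ hR ?_ ?_ ?_ ?_ ?_ ?_⟩
  · exact contDiffOn_of_hasDerivAt_comp (f := fun v => √(radicand E v)) (s := {v | 0 < radicand E v})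
      isOpen_Ioo ((contDiff_radicand E).contDiffOn.sqrt fun v hv => ne_of_gt hv) hrad hUd
  · intro t ht
    have h : deriv (fun t => Real.tan (θ t)) =ᶠ[𝓝 t] fun t => √(radicand E (Real.tan (θ t))) := by
      filter_upwards [isOpen_Ioo.mem_nhds ht] with y hy using (hUd y hy).deriv
    refine HasDerivAt.congr_of_eventuallyEq ?_ h
    -- With `P` the radicand, differentiating `U' = √P(U)` gives `U'' = P'(U)/2 = U³ - U`; the root
    -- can be divided out because `P` is positive along the orbit.
    have h2 := ((hasDerivAt_radicand E _).comp t (hUd t ht)).sqrt (hrad t ht).ne'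
    convert! h2 using 1
    have := Real.sqrt_pos.2 (hrad t ht)
    simp only [Function.comp]
    field_simp
  · simp [h0]
  · rw [(hUd 0 h0m).deriv, h0, Real.tan_arctan, hE, radicand_energy_self, Real.sqrt_sq hY.le]
  · refine Real.tendsto_tan_pi_div_two.comp ?_
    refine tendsto_nhdsWithin_iff.2 ⟨?_, ?_⟩
    · rw [← h1]; exact hcont.continuousAt.tendsto.mono_left nhdsWithin_le_nhds
    · filter_upwards [self_mem_nhdsWithin] with t ht
      rw [mem_Iio, ← h1]; exact hmono ht
  · filter_upwards [Ioo_mem_nhdsLT (show -ε < τ by linarith)] with t ht using hUd t ht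

/-! ### Profiles with a turning point: `U = m / cos θ` -/

/-- The square of the angular velocity of `U = m / cos θ`. -/
def secSpeedSq (m θ : ℝ) : ℝ := (m ^ 2 - (2 - m ^ 2) * Real.cos θ ^ 2) / 2

/-- The angular speed does not vanish at the turning point `θ = 0`: the zero of `U'` is carried by
the factor `sin θ`. A single regular flow therefore covers descent and ascent. -/
theorem secSpeedSq_pos {m : ℝ} (hm : 1 < m) (θ : ℝ) : 0 < secSpeedSq m θ := by
  have h1 := Real.cos_sq_le_one θ
  have h2 := sq_nonneg (Real.cos θ)
  have h3 : 1 < m ^ 2 := one_lt_pow₀ hm two_ne_zero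
  unfold secSpeedSq
  nlinarith

theorem contDiff_secSpeedSq (m : ℝ) : ContDiff ℝ ∞ (secSpeedSq m) := by
  unfold secSpeedSq
  exact (contDiff_const.sub (contDiff_const.mul (Real.contDiff_cos.pow 2))).div_const 2

/-- The energy `m²/2 - m⁴/4` is that of a state at rest at `m`. The radicand then factors as `(v² -
m²)(v² + m² - 2)/2`, and for `v = m / cos θ` the first factor is `m² tan² θ`. -/
theorem radicand_sec {m θ : ℝ} (h : Real.cos θ ≠ 0) :
    radicand (m ^ 2 / 2 - m ^ 4 / 4) (m / Real.cos θ)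
      = (m * Real.sin θ / Real.cos θ ^ 2) ^ 2 * secSpeedSq m θ := by
  rw [radicand, secSpeedSq, div_pow, div_pow, div_pow, mul_pow, Real.sin_sq]
  field_simp
  ring

theorem sqrt_radicand_sec {m θ : ℝ} (h : Real.cos θ ≠ 0) :
    √(radicand (m ^ 2 / 2 - m ^ 4 / 4) (m / Real.cos θ))
      = |m * Real.sin θ / Real.cos θ ^ 2| * √(secSpeedSq m θ) := by
  rw [radicand_sec h, Real.sqrt_mul (sq_nonneg _), Real.sqrt_sq_eq_abs]

theorem hasDerivAt_sec {m θ : ℝ} (h : Real.cos θ ≠ 0) :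
    HasDerivAt (fun θ => m / Real.cos θ) (m * Real.sin θ / Real.cos θ ^ 2) θ := by
  have := (hasDerivAt_const θ m).div (Real.hasDerivAt_cos θ) h
  convert! this using 1
  ring

theorem image_sec_Ioo {m : ℝ} (hm : 0 < m) :
    (fun θ => m / Real.cos θ) '' Ioo 0 (Real.pi / 2) = Ioi m := by
  ext v
  constructor
  · rintro ⟨θ, hθ, rfl⟩
    have hc : 0 < Real.cos θ := Real.cos_pos_of_mem_Ioo ⟨by linarith [hθ.1, Real.pi_pos], hθ.2⟩
    have h1 : Real.cos θ < 1 := by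
      rw [← Real.cos_zero]
      exact Real.cos_lt_cos_of_nonneg_of_le_pi_div_two le_rfl hθ.2.le hθ.1
    simp only [mem_Ioi]
    rw [lt_div_iff₀ hc]; nlinarith
  · intro hv
    have hv' : m < v := hv
    have hv0 : 0 < v := hm.trans hv'
    refine ⟨Real.arccos (m / v), ⟨Real.arccos_pos.2 ((div_lt_one hv0).2 hv'),
      Real.arccos_lt_pi_div_two.2 (by positivity)⟩, ?_⟩
    have : 0 < m / v := by positivity
    simp only
    rw [Real.cos_arccos (by linarith) ((div_lt_one hv0).2 hv').le]
    field_simp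

theorem image_sec_Ioo_neg {m X : ℝ} (hm : 0 < m) (hX : m ≤ X) :
    (fun θ => m / Real.cos θ) '' Ioo (-Real.arccos (m / X)) 0 = Ioo m X := by
  have hX0 : 0 < X := hm.trans_le hX
  have hmX : 0 < m / X := by positivity
  have hmX1 : m / X ≤ 1 := (div_le_one hX0).2 hX
  have hac := Real.arccos_lt_pi_div_two.2 hmX
  ext v
  constructor
  · rintro ⟨θ, hθ, rfl⟩
    have hc : 0 < Real.cos θ :=
      Real.cos_pos_of_mem_Ioo ⟨by linarith [hθ.1], by linarith [hθ.2, Real.pi_pos]⟩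
    have h1 : Real.cos (-θ) < 1 := by
      rw [← Real.cos_zero]
      exact Real.cos_lt_cos_of_nonneg_of_le_pi_div_two le_rfl (by linarith [hθ.1])
        (by linarith [hθ.2])
    have h2 : m / X < Real.cos (-θ) := by
      rw [← Real.cos_arccos (x := m / X) (by linarith) hmX1]
      exact Real.cos_lt_cos_of_nonneg_of_le_pi_div_two (by linarith [hθ.2]) hac.le
        (by linarith [hθ.1])
    rw [Real.cos_neg] at h1 h2
    simp only [mem_Ioo]
    rw [lt_div_iff₀ hc, div_lt_iff₀ hc]
    rw [div_lt_iff₀ hX0] at h2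
    constructor <;> nlinarith
  · rintro ⟨hv, hvX⟩
    have hv0 : 0 < v := hm.trans hv
    have h1 : m / v < 1 := (div_lt_one hv0).2 hv
    have h0 : 0 < m / v := by positivity
    refine ⟨-Real.arccos (m / v), ⟨neg_lt_neg ?_, neg_lt_zero.2 (Real.arccos_pos.2 h1)⟩, ?_⟩
    · exact Real.arccos_lt_arccos (by linarith)
        (div_lt_div_of_pos_left hm hv0 hvX) h1.le
    · simp only
      rw [Real.cos_neg, Real.cos_arccos (by linarith) h1.le]
      field_simp

/-- The time `U = m / cos θ` takes to blow up, starting from the angle `a`. -/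
def secTime (m a : ℝ) : ℝ := ∫ θ in a..(Real.pi / 2), (√(secSpeedSq m θ))⁻¹

theorem continuous_inv_sqrt_secSpeedSq {m : ℝ} (hm : 1 < m) :
    Continuous fun θ => (√(secSpeedSq m θ))⁻¹ :=
  ((contDiff_secSpeedSq m).continuous.sqrt).inv₀
    fun θ => (Real.sqrt_pos.2 (secSpeedSq_pos hm θ)).ne'

theorem sec_injOn_right {m : ℝ} (hm : 0 < m) :
    InjOn (fun θ => m / Real.cos θ) (Ioo 0 (Real.pi / 2)) := by
  intro x hx y hy h
  have h1 : 0 < Real.cos x := Real.cos_pos_of_mem_Ioo ⟨by linarith [hx.1, Real.pi_pos], hx.2⟩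
  have h2 : 0 < Real.cos y := Real.cos_pos_of_mem_Ioo ⟨by linarith [hy.1, Real.pi_pos], hy.2⟩
  simp only at h
  rw [div_eq_div_iff h1.ne' h2.ne'] at h
  exact Real.injOn_cos ⟨hx.1.le, by linarith [hx.2, Real.pi_pos]⟩
    ⟨hy.1.le, by linarith [hy.2, Real.pi_pos]⟩ (mul_left_cancel₀ hm.ne' h).symm

theorem sec_injOn_left {m : ℝ} (hm : 0 < m) :
    InjOn (fun θ => m / Real.cos θ) (Ioo (-(Real.pi / 2)) 0) := by
  intro x hx y hy h
  have := sec_injOn_right hm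
    (show -x ∈ Ioo 0 (Real.pi / 2) from ⟨by linarith [hx.2], by linarith [hx.1]⟩)
    (show -y ∈ Ioo 0 (Real.pi / 2) from ⟨by linarith [hy.2], by linarith [hy.1]⟩)
    (by simpa using h)
  exact neg_injective this

theorem lintegral_Ioi_sec {m : ℝ} (hm : 1 < m) :
    ∫⁻ v in Ioi m, integrand (m ^ 2 / 2 - m ^ 4 / 4) v = ENNReal.ofReal (secTime m 0) := by
  have hcos : ∀ θ ∈ Ioo 0 (Real.pi / 2), 0 < Real.cos θ := fun θ hθ =>
    Real.cos_pos_of_mem_Ioo ⟨by linarith [hθ.1, Real.pi_pos], hθ.2⟩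
  refine lintegral_integrand_eq (g' := fun θ => m * Real.sin θ / Real.cos θ ^ 2)
    (f := fun θ => √(secSpeedSq m θ)) (by linarith [Real.pi_pos]) (image_sec_Ioo (by linarith))
    (fun θ hθ => hasDerivAt_sec (hcos θ hθ).ne') (sec_injOn_right (by linarith))
    (contDiff_secSpeedSq m).continuous.sqrt.continuousOn
    (fun θ _ => Real.sqrt_pos.2 (secSpeedSq_pos hm θ)) ?_
    (fun θ hθ => sqrt_radicand_sec (hcos θ hθ).ne')
  intro θ hθ
  have h1 := hcos θ hθ
  have h2 := Real.sin_pos_of_pos_of_lt_pi hθ.1 (by linarith [hθ.2, Real.pi_pos])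
  have : 0 < m := by linarith
  positivity

theorem lintegral_Ioo_sec {m X : ℝ} (hm : 1 < m) (hX : m ≤ X) :
    ∫⁻ v in Ioo m X, integrand (m ^ 2 / 2 - m ^ 4 / 4) v =
      ENNReal.ofReal (∫ θ in (-Real.arccos (m / X))..0, (√(secSpeedSq m θ))⁻¹) := by
  have hX0 : 0 < X := by linarith
  have hac := Real.arccos_lt_pi_div_two.2 (show 0 < m / X by positivity)
  have hcos : ∀ θ ∈ Ioo (-Real.arccos (m / X)) 0, 0 < Real.cos θ := fun θ hθ =>
    Real.cos_pos_of_mem_Ioo ⟨by linarith [hθ.1], by linarith [hθ.2, Real.pi_pos]⟩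
  refine lintegral_integrand_eq (g' := fun θ => m * Real.sin θ / Real.cos θ ^ 2)
    (f := fun θ => √(secSpeedSq m θ)) (by linarith [Real.arccos_nonneg (m / X)])
    (image_sec_Ioo_neg (by linarith) hX)
    (fun θ hθ => hasDerivAt_sec (hcos θ hθ).ne')
    ((sec_injOn_left (by linarith)).mono (Ioo_subset_Ioo_left (by linarith)))
    (contDiff_secSpeedSq m).continuous.sqrt.continuousOn
    (fun θ _ => Real.sqrt_pos.2 (secSpeedSq_pos hm θ)) ?_
    (fun θ hθ => sqrt_radicand_sec (hcos θ hθ).ne')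
  intro θ hθ
  have h1 := hcos θ hθ
  have h2 := Real.sin_neg_of_neg_of_neg_pi_lt hθ.2 (by linarith [hθ.1, Real.pi_pos])
  have : 0 < m := by linarith
  exact div_ne_zero (mul_ne_zero this.ne' h2.ne) (by positivity)

theorem R_zero_eq {m : ℝ} (hm : 1 < m) : R m 0 = ENNReal.ofReal (secTime m 0) := by
  rw [← lintegral_Ioi_sec hm, R, energy]
  norm_num

theorem sqrt_turning {m : ℝ} (hm : 1 < m) :
    √(1 + √(1 - 4 * (m ^ 2 / 2 - m ^ 4 / 4))) = m := by
  have h3 : 1 < m ^ 2 := one_lt_pow₀ hm two_ne_zero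
  rw [show 1 - 4 * (m ^ 2 / 2 - m ^ 4 / 4) = (m ^ 2 - 1) ^ 2 by ring,
    Real.sqrt_sq (by linarith), show 1 + (m ^ 2 - 1) = m ^ 2 by ring, Real.sqrt_sq (by linarith)]

/-- The descent from `X` to `m` is the angular range from `-arccos (m/X)` to `0`, the ascent to
infinity the range from `0` to `π/2`; the two integrals join into one. -/
theorem S_eq {m X Y : ℝ} (hm : 1 < m) (hX : m ≤ X) (hE : energy X Y = m ^ 2 / 2 - m ^ 4 / 4) :
    S X Y = ENNReal.ofReal (secTime m (-Real.arccos (m / X))) := by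
  have hc := continuous_inv_sqrt_secSpeedSq hm
  have hnn : ∀ θ, 0 ≤ (√(secSpeedSq m θ))⁻¹ := fun θ => inv_nonneg.2 (Real.sqrt_nonneg _)
  have hle : 4 * energy X Y ≤ 1 := by rw [hE]; nlinarith [sq_nonneg (m ^ 2 - 1)]
  rw [S, if_pos hle, hE, sqrt_turning hm, abs_of_pos (by linarith), uIoc_of_le hX,
    setLIntegral_congr Ioo_ae_eq_Ioc.symm, lintegral_Ioo_sec hm hX, lintegral_Ioi_sec hm,
    ← ENNReal.ofReal_add, secTime, secTime,
    intervalIntegral.integral_add_adjacent_intervals (hc.intervalIntegrable _ _)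
      (hc.intervalIntegrable _ _)]
  · exact intervalIntegral.integral_nonneg (by linarith [Real.arccos_nonneg (m / X)])
      fun θ _ => hnn θ
  · exact intervalIntegral.integral_nonneg (by linarith [Real.pi_pos]) fun θ _ => hnn θ

/-- The initial angle is taken nonpositive because `U'` has the sign of `sin θ` and `Y ≤ 0`; the
energy fixes only the square of the velocity. -/
theorem exists_isProfile_of_secTime_lt {m X Y : ℝ} (hm : 1 < m) (hX : m ≤ X) (hY : Y ≤ 0)
    (hE : energy X Y = m ^ 2 / 2 - m ^ 4 / 4)
    (hT : secTime m (-Real.arccos (m / X)) < Real.pi) : ∃ ε τ U, IsProfile X Y ε τ U := by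
  have hX0 : 0 < X := by linarith
  have hmX : 0 < m / X := by positivity
  have hmX1 : m / X ≤ 1 := (div_le_one hX0).2 hX
  have hac := Real.arccos_lt_pi_div_two.2 hmX
  have hac0 := Real.arccos_nonneg (m / X)
  have hpi := Real.pi_pos
  set a := -Real.arccos (m / X) with ha
  have hgd : ∀ θ, HasDerivAt (secSpeedSq m) ((2 - m ^ 2) * Real.cos θ * Real.sin θ) θ := fun θ => by
    have : HasDerivAt (fun θ => (m ^ 2 - (2 - m ^ 2) * Real.cos θ ^ 2) / 2)
        ((0 - (2 - m ^ 2) * ((2 : ℕ) * Real.cos θ ^ (2 - 1) * -Real.sin θ)) / 2) θ :=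
      ((hasDerivAt_const θ (m ^ 2)).sub (((Real.hasDerivAt_cos θ).pow 2).const_mul _)).div_const 2
    convert! this using 1
    push_cast; ring
  obtain ⟨hτ, θ, ε, hε, hmono, hcont, h0, h1, hsm, hd⟩ := exists_flow
    (f := fun θ => √(secSpeedSq m θ)) (s := Ioi (-(Real.pi / 2))) isOpen_Ioi
    (a := a) (b := Real.pi / 2) (by linarith) (fun θ hθ => (by linarith : _ < a).trans_le hθ.1)
    ((contDiff_secSpeedSq m).contDiffOn.sqrt fun θ _ => (secSpeedSq_pos hm θ).ne')
    (fun θ _ => Real.sqrt_pos.2 (secSpeedSq_pos hm θ))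
  change 0 < secTime m a at hτ
  change θ (secTime m a) = _ at h1
  change ContDiffOn ℝ ∞ θ (Ioo (-ε) (secTime m a + ε)) at hsm
  change ∀ t ∈ Ioo (-ε) (secTime m a + ε), _ at hd
  set τ := secTime m a with hτd
  have hsub : ∀ t ∈ Ioo (-ε) τ, t ∈ Ioo (-ε) (τ + ε) := fun t ht => ⟨ht.1, ht.2.trans (by linarith)⟩
  have hcos : ∀ t ∈ Ioo (-ε) τ, 0 < Real.cos (θ t) := fun t ht =>
    Real.cos_pos_of_mem_Ioo ⟨(hd t (hsub t ht)).1, by rw [← h1]; exact hmono ht.2⟩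
  have hUd : ∀ t ∈ Ioo (-ε) τ, HasDerivAt (fun t => m / Real.cos (θ t))
      (m * Real.sin (θ t) / Real.cos (θ t) ^ 2 * √(secSpeedSq m (θ t))) t := fun t ht =>
    (hasDerivAt_sec (hcos t ht).ne').comp t (hd t (hsub t ht)).2
  have h0m : (0 : ℝ) ∈ Ioo (-ε) τ := ⟨by linarith, hτ⟩
  have hlim : Tendsto θ (𝓝[<] τ) (𝓝 (Real.pi / 2)) := by
    rw [← h1]; exact hcont.continuousAt.tendsto.mono_left nhdsWithin_le_nhds
  refine ⟨ε, τ, fun t => m / Real.cos (θ t), isProfile_of_blowup (E := m ^ 2 / 2 - m ^ 4 / 4)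
    hε hτ hT ?_ ?_ ?_ ?_ ?_ ?_⟩
  · exact contDiffOn_const.div (Real.contDiff_cos.comp_contDiffOn (hsm.mono hsub))
      fun t ht => (hcos t ht).ne'
  · intro t ht
    have h : deriv (fun t => m / Real.cos (θ t)) =ᶠ[𝓝 t]
        fun t => m * Real.sin (θ t) / Real.cos (θ t) ^ 2 * √(secSpeedSq m (θ t)) := by
      filter_upwards [isOpen_Ioo.mem_nhds ht] with y hy using (hUd y hy).deriv
    refine HasDerivAt.congr_of_eventuallyEq ?_ h
    have hg := secSpeedSq_pos hm (θ t)
    have hc := hcos t ht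
    have e1 : HasDerivAt (fun x => m * Real.sin x / Real.cos x ^ 2 * √(secSpeedSq m x))
        ((m * Real.cos (θ t) * Real.cos (θ t) ^ 2 - m * Real.sin (θ t) *
          ((2 : ℕ) * Real.cos (θ t) ^ (2 - 1) * -Real.sin (θ t))) / (Real.cos (θ t) ^ 2) ^ 2
          * √(secSpeedSq m (θ t)) + m * Real.sin (θ t) / Real.cos (θ t) ^ 2 *
          ((2 - m ^ 2) * Real.cos (θ t) * Real.sin (θ t) / (2 * √(secSpeedSq m (θ t))))) (θ t) :=
      (((Real.hasDerivAt_sin _).const_mul m).div ((Real.hasDerivAt_cos _).pow 2)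
        (pow_ne_zero 2 hc.ne')).mul ((hgd _).sqrt hg.ne')
    have h2 := e1.comp t (hd t (hsub t ht)).2
    convert! h2 using 1
    have hq := Real.sqrt_pos.2 hg
    have hq2 : √(secSpeedSq m (θ t)) ^ 2 = secSpeedSq m (θ t) := Real.sq_sqrt hg.le
    have hs2 := Real.sin_sq (θ t)
    generalize √(secSpeedSq m (θ t)) = q at *
    rw [secSpeedSq] at hq2
    generalize Real.cos (θ t) = c at *
    generalize Real.sin (θ t) = s at *
    push_cast
    field_simp
    have hm4 : q ^ 2 = (m ^ 2 - (2 - m ^ 2) * c ^ 2) / 2 := hq2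
    rw [hm4, hs2]
    ring
  · rw [h0, ha, Real.cos_neg, Real.cos_arccos (by linarith) hmX1]
    field_simp
  · have hca : Real.cos a = m / X := by rw [ha, Real.cos_neg, Real.cos_arccos (by linarith) hmX1]
    have hca0 : Real.cos a ≠ 0 := by rw [hca]; positivity
    have hX' : m / Real.cos a = X := by rw [hca]; field_simp
    have hsin : Real.sin a ≤ 0 := by
      rw [ha, Real.sin_neg]
      exact neg_nonpos.2 (Real.sin_nonneg_of_nonneg_of_le_pi hac0 (Real.arccos_le_pi _))
    have hr := sqrt_radicand_sec (m := m) hca0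
    rw [hX', ← hE, radicand_energy_self, Real.sqrt_sq_eq_abs, abs_of_nonpos hY,
      abs_of_nonpos (div_nonpos_of_nonpos_of_nonneg
        (mul_nonpos_of_nonneg_of_nonpos (by linarith) hsin) (sq_nonneg _))] at hr
    rw [(hUd 0 h0m).deriv, h0]
    linarith
  · have h3 : Tendsto (fun t => Real.cos (θ t)) (𝓝[<] τ) (𝓝[>] 0) := by
      refine tendsto_nhdsWithin_iff.2 ⟨?_, ?_⟩
      · rw [← Real.cos_pi_div_two]
        exact Real.continuous_cos.continuousAt.tendsto.comp hlim
      · filter_upwards [Ioo_mem_nhdsLT (show -ε < τ by linarith)] with t ht using hcos t ht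
    exact (h3.inv_tendsto_nhdsGT_zero).const_mul_atTop (show 0 < m by linarith)
  · filter_upwards [Ioo_mem_nhdsLT (show -ε < τ by linarith),
      hlim.eventually (lt_mem_nhds (show 0 < Real.pi / 2 by linarith))] with t ht ht0
    have hlt : θ t < Real.pi / 2 := by rw [← h1]; exact hmono ht.2
    have hs := Real.sin_pos_of_pos_of_lt_pi ht0 (by linarith)
    have := hcos t ht
    change HasDerivAt _ (√(radicand (m ^ 2 / 2 - m ^ 4 / 4) (m / Real.cos (θ t)))) t
    rw [sqrt_radicand_sec this.ne', abs_of_pos (by have : 0 < m := by linarith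
                                                   positivity)]
    exact hUd t ht

/-! ### Monotonicity and intermediate values of `R(X, ·)` -/

theorem energy_mono {X Y Y' : ℝ} (h0 : 0 ≤ Y) (h : Y ≤ Y') : energy X Y ≤ energy X Y' := by
  unfold energy; nlinarith

theorem R_anti {X Y Y' : ℝ} (h0 : 0 ≤ Y) (h : Y ≤ Y') : R X Y' ≤ R X Y :=
  lintegral_mono fun v => integrand_anti v (energy_mono h0 h)

theorem radicand_pos_of_one_lt {X Y : ℝ} (hX : 1 < X) (hY : 0 < Y) :
    ∀ v, X ≤ v → 0 < radicand (energy X Y) v := by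
  intro v hv
  have h1 : 1 < X ^ 2 := one_lt_pow₀ hX two_ne_zero
  have h2 : X ^ 2 ≤ v ^ 2 := by gcongr
  have : radicand (energy X Y) v = Y ^ 2 + (v ^ 2 - X ^ 2) * (v ^ 2 + X ^ 2 - 2) / 2 := by
    unfold radicand energy; ring
  rw [this]
  have : 0 ≤ (v ^ 2 - X ^ 2) * (v ^ 2 + X ^ 2 - 2) :=
    mul_nonneg (by linarith) (by linarith)
  positivity

/-- Completing the square gives `((v² - 1)² + 4E - 1)/2`. -/
theorem radicand_pos_of_energy {E : ℝ} (hE : 1 < 4 * E) (v : ℝ) : 0 < radicand E v := by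
  unfold radicand
  nlinarith [sq_nonneg (v ^ 2 - 1)]

theorem tendsto_integrand_atTop (v : ℝ) : Tendsto (fun E => integrand E v) atTop (𝓝 0) := by
  have h1 : Tendsto (fun E : ℝ => 2 * E - v ^ 2 + v ^ 4 / 2) atTop atTop :=
    tendsto_atTop_add_const_right _ _ (tendsto_atTop_add_const_right _ _
      (tendsto_id.const_mul_atTop two_pos))
  have h2 := ENNReal.tendsto_ofReal_atTop.comp (Real.tendsto_sqrt_atTop.comp h1)
  have h3 := h2.inv
  rw [ENNReal.inv_top] at h3
  exact h3

theorem continuous_energy (X : ℝ) : Continuous (energy X) := by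
  unfold energy; fun_prop

/-- Intermediate value theorem for `R(X, ·)`. -/
theorem exists_R_eq_pi {X Y₀ : ℝ} (h0 : 0 ≤ Y₀) (hπ : ENNReal.ofReal Real.pi ≤ R X Y₀)
    (hfin : ∀ Y > Y₀, R X Y < ⊤) :
    (∃ Y ≥ Y₀, R X Y = ENNReal.ofReal Real.pi) ∧
      ∃ Y > Y₀, R X Y < ENNReal.ofReal Real.pi := by
  have hlarge : ∃ Y > Y₀, R X Y < ENNReal.ofReal Real.pi := by
    have h1 : Tendsto (fun Y => R X Y) atTop (𝓝 (∫⁻ v in Ioi X, 0)) := by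
      refine tendsto_lintegral_filter_of_dominated_convergence (integrand (energy X (Y₀ + 1)))
        (Eventually.of_forall fun Y => measurable_integrand _) ?_ (hfin _ (by linarith)).ne ?_
      · filter_upwards [eventually_ge_atTop (Y₀ + 1)] with Y hY
        exact Eventually.of_forall fun v => integrand_anti v (energy_mono (by linarith) hY)
      · refine Eventually.of_forall fun v => (tendsto_integrand_atTop v).comp ?_
        unfold energy
        refine tendsto_atTop_add_const_right _ _ (tendsto_atTop_add_const_right _ _ ?_)
        exact (tendsto_pow_atTop two_ne_zero).atTop_div_const two_pos
    rw [lintegral_zero] at h1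
    have h2 := (h1.eventually (gt_mem_nhds (ENNReal.ofReal_pos.2 Real.pi_pos))).and
      (eventually_gt_atTop Y₀)
    obtain ⟨Y, hY, hY'⟩ := h2.exists
    exact ⟨Y, hY', hY⟩
  refine ⟨?_, hlarge⟩
  rcases eq_or_lt_of_le hπ with h | hlt
  · exact ⟨Y₀, le_rfl, h.symm⟩
  obtain ⟨Y₂, hY₂, hR₂⟩ := hlarge
  -- Approaching `Y₀` from the right requires monotone rather than dominated convergence, since `R X
  -- Y₀` may be infinite.
  obtain ⟨Y₁, hY₁, hR₁⟩ : ∃ Y > Y₀, ENNReal.ofReal Real.pi < R X Y := by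
    have h1 : Tendsto (fun n : ℕ => R X (Y₀ + 1 / ((n : ℝ) + 1))) atTop (𝓝 (R X Y₀)) := by
      have hlim : Tendsto (fun n : ℕ => Y₀ + 1 / ((n : ℝ) + 1)) atTop (𝓝 Y₀) := by
        simpa using (tendsto_one_div_add_atTop_nhds_zero_nat (𝕜 := ℝ)).const_add Y₀
      refine lintegral_tendsto_of_tendsto_of_monotone
        (fun n => (measurable_integrand _).aemeasurable) ?_ ?_
      · refine Eventually.of_forall fun v i j hij => integrand_anti v (energy_mono (by positivity) ?_)
        have := Nat.one_div_le_one_div (α := ℝ) hij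
        linarith
      · refine Eventually.of_forall fun v => ?_
        exact ((continuous_integrand_left v).continuousAt.tendsto.comp
          ((continuous_energy X).continuousAt.tendsto.comp hlim))
    obtain ⟨n, hn⟩ := (h1.eventually (lt_mem_nhds hlt)).exists
    exact ⟨_, by have : 0 < 1 / ((n : ℝ) + 1) := by positivity
                 linarith, hn⟩
  have hcont : ContinuousOn (fun Y => R X Y) (Ioi Y₀) := by
    intro Y hY
    refine ContinuousAt.continuousWithinAt ?_
    obtain ⟨Y', hY'⟩ := exists_between (show Y₀ < Y from hY)
    refine tendsto_lintegral_filter_of_dominated_convergence (integrand (energy X Y'))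
        (Eventually.of_forall fun Y => measurable_integrand _) ?_ (hfin _ hY'.1).ne ?_
    · filter_upwards [lt_mem_nhds hY'.2] with Z hZ
      exact Eventually.of_forall fun v => integrand_anti v
        (energy_mono (h0.trans hY'.1.le) hZ.le)
    · exact Eventually.of_forall fun v =>
        ((continuous_integrand_left v).comp (continuous_energy X)).continuousAt
  have h12 : Y₁ ≤ Y₂ := by
    by_contra! hcon
    exact absurd (R_anti (X := X) (h0.trans hY₂.le) hcon.le) (not_le.2 (hR₂.trans hR₁))
  obtain ⟨Y, hY, hRY⟩ := isPreconnected_Icc.intermediate_value₂ (left_mem_Icc.2 h12)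
    (right_mem_Icc.2 h12) continuousOn_const (hcont.mono fun y hy => hY₁.trans_le hy.1)
    hR₁.le hR₂.le
  exact ⟨Y, hY₁.le.trans hY.1, hRY.symm⟩

/-- The time is nonincreasing in `Y ≥ 0` and equals `π` somewhere at or above `Y₀`. Beyond the
supremum it is therefore at most `π`, and equality would contradict the supremum; uniqueness of the
threshold plays no role. -/
theorem exists_isProfile_of_sSup_lt {X Y Y₀ : ℝ} (h0 : 0 ≤ Y₀)
    (hπ : ENNReal.ofReal Real.pi ≤ R X Y₀)
    (hpos : ∀ Y > Y₀, ∀ v, X ≤ v → 0 < radicand (energy X Y) v)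
    (hY : sSup {Y : ℝ | 0 ≤ Y ∧ R X Y = ENNReal.ofReal Real.pi} < Y) :
    ∃ ε τ U, IsProfile X Y ε τ U := by
  obtain ⟨⟨Y₁, h₁, hR₁⟩, Y₂, h₂, hR₂⟩ := exists_R_eq_pi h0 hπ fun Y hY => by
    rw [R_eq_of_radicand_pos (hpos Y hY)]; exact ENNReal.ofReal_lt_top
  have hb : BddAbove {Y : ℝ | 0 ≤ Y ∧ R X Y = ENNReal.ofReal Real.pi} := by
    refine ⟨Y₂, fun Z hZ => ?_⟩
    by_contra! hcon
    exact absurd (R_anti (X := X) (h0.trans h₂.le) hcon.le) (not_le.2 (hR₂.trans_eq hZ.2.symm))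
  have hY₁ : Y₁ < Y := (le_csSup hb ⟨h0.trans h₁, hR₁⟩).trans_lt hY
  have hY0 : 0 < Y := by linarith
  refine exists_isProfile_of_R_lt hY0 (hpos Y (by linarith)) (lt_of_le_of_ne ?_ ?_)
  · rw [← hR₁]; exact R_anti (h0.trans h₁) hY₁.le
  · exact fun hcon => absurd (le_csSup hb ⟨hY0.le, hcon⟩) (not_le.2 hY)

/-! ### The time to blow-up from a turning point, as a function of the turning point -/

theorem continuousOn_secTime {m₀ : ℝ} (hm₀ : 1 < m₀) {a : ℝ → ℝ} (ha : Continuous a) :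
    ContinuousOn (fun m => secTime m (a m)) (Ici m₀) := by
  -- Replacing `m` by `max m₀ m` keeps the speed positive for every parameter, so the integrand is
  -- jointly continuous on the whole plane.
  have h1 : Continuous (Function.uncurry fun m θ : ℝ => (√(secSpeedSq (max m₀ m) θ))⁻¹) := by
    refine Continuous.inv₀ ?_ fun p =>
      (Real.sqrt_pos.2 (secSpeedSq_pos (hm₀.trans_le (le_max_left _ _)) _)).ne'
    unfold secSpeedSq
    fun_prop
  have h2 := intervalIntegral.continuous_parametric_primitive_of_continuous
    (μ := volume) (a₀ := Real.pi / 2) h1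
  have h3 : Continuous fun m => -∫ θ in (Real.pi / 2)..(a m), (√(secSpeedSq (max m₀ m) θ))⁻¹ :=
    (h2.comp (continuous_id.prodMk ha)).neg
  refine h3.continuousOn.congr fun m hm => ?_
  simp only
  rw [max_eq_right hm, secTime, intervalIntegral.integral_symm]

/-- A larger turning point raises the speed at every angle, and a later start shortens the range. -/
theorem secTime_anti {m m' a a' : ℝ} (hm : 1 < m) (hmm : m ≤ m') (ha : a ≤ a')
    (ha' : a' ≤ Real.pi / 2) : secTime m' a' ≤ secTime m a := by
  have hc := continuous_inv_sqrt_secSpeedSq hm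
  have h1 : secTime m' a' ≤ secTime m a' := by
    refine intervalIntegral.integral_mono_on ha'
      ((continuous_inv_sqrt_secSpeedSq (hm.trans_le hmm)).intervalIntegrable _ _)
      (hc.intervalIntegrable _ _) fun θ _ => ?_
    refine inv_anti₀ (Real.sqrt_pos.2 (secSpeedSq_pos hm θ)) (Real.sqrt_le_sqrt ?_)
    have : m ^ 2 ≤ m' ^ 2 := by gcongr
    unfold secSpeedSq
    nlinarith [sq_nonneg (Real.cos θ)]
  refine h1.trans ?_
  rw [secTime, secTime, ← intervalIntegral.integral_add_adjacent_intervals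
    (hc.intervalIntegrable a a') (hc.intervalIntegrable a' _)]
  have := intervalIntegral.integral_nonneg ha (μ := volume)
    fun θ _ => inv_nonneg.2 (Real.sqrt_nonneg (secSpeedSq m θ))
  linarith

theorem R_zero_eq_pi_iff {X : ℝ} (hX : 1 < X) :
    R X 0 = ENNReal.ofReal Real.pi ↔ secTime X 0 = Real.pi := by
  rw [R_zero_eq hX, ENNReal.ofReal_eq_ofReal_iff _ Real.pi_pos.le]
  exact intervalIntegral.integral_nonneg (by linarith [Real.pi_pos])
    fun θ _ => inv_nonneg.2 (Real.sqrt_nonneg _)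

/-- At `m = 1` the speed is `|sin θ|/√2` and the time diverges logarithmically. For `m² = 1 + η²/2`
the speed on `[0, 1]` is at most `(θ + η)/√2`, so the time is at least `√2 log (1/η)`; the choice `η
= e⁻³` makes this `3√2 > π`. -/
theorem exists_pi_lt_secTime : ∃ m, 1 < m ∧ m ≤ 2 ∧ Real.pi < secTime m 0 := by
  set η := Real.exp (-3) with hη
  have hη0 : 0 < η := Real.exp_pos _
  have hη1 : η < 1 := by rw [hη, Real.exp_lt_one_iff]; norm_num
  have hm2 : √(1 + η ^ 2 / 2) ^ 2 = 1 + η ^ 2 / 2 := Real.sq_sqrt (by positivity)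
  have hm : 1 < √(1 + η ^ 2 / 2) := by
    rw [Real.lt_sqrt (by norm_num)]; nlinarith
  refine ⟨√(1 + η ^ 2 / 2), hm, ?_, ?_⟩
  · rw [Real.sqrt_le_left (by norm_num)]; nlinarith
  set m := √(1 + η ^ 2 / 2)
  have hc := continuous_inv_sqrt_secSpeedSq hm
  have h2p : 0 < √2 := by positivity
  have h2 : (√2) ^ 2 = 2 := Real.sq_sqrt (by norm_num)
  have h2l : 7 / 5 < √2 := by rw [Real.lt_sqrt (by norm_num)]; norm_num
  have hpi := Real.pi_gt_three
  have hpi' := Real.pi_lt_d2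
  have h1 : ∫ θ in (0 : ℝ)..1, √2 * (θ + η)⁻¹ = √2 * Real.log ((1 + η) / η) := by
    rw [intervalIntegral.integral_const_mul,
      intervalIntegral.integral_comp_add_right (fun x => x⁻¹) η, zero_add,
      integral_inv_of_pos hη0 (by linarith)]
  have h3 : ∫ θ in (0 : ℝ)..1, √2 * (θ + η)⁻¹ ≤ ∫ θ in (0 : ℝ)..1, (√(secSpeedSq m θ))⁻¹ := by
    refine intervalIntegral.integral_mono_on zero_le_one ?_ (hc.intervalIntegrable _ _) ?_
    · refine ContinuousOn.intervalIntegrable ?_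
      refine continuousOn_const.mul (ContinuousOn.inv₀ (by fun_prop) fun θ hθ => ?_)
      rw [uIcc_of_le zero_le_one] at hθ
      linarith [hθ.1]
    · intro θ hθ
      have hθ0 : 0 < θ + η := by linarith [hθ.1]
      rw [show √2 * (θ + η)⁻¹ = ((θ + η) / √2)⁻¹ by rw [inv_div]; rfl]
      refine inv_anti₀ (Real.sqrt_pos.2 (secSpeedSq_pos hm θ)) ?_
      rw [Real.sqrt_le_left (by positivity), div_pow, h2, secSpeedSq, hm2]
      have hs : Real.sin θ ^ 2 ≤ θ ^ 2 := by
        rw [sq_le_sq]; exact Real.abs_sin_le_abs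
      have hcs := Real.sin_sq_add_cos_sq θ
      have := mul_nonneg hθ.1 hη0.le
      have h4 := Real.cos_sq_le_one θ
      nlinarith [mul_le_mul_of_nonneg_left h4 (sq_nonneg η)]
  have h4 : 3 ≤ Real.log ((1 + η) / η) := by
    rw [Real.log_div (by linarith) hη0.ne', hη, Real.log_exp]
    have := Real.log_nonneg (show 1 ≤ 1 + Real.exp (-3) by linarith)
    linarith
  have h5 : 0 ≤ ∫ θ in (1 : ℝ)..(Real.pi / 2), (√(secSpeedSq m θ))⁻¹ :=
    intervalIntegral.integral_nonneg (by linarith) fun θ _ => inv_nonneg.2 (Real.sqrt_nonneg _)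
  rw [secTime, ← intervalIntegral.integral_add_adjacent_intervals
    (hc.intervalIntegrable 0 1) (hc.intervalIntegrable 1 _)]
  nlinarith

theorem secTime_two_lt : secTime 2 0 < Real.pi := by
  have hpi := Real.pi_pos
  have : secTime 2 0 ≤ ∫ _ in (0 : ℝ)..(Real.pi / 2), (1 : ℝ) := by
    refine intervalIntegral.integral_mono_on (by linarith)
      ((continuous_inv_sqrt_secSpeedSq one_lt_two).intervalIntegrable _ _)
      (continuous_const.intervalIntegrable _ _) fun θ _ => ?_
    refine inv_le_one_of_one_le₀ ?_
    rw [Real.one_le_sqrt, secSpeedSq]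
    nlinarith [sq_nonneg (Real.cos θ)]
  rw [intervalIntegral.integral_const] at this
  simp only [sub_zero, smul_eq_mul, mul_one] at this
  linarith

/-- The defining set is a level set of a continuous function on the compact interval `[m₀, 2]`,
nonempty by the intermediate value theorem, so its supremum is attained. -/
theorem criticalX_mem : 1 < criticalX ∧ secTime criticalX 0 = Real.pi := by
  obtain ⟨m₀, hm₀, hm₀2, hK⟩ := exists_pi_lt_secTime
  have hset : {X : ℝ | 1 < X ∧ R X 0 = ENNReal.ofReal Real.pi}
      = Icc m₀ 2 ∩ (fun m => secTime m 0) ⁻¹' {Real.pi} := by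
    ext X
    constructor
    · rintro ⟨hX, hR⟩
      have hR' := (R_zero_eq_pi_iff hX).1 hR
      refine ⟨⟨?_, ?_⟩, hR'⟩ <;> by_contra! hcon
      · have := secTime_anti hX hcon.le le_rfl (a := 0) (by linarith [Real.pi_pos])
        linarith
      · have := secTime_anti one_lt_two hcon.le le_rfl (a := 0) (by linarith [Real.pi_pos])
        linarith [secTime_two_lt]
    · rintro ⟨hX, hR⟩
      have hX1 : 1 < X := hm₀.trans_le hX.1
      exact ⟨hX1, by rw [R_zero_eq hX1, show secTime X 0 = Real.pi from hR]⟩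
  have hc := (continuousOn_secTime hm₀ (a := fun _ => 0) continuous_const).mono
    (fun x (hx : x ∈ Icc m₀ 2) => hx.1)
  have hne : (Icc m₀ 2 ∩ (fun m => secTime m 0) ⁻¹' {Real.pi}).Nonempty := by
    obtain ⟨m, hm, h⟩ := isPreconnected_Icc.intermediate_value₂ (left_mem_Icc.2 hm₀2)
      (right_mem_Icc.2 hm₀2) continuousOn_const hc hK.le secTime_two_lt.le
    exact ⟨m, hm, h.symm⟩
  have hcl : IsClosed (Icc m₀ 2 ∩ (fun m => secTime m 0) ⁻¹' {Real.pi}) :=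
    hc.preimage_isClosed_of_isClosed isClosed_Icc isClosed_singleton
  have hmem := hcl.csSup_mem hne ⟨2, fun x hx => hx.1.2⟩
  rw [← hset] at hmem
  change criticalX ∈ _ at hmem
  rw [hset] at hmem
  exact ⟨hm₀.trans_le hmem.1.1, hmem.2⟩

/-! ### Existence of a profile above the threshold -/

/-- At energy `1/4` the radicand is `(v² - 1)²/2`, and just above its double zero `v = 1` the
integrand dominates a multiple of `1/(v - 1)`. -/
theorem R_eq_top_of_le_one {X Y : ℝ} (hX : X ≤ 1) (hE : energy X Y = 1 / 4) : R X Y = ⊤ := by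
  by_contra hcon
  have h1 : ∫⁻ v in Ioo (1 : ℝ) 2, ENNReal.ofReal ((v - 1)⁻¹) ≤
      ENNReal.ofReal 3 * R X Y := by
    rw [R, ← lintegral_const_mul _ (measurable_integrand _)]
    refine (setLIntegral_mono' measurableSet_Ioo fun v hv => ?_).trans
      (lintegral_mono_set fun v hv => hX.trans_lt hv.1)
    have hr : radicand (energy X Y) v = (v ^ 2 - 1) ^ 2 / 2 := by rw [hE, radicand]; ring
    have hv1 : 0 < v - 1 := by linarith [hv.1]
    have hpos : 0 < radicand (energy X Y) v := by
      have : 0 < v ^ 2 - 1 := by nlinarith [hv.1]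
      rw [hr]; positivity
    rw [integrand_eq_ofReal hpos, ← ENNReal.ofReal_mul (by norm_num)]
    refine ENNReal.ofReal_le_ofReal ?_
    rw [show 3 * (√(radicand (energy X Y) v))⁻¹ = (√(radicand (energy X Y) v) / 3)⁻¹ by
      rw [inv_div]; rfl]
    refine inv_anti₀ (by have := Real.sqrt_pos.2 hpos; positivity) ?_
    rw [div_le_iff₀ (by norm_num), Real.sqrt_le_left (by linarith), hr]
    have h3 : (v ^ 2 - 1) ^ 2 = ((v - 1) * (v + 1)) ^ 2 := by ring
    have h4 : ((v - 1) * (v + 1)) ^ 2 ≤ ((v - 1) * 3) ^ 2 := by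
      have := hv.1
      gcongr
      linarith [hv.2]
    nlinarith [sq_nonneg (v - 1)]
  have h2 : IntegrableOn (fun v : ℝ => (v - 1)⁻¹) (Ioo 1 2) := by
    refine ⟨by measurability, ?_⟩
    rw [hasFiniteIntegral_iff_ofReal ((ae_restrict_iff' measurableSet_Ioo).2
      (Eventually.of_forall fun v hv => inv_nonneg.2 (by linarith [hv.1])))]
    exact h1.trans_lt (ENNReal.mul_lt_top ENNReal.ofReal_lt_top (lt_top_iff_ne_top.2 hcon))
  have h3 : IntervalIntegrable (fun v : ℝ => (v - 1)⁻¹) volume 1 2 := by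
    rw [intervalIntegrable_iff_integrableOn_Ioo_of_le one_le_two]
    exact h2
  rw [intervalIntegrable_sub_inv_iff] at h3
  rcases h3 with h | h
  · norm_num at h
  · exact h left_mem_uIcc

theorem exists_isProfile {X Y : ℝ} (h : threshold X < Y) : ∃ ε τ U, IsProfile X Y ε τ U := by
  obtain ⟨hC1, hCπ⟩ := criticalX_mem
  have hpi := Real.pi_pos
  unfold threshold at h
  split_ifs at h with hX
  · rcases le_or_gt X 1 with hX1 | hX1
    · have hx : 0 ≤ 1 - X ^ 2 ∨ 0 ≤ X ^ 2 - 1 := by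
        rcases le_total (X ^ 2) 1 with h | h
        · left; linarith
        · right; linarith
      -- The velocity `|1 - X²|/√2` puts the state on the level `E = 1/4` of the equilibrium `U =
      -- 1`; above this level the radicand has no zero.
      have hE : energy X √((1 - X ^ 2) ^ 2 / 2) = 1 / 4 := by
        rw [energy, Real.sq_sqrt (by positivity)]; ring
      refine exists_isProfile_of_sSup_lt (Real.sqrt_nonneg ((1 - X ^ 2) ^ 2 / 2)) ?_ ?_ h
      · rw [R_eq_top_of_le_one hX1 hE]; exact le_top
      · intro Y hY v _
        refine radicand_pos_of_energy ?_ v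
        have h1 : √((1 - X ^ 2) ^ 2 / 2) ^ 2 < Y ^ 2 :=
          pow_lt_pow_left₀ hY (Real.sqrt_nonneg _) two_ne_zero
        unfold energy at hE ⊢
        linarith
    · refine exists_isProfile_of_sSup_lt le_rfl ?_ (fun Y hY => radicand_pos_of_one_lt hX1 hY) h
      rw [R_zero_eq hX1]
      refine ENNReal.ofReal_le_ofReal ?_
      rw [← hCπ]
      exact secTime_anti hX1 hX le_rfl (by linarith)
  · rw [not_le] at hX
    have hX1 : 1 < X := hC1.trans hX
    have hX0 : 0 < X := by linarith
    have hKX : secTime X 0 < Real.pi := by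
      refine lt_of_le_of_ne ?_ fun hcon => ?_
      · rw [← hCπ]
        exact secTime_anti hC1 hX.le le_rfl (by linarith)
      · refine absurd (le_csSup ⟨2, ?_⟩ (show X ∈ {X : ℝ | 1 < X ∧ R X 0 = ENNReal.ofReal Real.pi}
          from ⟨hX1, by rw [R_zero_eq hX1, hcon]⟩)) (not_le.2 hX)
        rintro Z ⟨hZ, hR⟩
        by_contra! hcon
        have := secTime_anti one_lt_two hcon.le le_rfl (a := 0) (by linarith)
        have hR' := (R_zero_eq_pi_iff hZ).1 hR
        linarith [secTime_two_lt]
    rcases lt_or_ge 0 Y with hY | hY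
    · refine exists_isProfile_of_R_lt hY (radicand_pos_of_one_lt hX1 hY)
        ((R_anti le_rfl hY.le).trans_lt ?_)
      rw [R_zero_eq hX1, ENNReal.ofReal_lt_ofReal_iff hpi]
      exact hKX
    obtain ⟨m₀, hm₀, -, hK⟩ := exists_pi_lt_secTime
    have hm₀X : m₀ ≤ X := by
      by_contra! hcon
      have := secTime_anti hX1 hcon.le le_rfl (a := 0) (by linarith)
      linarith
    have hJX : secTime X (-Real.arccos (X / X)) < Real.pi := by
      rw [div_self hX0.ne', Real.arccos_one, neg_zero]; exact hKX
    have hJm₀ : Real.pi < secTime m₀ (-Real.arccos (m₀ / X)) :=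
      hK.trans_le (secTime_anti hm₀ le_rfl (by linarith [Real.arccos_nonneg (m₀ / X)])
        (by linarith))
    -- For fixed `X`, descending states are parametrised by their turning point. The state with
    -- turning point `m'` blows up exactly at time `π`, so its velocity belongs to the set whose
    -- supremum is the threshold.
    obtain ⟨m', hm', hJm'⟩ := isPreconnected_Icc.intermediate_value₂ (left_mem_Icc.2 hm₀X)
      (right_mem_Icc.2 hm₀X) continuousOn_const
      ((continuousOn_secTime hm₀ (a := fun m => -Real.arccos (m / X))
        (Real.continuous_arccos.comp (by fun_prop)).neg).mono fun x hx => hx.1) hJm₀.le hJX.le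
    have hm'1 : 1 < m' := hm₀.trans_le hm'.1
    have hm'2 : 1 < m' ^ 2 := one_lt_pow₀ hm'1 two_ne_zero
    have hm'X : m' < X := lt_of_le_of_ne hm'.2 fun hcon => by rw [hcon] at hJm'; linarith
    have hm'X2 : m' ^ 2 < X ^ 2 := by gcongr
    have hrad : 0 < radicand (m' ^ 2 / 2 - m' ^ 4 / 4) X := by
      rw [show radicand (m' ^ 2 / 2 - m' ^ 4 / 4) X
        = (X ^ 2 - m' ^ 2) * (X ^ 2 + m' ^ 2 - 2) / 2 by unfold radicand; ring]
      have : 0 < (X ^ 2 - m' ^ 2) * (X ^ 2 + m' ^ 2 - 2) :=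
        mul_pos (by linarith) (by linarith)
      positivity
    have hE' : energy X (-√(radicand (m' ^ 2 / 2 - m' ^ 4 / 4) X)) = m' ^ 2 / 2 - m' ^ 4 / 4 := by
      rw [energy, neg_sq, Real.sq_sqrt hrad.le, radicand]; ring
    have hbdd : BddAbove {Y : ℝ | Y < 0 ∧ S X Y = ENNReal.ofReal Real.pi} :=
      ⟨0, fun y hy => hy.1.le⟩
    have hY' : -√(radicand (m' ^ 2 / 2 - m' ^ 4 / 4) X) < Y :=
      (le_csSup hbdd ⟨neg_lt_zero.2 (Real.sqrt_pos.2 hrad), by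
        rw [S_eq hm'1 hm'X.le hE', ← hJm']⟩).trans_lt h
    -- Among nonpositive velocities a larger `Y` means less energy, hence a higher turning point and
    -- an earlier blow-up.
    have hEY : energy X Y < m' ^ 2 / 2 - m' ^ 4 / 4 := by
      rw [← hE']; unfold energy; nlinarith
    have h4E : (m' ^ 2 - 1) ^ 2 < 1 - 4 * energy X Y := by nlinarith
    set q := √(1 - 4 * energy X Y) with hq
    have hq2 : q ^ 2 = 1 - 4 * energy X Y := Real.sq_sqrt (by nlinarith)
    have hqm : m' ^ 2 - 1 < q := by
      rw [hq, Real.lt_sqrt (by linarith)]; exact h4E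
    set m := √(1 + q) with hm
    have hm2 : m ^ 2 = 1 + q := Real.sq_sqrt (by linarith)
    have hm'm : m' ≤ m := by rw [hm]; exact Real.le_sqrt_of_sq_le (by linarith)
    have hEm : energy X Y = m ^ 2 / 2 - m ^ 4 / 4 := by
      rw [show m ^ 4 = (m ^ 2) ^ 2 by ring, hm2]; linarith
    have hm1 : 1 < m := hm'1.trans_le hm'm
    have hmX : m ≤ X := by
      have h1 : q ≤ X ^ 2 - 1 := by
        rw [hq, Real.sqrt_le_left (by nlinarith), energy]
        nlinarith [sq_nonneg Y]
      exact (sq_le_sq₀ (Real.sqrt_nonneg _) hX0.le).1 (by linarith)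
    have hle : secTime m (-Real.arccos (m / X)) ≤ Real.pi := by
      rw [hJm']
      refine secTime_anti hm'1 hm'm (neg_le_neg (Real.arccos_le_arccos (by gcongr))) ?_
      linarith [Real.arccos_nonneg (m / X)]
    refine exists_isProfile_of_secTime_lt hm1 hmX hY hEm (lt_of_le_of_ne hle fun hcon => ?_)
    -- A time equal to `π` is excluded by the supremum when `Y < 0`. When `Y = 0` the motion starts
    -- at its turning point `m = X`, whose time is already known to be shorter.
    rcases eq_or_lt_of_le hY with h0 | h0
    · have : q = X ^ 2 - 1 := by
        rw [hq, show 1 - 4 * energy X Y = (X ^ 2 - 1) ^ 2 by rw [h0, energy]; ring,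
          Real.sqrt_sq (by nlinarith)]
      have hmX' : m = X := by
        rw [hm, this, show 1 + (X ^ 2 - 1) = X ^ 2 by ring, Real.sqrt_sq hX0.le]
      rw [hmX'] at hcon
      linarith
    · exact absurd (le_csSup hbdd ⟨h0, by rw [S_eq hm1 hmX hEm, hcon]⟩) (not_le.2 h)

/-! ### The Penrose transform -/

/-- With `q = |x|²`, the number `(1 + (t + |x|)²) (1 + (t - |x|)²)`. -/
def confS (t q : ℝ) : ℝ := (1 - t ^ 2 + q) ^ 2 + 4 * t ^ 2

/-- The conformal factor of the Penrose transform, with `q = |x|²`. -/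
def confFactor (t q : ℝ) : ℝ := 2 / √(confS t q)

/-- The conformal time `arctan (t + |x|) + arctan (t - |x|)`, with `q = |x|²`. -/
def confTime (t q : ℝ) : ℝ := 2 * Real.arctan (2 * t / (√(confS t q) + (1 - t ^ 2 + q)))

theorem confS_pos {t q : ℝ} (hq : 0 ≤ q) : 0 < confS t q := by
  have : confS t q = (1 + t ^ 2 - q) ^ 2 + 4 * q := by unfold confS; ring
  rcases eq_or_lt_of_le hq with h | h
  · rw [this, ← h, sub_zero]; positivity
  · rw [this]; positivity

theorem sqrt_confS_sq {t q : ℝ} (hq : 0 ≤ q) : √(confS t q) ^ 2 = confS t q :=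
  Real.sq_sqrt (confS_pos hq).le

theorem sqrt_confS_pos {t q : ℝ} (hq : 0 ≤ q) : 0 < √(confS t q) := Real.sqrt_pos.2 (confS_pos hq)

/-- Also `S = (1 + t² - q)² + 4q`, hence `√S ≥ 1 + t² - q`. The denominator in the half-angle form
of the conformal time thus never vanishes, which makes that time smooth at every `(t, x)`. -/
theorem two_le_sqrt_confS_add {t q : ℝ} (hq : 0 ≤ q) : 2 ≤ √(confS t q) + (1 - t ^ 2 + q) := by
  have : |1 + t ^ 2 - q| ≤ √(confS t q) := by
    refine Real.abs_le_sqrt ?_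
    unfold confS; nlinarith
  linarith [le_abs_self (1 + t ^ 2 - q)]

theorem confFactor_pos {t q : ℝ} (hq : 0 ≤ q) : 0 < confFactor t q :=
  div_pos two_pos (sqrt_confS_pos hq)

theorem confFactor_sq_mul {t q : ℝ} (hq : 0 ≤ q) : confFactor t q ^ 2 * confS t q = 4 := by
  have := sqrt_confS_pos (t := t) hq
  rw [confFactor, div_pow, sqrt_confS_sq hq, div_mul_cancel₀ _ (confS_pos hq).ne']
  norm_num

/-- Differentiation is along a curve in `(t, q)`, so that one computation serves the time derivative
and the derivatives along coordinate lines. -/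
theorem hasDerivAt_confS {t q : ℝ → ℝ} {t' q' σ : ℝ} (ht : HasDerivAt t t' σ)
    (hq : HasDerivAt q q' σ) : HasDerivAt (fun σ => confS (t σ) (q σ))
      (2 * ((1 - t σ ^ 2 + q σ) * (-2 * t σ * t' + q')) + 8 * t σ * t') σ := by
  have := ((((ht.pow 2).const_sub 1).add hq).pow 2).add ((ht.pow 2).const_mul 4)
  convert! this using 1
  simp only [Pi.add_apply, Pi.pow_apply]
  push_cast; ring

theorem hasDerivAt_confFactor {t q : ℝ → ℝ} {t' q' σ : ℝ} (ht : HasDerivAt t t' σ)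
    (hq : HasDerivAt q q' σ) (h0 : 0 ≤ q σ) :
    HasDerivAt (fun σ => confFactor (t σ) (q σ))
      (-confFactor (t σ) (q σ) ^ 3 *
        ((1 - t σ ^ 2 + q σ) * (-2 * t σ * t' + q') + 4 * t σ * t') / 4) σ := by
  have hD := sqrt_confS_pos (t := t σ) h0
  have := (hasDerivAt_const σ (2 : ℝ)).div ((hasDerivAt_confS ht hq).sqrt (confS_pos h0).ne') hD.ne'
  convert! this using 1
  rw [confFactor]
  field_simp
  ring

theorem confTime_deriv_identity {D A t t' A' : ℝ} (hD : 0 < D) (hDA : 0 < D + A)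
    (h : D ^ 2 = A ^ 2 + 4 * t ^ 2) :
    (2 / D) ^ 2 * (A * t' - t * A') / 2 = 2 * (1 / (1 + (2 * t / (D + A)) ^ 2) *
      ((2 * t' * (D + A) - 2 * t * ((2 * (A * A') + 8 * t * t') / (2 * D) + A')) / (D + A) ^ 2)) := by
  have hN : 1 + (2 * t / (D + A)) ^ 2 = 2 * D / (D + A) := by
    field_simp
    linear_combination -h
  rw [hN]
  field_simp
  linear_combination (-2 * t') * h

theorem hasDerivAt_confTime {t q : ℝ → ℝ} {t' q' σ : ℝ} (ht : HasDerivAt t t' σ)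
    (hq : HasDerivAt q q' σ) (h0 : 0 ≤ q σ) :
    HasDerivAt (fun σ => confTime (t σ) (q σ))
      (confFactor (t σ) (q σ) ^ 2 *
        ((1 - t σ ^ 2 + q σ) * t' - t σ * (-2 * t σ * t' + q')) / 2) σ := by
  have hD := sqrt_confS_pos (t := t σ) h0
  have hD2 := sqrt_confS_sq (t := t σ) h0
  have hden := two_le_sqrt_confS_add (t := t σ) h0
  have h1 : HasDerivAt (fun σ => √(confS (t σ) (q σ)) + (1 - t σ ^ 2 + q σ)) _ σ :=
    ((hasDerivAt_confS ht hq).sqrt (confS_pos h0).ne').add (((ht.pow 2).const_sub 1).add hq)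
  have := ((((ht.const_mul 2).div h1 (by linarith)).arctan).const_mul 2)
  convert! this using 1
  simp only [Pi.div_apply]
  rw [confFactor, confTime_deriv_identity hD (by linarith) (by rw [hD2, confS])]
  push_cast
  ring_nf

theorem sin_confTime {t q : ℝ} (hq : 0 ≤ q) : Real.sin (confTime t q) = t * confFactor t q := by
  have hD := sqrt_confS_pos (t := t) hq
  have hD2 := sqrt_confS_sq (t := t) hq
  have hden := two_le_sqrt_confS_add (t := t) hq
  have hden0 : √(confS t q) + (1 - t ^ 2 + q) ≠ 0 := by linarith
  rw [confTime, Real.sin_two_mul, Real.sin_arctan, Real.cos_arctan, confFactor]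
  rw [show ∀ y : ℝ, 2 * (y / √(1 + y ^ 2)) * (1 / √(1 + y ^ 2)) = 2 * y / √(1 + y ^ 2) ^ 2 by
    intro y; field_simp, Real.sq_sqrt (by positivity)]
  have : 1 + (2 * t / (√(confS t q) + (1 - t ^ 2 + q))) ^ 2
      = 2 * √(confS t q) / (√(confS t q) + (1 - t ^ 2 + q)) := by
    field_simp
    rw [confS] at *
    linear_combination -hD2
  rw [this]
  field_simp

theorem cos_confTime {t q : ℝ} (hq : 0 ≤ q) :
    Real.cos (confTime t q) = (1 - t ^ 2 + q) * confFactor t q / 2 := by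
  have hD := sqrt_confS_pos (t := t) hq
  have hD2 := sqrt_confS_sq (t := t) hq
  have hden := two_le_sqrt_confS_add (t := t) hq
  have hden0 : √(confS t q) + (1 - t ^ 2 + q) ≠ 0 := by linarith
  rw [confTime, Real.cos_two_mul, Real.cos_sq_arctan, confFactor]
  have : 1 + (2 * t / (√(confS t q) + (1 - t ^ 2 + q))) ^ 2
      = 2 * √(confS t q) / (√(confS t q) + (1 - t ^ 2 + q)) := by
    field_simp
    rw [confS] at *
    linear_combination -hD2
  rw [this]
  field_simp
  ring

theorem confTime_nonneg {t q : ℝ} (hq : 0 ≤ q) (ht : 0 ≤ t) : 0 ≤ confTime t q := by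
  have hden := two_le_sqrt_confS_add (t := t) hq
  exact mul_nonneg two_pos.le (Real.arctan_nonneg.2 (div_nonneg (by linarith) (by linarith)))

/-- The bound is the value at the origin, the denominator being at least `2`. Consequently no point
has conformal time `τ` before `t = tan (τ/2)`. -/
theorem confTime_le {t q : ℝ} (hq : 0 ≤ q) (ht : 0 ≤ t) : confTime t q ≤ 2 * Real.arctan t := by
  have hden := two_le_sqrt_confS_add (t := t) hq
  refine mul_le_mul_of_nonneg_left (Real.arctan_mono ?_) two_pos.le
  rw [div_le_iff₀ (by linarith)]
  nlinarith

theorem confTime_neg (t q : ℝ) : confTime (-t) q = -confTime t q := by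
  unfold confTime confS
  rw [neg_sq, mul_neg, neg_div, Real.arctan_neg, mul_neg]

theorem two_mul_arctan_tan_half {τ : ℝ} (h0 : 0 < τ) (hπ : τ < Real.pi) :
    2 * Real.arctan (Real.tan (τ / 2)) = τ := by
  rw [Real.arctan_tan (by linarith) (by linarith)]; ring

theorem confTime_mem {ε τ t q : ℝ} (hε : 0 < ε) (hε' : ε < Real.pi) (hτ : 0 < τ)
    (hτ' : τ < Real.pi) (hq : 0 ≤ q) (ht : t ∈ Ioo (-Real.tan (ε / 2)) (Real.tan (τ / 2))) :
    confTime t q ∈ Ioo (-ε) τ := by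
  rcases le_total 0 t with h | h
  · refine ⟨by linarith [confTime_nonneg hq h], (confTime_le hq h).trans_lt ?_⟩
    rw [← two_mul_arctan_tan_half hτ hτ']
    exact mul_lt_mul_of_pos_left (Real.arctan_strictMono ht.2) two_pos
  · have h1 := confTime_nonneg hq (neg_nonneg.2 h)
    have h2 := confTime_le hq (neg_nonneg.2 h)
    have h3 : 2 * Real.arctan (-t) < ε := by
      rw [← two_mul_arctan_tan_half hε hε']
      exact mul_lt_mul_of_pos_left (Real.arctan_strictMono (by linarith [ht.1])) two_pos
    rw [confTime_neg] at h1 h2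
    exact ⟨by linarith, by linarith⟩

/-! ### The Laplacian in coordinates -/

theorem laplacian_eq_sum_fderiv {f : Space → ℝ} {x : Space} (hf : ContDiffAt ℝ 2 f x) :
    Δ f x = ∑ i : Fin 3, fderiv ℝ (fun y => fderiv ℝ f y (EuclideanSpace.single i 1)) x
      (EuclideanSpace.single i 1) := by
  rw [InnerProductSpace.laplacian_eq_iteratedFDeriv_orthonormalBasis f
    (EuclideanSpace.basisFun (Fin 3) ℝ)]
  refine Finset.sum_congr rfl fun i _ => ?_
  rw [iteratedFDeriv_two_apply]
  have hd : DifferentiableAt ℝ (fderiv ℝ f) x :=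
    (hf.fderiv_right (m := 1) (by norm_num)).differentiableAt one_ne_zero
  rw [fderiv_clm_apply hd (differentiableAt_const _)]
  simp

theorem fderiv_apply_eq_of_hasDerivAt {f : Space → ℝ} {x v : Space} {c : ℝ}
    (hf : DifferentiableAt ℝ f x) (h : HasDerivAt (fun σ : ℝ => f (x + σ • v)) c 0) :
    fderiv ℝ f x v = c := by
  rw [← hf.lineDeriv_eq_fderiv]
  exact h.deriv

/-! ### The solution -/

/-- The Penrose transform of the spatially homogeneous solution `U`. -/
def penrose (U : ℝ → ℝ) (t : ℝ) (x : Space) : ℝ :=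
  confFactor t (‖x‖ ^ 2) * U (confTime t (‖x‖ ^ 2))

theorem contDiff_confS : ContDiff ℝ ∞ fun p : ℝ × Space => confS p.1 (‖p.2‖ ^ 2) := by
  unfold confS
  have h1 : ContDiff ℝ ∞ fun p : ℝ × Space => ‖p.2‖ ^ 2 := contDiff_snd.norm_sq ℝ
  exact (((contDiff_const.sub (contDiff_fst.pow 2)).add h1).pow 2).add
    (contDiff_const.mul (contDiff_fst.pow 2))

theorem contDiff_confFactor : ContDiff ℝ ∞ fun p : ℝ × Space => confFactor p.1 (‖p.2‖ ^ 2) :=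
  contDiff_const.div (contDiff_confS.sqrt fun _ => (confS_pos (sq_nonneg _)).ne')
    fun _ => (sqrt_confS_pos (sq_nonneg _)).ne'

theorem contDiff_confTime : ContDiff ℝ ∞ fun p : ℝ × Space => confTime p.1 (‖p.2‖ ^ 2) := by
  have h1 : ContDiff ℝ ∞ fun p : ℝ × Space => ‖p.2‖ ^ 2 := contDiff_snd.norm_sq ℝ
  refine contDiff_const.mul (ContDiff.arctan ?_)
  refine (contDiff_const.mul contDiff_fst).div ((contDiff_confS.sqrt
    fun _ => (confS_pos (sq_nonneg _)).ne').add
      ((contDiff_const.sub (contDiff_fst.pow 2)).add h1)) fun p => ?_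
  have := two_le_sqrt_confS_add (t := p.1) (sq_nonneg ‖p.2‖)
  linarith

theorem contDiffOn_penrose {U : ℝ → ℝ} {I J : Set ℝ} (hU : ContDiffOn ℝ ∞ U J)
    (hIJ : ∀ t ∈ I, ∀ q, 0 ≤ q → confTime t q ∈ J) :
    ContDiffOn ℝ ∞ (fun p : ℝ × Space => penrose U p.1 p.2) (I ×ˢ univ) :=
  contDiff_confFactor.contDiffOn.mul
    (hU.comp contDiff_confTime.contDiffOn fun _ hp => hIJ _ hp.1 _ (sq_nonneg _))

theorem contDiff_slice {I : Set ℝ} {u : ℝ → Space → ℝ}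
    (h : ContDiffOn ℝ ∞ (fun p : ℝ × Space => u p.1 p.2) (I ×ˢ univ)) {t : ℝ} (ht : t ∈ I) :
    ContDiff ℝ ∞ (u t) := by
  have := h.comp (s := univ) (f := fun x : Space => (t, x)) (contDiff_prodMk_right t).contDiffOn
    fun x _ => ⟨ht, mem_univ _⟩
  exact contDiffOn_univ.1 this

/-- The time derivative of `penrose U`. -/
def penroseDt (U : ℝ → ℝ) (t q : ℝ) : ℝ :=
  confFactor t q ^ 3 / 2 * ((1 + t ^ 2 + q) * deriv U (confTime t q)
    - t * (1 + t ^ 2 - q) * U (confTime t q))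

/-- The `i`-th partial derivative of `penrose U` at `x` is `x i * penroseDx U t (‖x‖ ^ 2)`. -/
def penroseDx (U : ℝ → ℝ) (t q : ℝ) : ℝ :=
  -(confFactor t q ^ 3 / 2) * ((1 - t ^ 2 + q) * U (confTime t q)
    + 2 * t * deriv U (confTime t q))

theorem hasDerivAt_penrose_time {U : ℝ → ℝ} {t : ℝ} {x : Space}
    (hU : DifferentiableAt ℝ U (confTime t (‖x‖ ^ 2))) :
    HasDerivAt (fun s => penrose U s x) (penroseDt U t (‖x‖ ^ 2)) t := by
  have h1 := hasDerivAt_confFactor (hasDerivAt_id t) (hasDerivAt_const t (‖x‖ ^ 2)) (sq_nonneg _)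
  have h2 := hasDerivAt_confTime (hasDerivAt_id t) (hasDerivAt_const t (‖x‖ ^ 2)) (sq_nonneg _)
  have := h1.mul (hU.hasDerivAt.comp t h2)
  convert! this using 1
  simp only [id, penroseDt, Function.comp]
  ring

theorem hasDerivAt_penroseDt {U : ℝ → ℝ} {t q : ℝ} (hq : 0 ≤ q)
    (hU : DifferentiableAt ℝ U (confTime t q)) {U₂ : ℝ}
    (hU' : HasDerivAt (deriv U) U₂ (confTime t q)) :
    HasDerivAt (fun s => penroseDt U s q)
      (-3 * confFactor t q ^ 5 * t * (1 + t ^ 2 - q) / 4 *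
        ((1 + t ^ 2 + q) * deriv U (confTime t q) - t * (1 + t ^ 2 - q) * U (confTime t q))
      + confFactor t q ^ 3 / 2 * (2 * t * deriv U (confTime t q)
        + (1 + t ^ 2 + q) * U₂ * (confFactor t q ^ 2 * (1 + t ^ 2 + q) / 2)
        - (1 + 3 * t ^ 2 - q) * U (confTime t q)
        - t * (1 + t ^ 2 - q) * deriv U (confTime t q)
          * (confFactor t q ^ 2 * (1 + t ^ 2 + q) / 2))) t := by
  have h1 := hasDerivAt_confFactor (hasDerivAt_id t) (hasDerivAt_const t q) hq
  have h2 := hasDerivAt_confTime (hasDerivAt_id t) (hasDerivAt_const t q) hq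
  have h3 : HasDerivAt (fun s : ℝ => 1 + s ^ 2 + q) (2 * t) t := by
    simpa using ((hasDerivAt_pow 2 t).const_add 1).add_const q
  have h4 : HasDerivAt (fun s : ℝ => s * (1 + s ^ 2 - q)) (1 * (1 + t ^ 2 - q) + t * (2 * t)) t := by
    have : HasDerivAt (fun s : ℝ => 1 + s ^ 2 - q) (2 * t) t := by
      simpa using ((hasDerivAt_pow 2 t).const_add 1).sub_const q
    exact (hasDerivAt_id t).mul this
  have := ((h1.pow 3).div_const 2).mul
    ((h3.mul (hU'.comp t h2)).sub (h4.mul (hU.hasDerivAt.comp t h2)))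
  convert! this using 1
  simp only [id, Function.comp, Pi.sub_apply, Pi.mul_apply, Pi.pow_apply]
  push_cast
  ring

theorem hasDerivAt_norm_sq_line (x : Space) (i : Fin 3) :
    HasDerivAt (fun σ : ℝ => ‖x + σ • EuclideanSpace.single i (1 : ℝ)‖ ^ 2) (2 * x i) 0 := by
  have h1 : HasDerivAt (fun σ : ℝ => x + σ • EuclideanSpace.single i (1 : ℝ))
      ((1 : ℝ) • EuclideanSpace.single i (1 : ℝ)) 0 :=
    ((hasDerivAt_id (0 : ℝ)).smul_const _).const_add x
  have := h1.norm_sq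
  convert! this using 1
  simp [EuclideanSpace.inner_single_right]

theorem hasDerivAt_coord_line (x : Space) (i : Fin 3) :
    HasDerivAt (fun σ : ℝ => (x + σ • EuclideanSpace.single i (1 : ℝ)) i) 1 0 := by
  have : (fun σ : ℝ => (x + σ • EuclideanSpace.single i (1 : ℝ)) i) = fun σ => x i + σ := by
    ext σ; simp
  rw [this]
  exact (hasDerivAt_id (0 : ℝ)).const_add _

theorem hasDerivAt_penrose_line {U : ℝ → ℝ} {t : ℝ} {x : Space} (i : Fin 3)
    (hU : DifferentiableAt ℝ U (confTime t (‖x‖ ^ 2))) :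
    HasDerivAt (fun σ : ℝ => penrose U t (x + σ • EuclideanSpace.single i (1 : ℝ)))
      (x i * penroseDx U t (‖x‖ ^ 2)) 0 := by
  have hq := hasDerivAt_norm_sq_line x i
  have h1 := hasDerivAt_confFactor (hasDerivAt_const 0 t) hq (sq_nonneg _)
  have h2 := hasDerivAt_confTime (hasDerivAt_const 0 t) hq (sq_nonneg _)
  simp only [zero_smul, add_zero] at h1 h2
  have h3 : HasDerivAt U (deriv U (confTime t (‖x‖ ^ 2)))
    (confTime t (‖x + (0 : ℝ) • EuclideanSpace.single i (1 : ℝ)‖ ^ 2)) := by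
    simpa using hU.hasDerivAt
  have := h1.mul (h3.comp 0 h2)
  convert! this using 1
  simp only [Function.comp, zero_smul, add_zero, penroseDx]
  ring

theorem hasDerivAt_penroseDx_line {U : ℝ → ℝ} {t : ℝ} {x : Space} (i : Fin 3)
    (hU : DifferentiableAt ℝ U (confTime t (‖x‖ ^ 2))) {U₂ : ℝ}
    (hU' : HasDerivAt (deriv U) U₂ (confTime t (‖x‖ ^ 2))) :
    HasDerivAt (fun σ : ℝ => (x + σ • EuclideanSpace.single i (1 : ℝ)) i *
        penroseDx U t (‖x + σ • EuclideanSpace.single i (1 : ℝ)‖ ^ 2))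
      ((3 * confFactor t (‖x‖ ^ 2) ^ 5 * (1 - t ^ 2 + ‖x‖ ^ 2) * x i ^ 2 / 4
          - confFactor t (‖x‖ ^ 2) ^ 3 / 2) * ((1 - t ^ 2 + ‖x‖ ^ 2) * U (confTime t (‖x‖ ^ 2))
            + 2 * t * deriv U (confTime t (‖x‖ ^ 2)))
        - confFactor t (‖x‖ ^ 2) ^ 3 / 2 * (2 * x i ^ 2 * U (confTime t (‖x‖ ^ 2))
          - confFactor t (‖x‖ ^ 2) ^ 2 * t * x i ^ 2 *
            ((1 - t ^ 2 + ‖x‖ ^ 2) * deriv U (confTime t (‖x‖ ^ 2)) + 2 * t * U₂))) 0 := by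
  have hq := hasDerivAt_norm_sq_line x i
  have h1 := hasDerivAt_confFactor (hasDerivAt_const 0 t) hq (sq_nonneg _)
  have h2 := hasDerivAt_confTime (hasDerivAt_const 0 t) hq (sq_nonneg _)
  simp only [zero_smul, add_zero] at h1 h2
  have h3 : HasDerivAt U (deriv U (confTime t (‖x‖ ^ 2)))
    (confTime t (‖x + (0 : ℝ) • EuclideanSpace.single i (1 : ℝ)‖ ^ 2)) := by
    simpa using hU.hasDerivAt
  have h4 : HasDerivAt (deriv U) U₂
    (confTime t (‖x + (0 : ℝ) • EuclideanSpace.single i (1 : ℝ)‖ ^ 2)) := by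
    simpa using hU'
  have := (hasDerivAt_coord_line x i).mul ((((h1.pow 3).div_const 2).neg).mul
    (((hq.const_add (1 - t ^ 2)).mul (h3.comp 0 h2)).add ((h4.comp 0 h2).const_mul (2 * t))))
  convert! this using 1
  simp only [Function.comp, zero_smul, add_zero, Pi.add_apply, Pi.mul_apply, Pi.pow_apply,
    Pi.neg_apply]
  push_cast
  ring

theorem IsProfile.differentiableAt {X Y ε τ s : ℝ} {U : ℝ → ℝ} (h : IsProfile X Y ε τ U)
    (hs : s ∈ Ioo (-ε) τ) : DifferentiableAt ℝ U s :=
  ((h.smooth.contDiffAt (isOpen_Ioo.mem_nhds hs)).differentiableAt (by simp))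

theorem IsProfile.mono {X Y ε ε' τ : ℝ} {U : ℝ → ℝ} (h : IsProfile X Y ε τ U) (h0 : 0 < ε')
    (hle : ε' ≤ ε) : IsProfile X Y ε' τ U :=
  have hsub : Ioo (-ε') τ ⊆ Ioo (-ε) τ := Ioo_subset_Ioo_left (by linarith)
  { h with
    eps_pos := h0
    smooth := h.smooth.mono hsub
    ode := fun t ht => h.ode t (hsub ht) }

theorem norm_sq_eq_coords (x : Space) : ‖x‖ ^ 2 = x 0 ^ 2 + x 1 ^ 2 + x 2 ^ 2 := by
  rw [EuclideanSpace.real_norm_sq_eq, Fin.sum_univ_three]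

theorem IsProfile.isSolution {X Y ε τ : ℝ} {U : ℝ → ℝ} (h : IsProfile X Y ε τ U)
    (hε : ε < Real.pi) :
    IsSolution X Y (Ioo (-Real.tan (ε / 2)) (Real.tan (τ / 2))) (penrose U) := by
  have hmem : ∀ t ∈ Ioo (-Real.tan (ε / 2)) (Real.tan (τ / 2)), ∀ q, 0 ≤ q →
      confTime t q ∈ Ioo (-ε) τ := fun t ht q hq =>
    confTime_mem h.eps_pos hε h.pos h.lt_pi hq ht
  have hsm := contDiffOn_penrose h.smooth hmem
  have hsm' : ∀ t ∈ Ioo (-Real.tan (ε / 2)) (Real.tan (τ / 2)), ContDiff ℝ ∞ (penrose U t) :=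
    fun t ht => contDiff_slice hsm ht
  have hc0 : ∀ q, confTime 0 q = 0 := fun q => by simp [confTime]
  have hf0 : ∀ x : Space, confFactor 0 (‖x‖ ^ 2) = 2 / (1 + ‖x‖ ^ 2) := fun x => by
    rw [confFactor, confS, show (1 - (0 : ℝ) ^ 2 + ‖x‖ ^ 2) ^ 2 + 4 * 0 ^ 2 = (1 + ‖x‖ ^ 2) ^ 2 by
      ring, Real.sqrt_sq (by positivity)]
  have h0m : (0 : ℝ) ∈ Ioo (-ε) τ := ⟨by linarith [h.eps_pos], h.pos⟩
  refine ⟨hsm, ?_, ?_, ?_⟩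
  · intro t ht x
    have hq := sq_nonneg ‖x‖
    have hx := hmem t ht _ hq
    have hdt : deriv (fun s => penrose U s x) =ᶠ[𝓝 t] fun s => penroseDt U s (‖x‖ ^ 2) := by
      filter_upwards [isOpen_Ioo.mem_nhds ht] with s hs
      exact (hasDerivAt_penrose_time (h.differentiableAt (hmem s hs _ hq))).deriv
    have hgrad : ∀ (i : Fin 3) (y : Space),
        fderiv ℝ (penrose U t) y (EuclideanSpace.single i 1) = y i * penroseDx U t (‖y‖ ^ 2) :=
      fun i y => fderiv_apply_eq_of_hasDerivAt ((hsm' t ht).differentiable (by simp) y)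
        (hasDerivAt_penrose_line i (h.differentiableAt (hmem t ht _ (sq_nonneg _))))
    have hd2 : ∀ i : Fin 3, DifferentiableAt ℝ (fun y : Space => y i * penroseDx U t (‖y‖ ^ 2)) x := by
      intro i
      simp_rw [← hgrad i]
      have h1 : ContDiff ℝ 1 (fderiv ℝ (penrose U t)) :=
        (hsm' t ht).fderiv_right (by norm_cast)
      exact (h1.clm_apply contDiff_const).differentiable one_ne_zero x
    rw [iteratedDeriv_succ, iteratedDeriv_one, hdt.deriv_eq,
      (hasDerivAt_penroseDt hq (h.differentiableAt hx) (h.ode _ hx)).deriv,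
      laplacian_eq_sum_fderiv ((hsm' t ht).contDiffAt.of_le (by norm_cast))]
    simp_rw [hgrad]
    rw [Finset.sum_congr rfl fun i _ => fderiv_apply_eq_of_hasDerivAt (hd2 i)
      (hasDerivAt_penroseDx_line i (h.differentiableAt hx) (h.ode _ hx)), Fin.sum_univ_three,
      penrose]
    have hq3 := norm_sq_eq_coords x
    have hΩ := confFactor_sq_mul (t := t) hq
    rw [confS] at hΩ
    generalize U (confTime t (‖x‖ ^ 2)) = U₀
    generalize deriv U (confTime t (‖x‖ ^ 2)) = U₁
    generalize confFactor t (‖x‖ ^ 2) = w at *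
    generalize ‖x‖ ^ 2 = q at *
    -- The equation for `U` has entered through its second derivative `U₀³ - U₀`; only `w² S = 4`
    -- and `q = x₀² + x₁² + x₂²` remain to be used.
    linear_combination (w ^ 3 / 4 * (U₀ ^ 3 - U₀) + 3 / 4 * w ^ 3 * (t ^ 2 - q) * U₀
      - w ^ 3 * t * U₁) * hΩ +
      ((3 * w ^ 5 * (1 - t ^ 2 + q) / 4) * ((1 - t ^ 2 + q) * U₀ + 2 * t * U₁) - w ^ 3 * U₀
        + w ^ 5 / 2 * t * ((1 - t ^ 2 + q) * U₁ + 2 * t * (U₀ ^ 3 - U₀))) * hq3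
  · intro x
    rw [penrose, hc0, hf0, h.init]; ring
  · intro x
    rw [(hasDerivAt_penrose_time (by rw [hc0]; exact h.differentiableAt h0m)).deriv, penroseDt,
      hc0, hf0, h.init_deriv]
    field_simp
    ring

/-! ### Uniqueness of smooth solutions -/

/-- Directional derivative on space-time. -/
def pd (v : ℝ × Space) (g : ℝ × Space → ℝ) (p : ℝ × Space) : ℝ := fderiv ℝ g p v

/-- The unit vector in the time direction. -/
def eT : ℝ × Space := (1, 0)

/-- The unit vector in the `i`-th space direction. -/
def eX (i : Fin 3) : ℝ × Space := (0, EuclideanSpace.single i 1)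

section

variable {a b : ℝ} {F G : ℝ × Space → ℝ} {K : Set Space}

theorem isOpen_slab : IsOpen (Ioo a b ×ˢ (univ : Set Space)) := isOpen_Ioo.prod isOpen_univ

theorem contDiffOn_pd (hF : ContDiffOn ℝ ∞ F (Ioo a b ×ˢ univ)) (v : ℝ × Space) :
    ContDiffOn ℝ ∞ (pd v F) (Ioo a b ×ˢ univ) :=
  (hF.fderiv_of_isOpen isOpen_slab (by norm_cast)).clm_apply contDiffOn_const

theorem differentiableAt_of_slab (hF : ContDiffOn ℝ ∞ F (Ioo a b ×ˢ univ)) {p : ℝ × Space}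
    (hp : p.1 ∈ Ioo a b) : DifferentiableAt ℝ F p :=
  (hF.contDiffAt (isOpen_slab.mem_nhds ⟨hp, mem_univ _⟩)).differentiableAt (by simp)

theorem pd_mul {p v : ℝ × Space} (hF : DifferentiableAt ℝ F p) (hG : DifferentiableAt ℝ G p) :
    pd v (fun p => F p * G p) p = pd v F p * G p + F p * pd v G p := by
  unfold pd
  rw [fderiv_fun_mul hF hG]
  simp only [_root_.add_apply, _root_.smul_apply, smul_eq_mul]
  ring

theorem hasDerivAt_slice_time {t : ℝ} {x : Space} (hF : DifferentiableAt ℝ F (t, x)) :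
    HasDerivAt (fun s => F (s, x)) (pd eT F (t, x)) t :=
  hF.hasFDerivAt.comp_hasDerivAt t ((hasDerivAt_id t).prodMk (hasDerivAt_const t x))

theorem fderiv_slice_space {t : ℝ} {x : Space} (hF : DifferentiableAt ℝ F (t, x)) (i : Fin 3) :
    fderiv ℝ (fun y => F (t, y)) x (EuclideanSpace.single i 1) = pd (eX i) F (t, x) := by
  have h1 : HasFDerivAt (fun y : Space => (t, y)) (ContinuousLinearMap.inr ℝ ℝ Space) x :=
    (hasFDerivAt_const t x).prodMk (hasFDerivAt_id x)
  have h2 := (hF.hasFDerivAt.comp x h1).fderiv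
  change fderiv ℝ (fun y => F (t, y)) x = _ at h2
  rw [h2]
  rfl

theorem pd_comm (hF : ContDiffOn ℝ ∞ F (Ioo a b ×ˢ univ)) {p : ℝ × Space} (hp : p.1 ∈ Ioo a b)
    (v v' : ℝ × Space) : pd v (pd v' F) p = pd v' (pd v F) p := by
  have hc := hF.contDiffAt (isOpen_slab.mem_nhds (⟨hp, mem_univ _⟩ : p ∈ Ioo a b ×ˢ univ))
  have hs : IsSymmSndFDerivAt ℝ F p := hc.isSymmSndFDerivAt (by
    rw [minSmoothness_of_isRCLikeNormedField]; norm_cast)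
  have hd : DifferentiableAt ℝ (fderiv ℝ F) p :=
    (hc.fderiv_right (m := 1) (by norm_cast)).differentiableAt one_ne_zero
  have key : ∀ v v' : ℝ × Space, pd v (pd v' F) p = fderiv ℝ (fderiv ℝ F) p v v' := by
    intro v v'
    unfold pd
    rw [fderiv_clm_apply hd (differentiableAt_const _)]
    simp
  rw [key, key, hs.eq]

theorem pd_eq_zero_of_notMem (hK : IsClosed K)
    (hsupp : ∀ p : ℝ × Space, p.1 ∈ Ioo a b → p.2 ∉ K → F p = 0) {p : ℝ × Space}
    (hp : p.1 ∈ Ioo a b) (hpK : p.2 ∉ K) (v : ℝ × Space) : pd v F p = 0 := by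
  have : F =ᶠ[𝓝 p] fun _ => 0 := by
    filter_upwards [(isOpen_Ioo.prod hK.isOpen_compl).mem_nhds (show p ∈ Ioo a b ×ˢ Kᶜ from ⟨hp, hpK⟩)]
      with y hy using hsupp y hy.1 hy.2
  rw [pd, this.fderiv_eq]
  simp

theorem integrable_slice (hF : ContinuousOn F (Ioo a b ×ˢ univ)) (hK : IsCompact K)
    (hsupp : ∀ p : ℝ × Space, p.1 ∈ Ioo a b → p.2 ∉ K → F p = 0) {t : ℝ} (ht : t ∈ Ioo a b) :
    Continuous (fun x => F (t, x)) ∧ Integrable fun x => F (t, x) := by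
  have hc : Continuous fun x => F (t, x) :=
    hF.comp_continuous (by fun_prop) fun x => ⟨ht, mem_univ _⟩
  exact ⟨hc, hc.integrable_of_hasCompactSupport
    (HasCompactSupport.intro hK fun x hx => hsupp (t, x) ht hx)⟩

theorem integral_pd_space_eq_zero (hF : ContDiffOn ℝ ∞ F (Ioo a b ×ˢ univ)) (hK : IsCompact K)
    (hsupp : ∀ p : ℝ × Space, p.1 ∈ Ioo a b → p.2 ∉ K → F p = 0) {t : ℝ} (ht : t ∈ Ioo a b)
    (i : Fin 3) : ∫ x, pd (eX i) F (t, x) = 0 := by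
  have hd : ∀ x, DifferentiableAt ℝ F (t, x) := fun x => differentiableAt_of_slab hF ht
  have h1 : (fun x => pd (eX i) F (t, x))
      = fun x => fderiv ℝ (fun y => F (t, y)) x (EuclideanSpace.single i 1) :=
    funext fun x => (fderiv_slice_space (hd x) i).symm
  have hint := (integrable_slice (contDiffOn_pd hF (eX i)).continuousOn hK
    (fun p hp hpK => pd_eq_zero_of_notMem hK.isClosed hsupp hp hpK _) ht).2
  have h2 := integral_mul_fderiv_eq_neg_fderiv_mul_of_integrable (μ := (volume : Measure Space))
    (f := fun _ => (1 : ℝ)) (g := fun x => F (t, x)) (v := EuclideanSpace.single i 1)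
    (by simp) (by simpa only [one_mul, ← h1] using hint)
    (by simpa only [one_mul] using (integrable_slice hF.continuousOn hK hsupp ht).2)
    (fun x _ => differentiableAt_const _)
    (fun x _ => (hd x).comp x (by fun_prop))
  simpa [h1] using h2

theorem hasDerivAt_integral_slice (hF : ContDiffOn ℝ ∞ F (Ioo a b ×ˢ univ)) (hK : IsCompact K)
    (hsupp : ∀ p : ℝ × Space, p.1 ∈ Ioo a b → p.2 ∉ K → F p = 0) {t : ℝ} (ht : t ∈ Ioo a b) :
    HasDerivAt (fun s => ∫ x, F (s, x)) (∫ x, pd eT F (t, x)) t := by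
  have hsupp' : ∀ p : ℝ × Space, p.1 ∈ Ioo a b → p.2 ∉ K → pd eT F p = 0 :=
    fun p hp hpK => pd_eq_zero_of_notMem hK.isClosed hsupp hp hpK _
  have hc := (contDiffOn_pd hF eT).continuousOn
  obtain ⟨l, hl⟩ := exists_between ht.1
  obtain ⟨r, hr⟩ := exists_between ht.2
  have hsub : Icc l r ⊆ Ioo a b := fun s hs => ⟨hl.1.trans_le hs.1, hs.2.trans_lt hr.2⟩
  obtain ⟨M, hM⟩ := ((isCompact_Icc (a := l) (b := r)).prod hK).exists_bound_of_continuousOn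
    (hc.mono (prod_mono hsub (subset_univ _)))
  refine (hasDerivAt_integral_of_dominated_loc_of_deriv_le (F := fun s x => F (s, x))
    (F' := fun s x => pd eT F (s, x)) (bound := K.indicator fun _ => M)
    (Icc_mem_nhds hl.2 hr.1) ?_ ?_ ?_ ?_ ?_ ?_).2
  · filter_upwards [isOpen_Ioo.mem_nhds ht] with s hs
    exact (integrable_slice hF.continuousOn hK hsupp hs).1.aestronglyMeasurable
  · exact (integrable_slice hF.continuousOn hK hsupp ht).2
  · exact (integrable_slice hc hK hsupp' ht).1.aestronglyMeasurable
  · refine Eventually.of_forall fun x s hs => ?_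
    by_cases hx : x ∈ K
    · rw [indicator_of_mem hx]; exact hM (s, x) ⟨hs, hx⟩
    · rw [indicator_of_notMem hx, hsupp' (s, x) (hsub hs) hx, norm_zero]
  · exact (integrable_indicator_iff hK.measurableSet).2
      (continuousOn_const.integrableOn_compact hK)
  · exact Eventually.of_forall fun x s hs =>
      hasDerivAt_slice_time (differentiableAt_of_slab hF (hsub hs))

end

/-- Here `χ₀`, `χᵢ` are derivatives of the weight, `w₀`, `wᵢ` those of the solution, and `q` is the
wave operator applied to it. The flux `w₀ ∑ χᵢ wᵢ` is absorbed by the nonpositive term with `χ₀`,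
because the weight decreases in time at least as fast as it varies in space. -/
theorem energy_density_bound {χ χ₀ χ₁ χ₂ χ₃ w w₀ w₁ w₂ w₃ q M : ℝ} (hχ : 0 ≤ χ) (hχ₀ : χ₀ ≤ 0)
    (hcone : χ₁ ^ 2 + χ₂ ^ 2 + χ₃ ^ 2 ≤ χ₀ ^ 2) (hq : |q| ≤ M * |w|) (hM : 0 ≤ M) :
    χ₀ * ((w₀ ^ 2 + (w₁ ^ 2 + w₂ ^ 2 + w₃ ^ 2) + w ^ 2) / 2) + χ * (w₀ * q + w * w₀)
        - w₀ * (χ₁ * w₁ + χ₂ * w₂ + χ₃ * w₃)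
      ≤ (M + 1) * (χ * ((w₀ ^ 2 + (w₁ ^ 2 + w₂ ^ 2 + w₃ ^ 2) + w ^ 2) / 2)) := by
  have h1 : w₀ * q + w * w₀ ≤ (M + 1) * ((w₀ ^ 2 + (w₁ ^ 2 + w₂ ^ 2 + w₃ ^ 2) + w ^ 2) / 2) := by
    have e1 : w₀ * q ≤ M * ((w₀ ^ 2 + w ^ 2) / 2) := by
      calc w₀ * q ≤ |w₀| * |q| := by rw [← abs_mul]; exact le_abs_self _
        _ ≤ |w₀| * (M * |w|) := by gcongr
        _ = M * (|w₀| * |w|) := by ring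
        _ ≤ M * ((w₀ ^ 2 + w ^ 2) / 2) := by
          gcongr
          rw [← sq_abs w₀, ← sq_abs w]
          nlinarith [sq_nonneg (|w₀| - |w|)]
    have e2 : w * w₀ ≤ (w₀ ^ 2 + w ^ 2) / 2 := by nlinarith [sq_nonneg (w - w₀)]
    have e3 : 0 ≤ (M + 1) * ((w₁ ^ 2 + w₂ ^ 2 + w₃ ^ 2) / 2) := by positivity
    linarith
  have h2 : -(w₀ * (χ₁ * w₁ + χ₂ * w₂ + χ₃ * w₃))
      ≤ -χ₀ * ((w₀ ^ 2 + (w₁ ^ 2 + w₂ ^ 2 + w₃ ^ 2)) / 2) := by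
    have hsq : (χ₁ * w₁ + χ₂ * w₂ + χ₃ * w₃) ^ 2 ≤ χ₀ ^ 2 * (w₁ ^ 2 + w₂ ^ 2 + w₃ ^ 2) := by
      have : (χ₁ * w₁ + χ₂ * w₂ + χ₃ * w₃) ^ 2
          ≤ (χ₁ ^ 2 + χ₂ ^ 2 + χ₃ ^ 2) * (w₁ ^ 2 + w₂ ^ 2 + w₃ ^ 2) := by
        nlinarith [sq_nonneg (χ₁ * w₂ - χ₂ * w₁), sq_nonneg (χ₁ * w₃ - χ₃ * w₁),
          sq_nonneg (χ₂ * w₃ - χ₃ * w₂)]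
      exact this.trans (by gcongr)
    set W := √(w₁ ^ 2 + w₂ ^ 2 + w₃ ^ 2) with hW
    have hW2 : W ^ 2 = w₁ ^ 2 + w₂ ^ 2 + w₃ ^ 2 := Real.sq_sqrt (by positivity)
    have habs : |χ₁ * w₁ + χ₂ * w₂ + χ₃ * w₃| ≤ -χ₀ * W := by
      refine abs_le_of_sq_le_sq ?_ (mul_nonneg (by linarith) (Real.sqrt_nonneg _))
      rw [mul_pow, neg_sq, hW2]; exact hsq
    calc -(w₀ * (χ₁ * w₁ + χ₂ * w₂ + χ₃ * w₃)) ≤ |w₀| * |χ₁ * w₁ + χ₂ * w₂ + χ₃ * w₃| := by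
          rw [← abs_mul]; exact neg_le_abs _
      _ ≤ |w₀| * (-χ₀ * W) := by gcongr
      _ = -χ₀ * (|w₀| * W) := by ring
      _ ≤ -χ₀ * ((w₀ ^ 2 + (w₁ ^ 2 + w₂ ^ 2 + w₃ ^ 2)) / 2) := by
          refine mul_le_mul_of_nonneg_left ?_ (by linarith)
          rw [← hW2, ← sq_abs w₀]
          nlinarith [sq_nonneg (|w₀| - W)]
  have h3 := mul_le_mul_of_nonneg_left h1 hχ
  have h4 : χ₀ * (w ^ 2 / 2) ≤ 0 := mul_nonpos_of_nonpos_of_nonneg hχ₀ (by positivity)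
  linarith

/-- Grönwall for the energy `∫ χ e`: its derivative is at most `M + 1` times itself, since the
divergence terms integrate to zero. It vanishes at time `0`, hence at `t₀`, and `e ≥ w²/2`. -/
theorem eq_zero_of_weighted_energy {a b t₀ M : ℝ} {w χ : ℝ × Space → ℝ} {K : Set Space}
    (ha : a < 0) (ht₀ : 0 ≤ t₀) (htb : t₀ < b) (hM : 0 ≤ M)
    (hw : ContDiffOn ℝ ∞ w (Ioo a b ×ˢ univ)) (hχ : ContDiff ℝ ∞ χ) (hχ0 : ∀ p, 0 ≤ χ p)
    (hK : IsCompact K) (hsupp : ∀ p : ℝ × Space, p.1 ∈ Ioo a b → p.2 ∉ K → χ p = 0)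
    (hχt : ∀ p, pd eT χ p ≤ 0) (hcone : ∀ p, ∑ i, pd (eX i) χ p ^ 2 ≤ pd eT χ p ^ 2)
    (heq : ∀ t ∈ Icc 0 t₀, ∀ x ∈ K, |pd eT (pd eT w) (t, x) - ∑ i, pd (eX i) (pd (eX i) w) (t, x)|
      ≤ M * |w (t, x)|)
    (h0 : ∀ x, w (0, x) = 0) (h1 : ∀ x, pd eT w (0, x) = 0) {x : Space} (hx : χ (t₀, x) ≠ 0) :
    w (t₀, x) = 0 := by
  have hI : Icc 0 t₀ ⊆ Ioo a b := fun s hs => ⟨ha.trans_le hs.1, hs.2.trans_lt htb⟩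
  have hχs : ContDiffOn ℝ ∞ χ (Ioo a b ×ˢ univ) := hχ.contDiffOn
  have hw0 := contDiffOn_pd hw eT
  have hwi := fun i => contDiffOn_pd hw (eX i)
  set e : ℝ × Space → ℝ := fun p =>
    (pd eT w p * pd eT w p + (pd (eX 0) w p * pd (eX 0) w p + pd (eX 1) w p * pd (eX 1) w p +
      pd (eX 2) w p * pd (eX 2) w p) + w p * w p) / 2 with he
  have hes : ContDiffOn ℝ ∞ e (Ioo a b ×ˢ univ) :=
    (((hw0.mul hw0).add ((((hwi 0).mul (hwi 0)).add ((hwi 1).mul (hwi 1))).add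
      ((hwi 2).mul (hwi 2)))).add (hw.mul hw)).div_const 2
  set F : ℝ × Space → ℝ := fun p => χ p * e p with hF
  have hFs : ContDiffOn ℝ ∞ F (Ioo a b ×ˢ univ) := hχs.mul hes
  have hFsupp : ∀ p : ℝ × Space, p.1 ∈ Ioo a b → p.2 ∉ K → F p = 0 := fun p hp hpK => by
    simp only [hF, hsupp p hp hpK, zero_mul]
  set G : Fin 3 → ℝ × Space → ℝ := fun i p => χ p * (pd eT w p * pd (eX i) w p) with hG
  have hGs : ∀ i, ContDiffOn ℝ ∞ (G i) (Ioo a b ×ˢ univ) := fun i => hχs.mul (hw0.mul (hwi i))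
  have hGsupp : ∀ i, ∀ p : ℝ × Space, p.1 ∈ Ioo a b → p.2 ∉ K → G i p = 0 := fun i p hp hpK => by
    simp only [hG, hsupp p hp hpK, zero_mul]
  -- Separating the divergence of `G` lets the second derivatives combine into the wave operator;
  -- off `K` every term vanishes.
  have hpoint : ∀ t ∈ Icc 0 t₀, ∀ x, pd eT F (t, x) ≤ (M + 1) * F (t, x)
      + ∑ i, pd (eX i) (G i) (t, x) := by
    intro t ht x
    by_cases hxK : x ∈ K
    swap
    · rw [pd_eq_zero_of_notMem hK.isClosed hFsupp (hI ht) hxK, hFsupp _ (hI ht) hxK,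
        Finset.sum_eq_zero fun i _ =>
          pd_eq_zero_of_notMem hK.isClosed (hGsupp i) (hI ht) hxK (eX i)]
      simp
    have hd : ∀ {g : ℝ × Space → ℝ}, ContDiffOn ℝ ∞ g (Ioo a b ×ˢ univ) →
        DifferentiableAt ℝ g (t, x) := fun hg => differentiableAt_of_slab hg (hI ht)
    have hpe : pd eT e (t, x) = pd eT w (t, x) * pd eT (pd eT w) (t, x)
        + (pd (eX 0) w (t, x) * pd eT (pd (eX 0) w) (t, x)
          + pd (eX 1) w (t, x) * pd eT (pd (eX 1) w) (t, x)
          + pd (eX 2) w (t, x) * pd eT (pd (eX 2) w) (t, x)) + w (t, x) * pd eT w (t, x) := by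
      have hsq : ∀ {g : ℝ × Space → ℝ}, ContDiffOn ℝ ∞ g (Ioo a b ×ˢ univ) →
          HasDerivAt (fun s => g (s, x) * g (s, x))
            (2 * (g (t, x) * pd eT g (t, x))) t := fun {g} hg => by
        have h := hasDerivAt_slice_time (hd hg)
        have h2 := h.mul h
        convert! h2 using 1
        ring
      have h2 := (((hsq hw0).add (((hsq (hwi 0)).add (hsq (hwi 1))).add (hsq (hwi 2)))).add
        (hsq hw)).div_const 2
      have h3 := (hasDerivAt_slice_time (hd hes)).unique h2
      rw [h3]
      ring
    have hGe : ∀ i, pd (eX i) (G i) (t, x) = pd (eX i) χ (t, x) * (pd eT w (t, x) * pd (eX i) w (t, x))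
        + χ (t, x) * (pd eT (pd (eX i) w) (t, x) * pd (eX i) w (t, x)
          + pd eT w (t, x) * pd (eX i) (pd (eX i) w) (t, x)) := by
      intro i
      rw [hG]
      simp only
      rw [pd_mul (hd hχs) (hd (hw0.mul (hwi i))), pd_mul (hd hw0) (hd (hwi i)),
        pd_comm hw (hI ht) (eX i) eT]
    have hFe : pd eT F (t, x) = pd eT χ (t, x) * e (t, x) + χ (t, x) * pd eT e (t, x) :=
      pd_mul (hd hχs) (hd hes)
    have hb := energy_density_bound (w₀ := pd eT w (t, x)) (w₁ := pd (eX 0) w (t, x))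
      (w₂ := pd (eX 1) w (t, x)) (w₃ := pd (eX 2) w (t, x)) (χ₁ := pd (eX 0) χ (t, x))
      (χ₂ := pd (eX 1) χ (t, x)) (χ₃ := pd (eX 2) χ (t, x)) (hχ0 (t, x)) (hχt (t, x))
      (by have := hcone (t, x); rwa [Fin.sum_univ_three] at this) (heq t ht x hxK) hM
    rw [Fin.sum_univ_three] at hb
    have hFx : F (t, x) = χ (t, x) * ((pd eT w (t, x) ^ 2 + (pd (eX 0) w (t, x) ^ 2
      + pd (eX 1) w (t, x) ^ 2 + pd (eX 2) w (t, x) ^ 2) + w (t, x) ^ 2) / 2) := by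
      simp only [hF, he]; ring
    have hex : e (t, x) = (pd eT w (t, x) ^ 2 + (pd (eX 0) w (t, x) ^ 2
      + pd (eX 1) w (t, x) ^ 2 + pd (eX 2) w (t, x) ^ 2) + w (t, x) ^ 2) / 2 := by
      simp only [he]; ring
    rw [Fin.sum_univ_three, hGe, hGe, hGe, hFe, hpe, hFx, hex]
    linarith
  set En : ℝ → ℝ := fun t => ∫ x, F (t, x) with hEn
  have hEd : ∀ t ∈ Icc 0 t₀, HasDerivAt En (∫ x, pd eT F (t, x)) t := fun t ht =>
    hasDerivAt_integral_slice hFs hK hFsupp (hI ht)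
  have hEle : ∀ t ∈ Icc 0 t₀, ∫ x, pd eT F (t, x) ≤ (M + 1) * En t := by
    intro t ht
    have hi1 := (integrable_slice (contDiffOn_pd hFs eT).continuousOn hK (fun p hp hpK =>
      pd_eq_zero_of_notMem hK.isClosed hFsupp hp hpK _) (hI ht)).2
    have hi2 := (integrable_slice hFs.continuousOn hK hFsupp (hI ht)).2
    have hi3 := fun i => (integrable_slice (contDiffOn_pd (hGs i) (eX i)).continuousOn hK
      (fun p hp hpK => pd_eq_zero_of_notMem hK.isClosed (hGsupp i) hp hpK _) (hI ht)).2
    have := integral_mono hi1 ((hi2.const_mul (M + 1)).add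
      (integrable_finsetSum Finset.univ fun i _ => hi3 i)) (hpoint t ht)
    simp only [Pi.add_apply] at this
    rw [integral_add (hi2.const_mul (M + 1)) (integrable_finsetSum Finset.univ fun i _ => hi3 i),
      integral_const_mul, integral_finsetSum _ fun i _ => hi3 i,
      Finset.sum_eq_zero fun i _ => integral_pd_space_eq_zero (hGs i) hK (hGsupp i) (hI ht) i,
      add_zero] at this
    exact this
  have hpos : ∀ p, 0 ≤ F p := fun p => mul_nonneg (hχ0 p) (by
    simp only [he]
    have := mul_self_nonneg (pd eT w p)
    have := mul_self_nonneg (pd (eX 0) w p)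
    have := mul_self_nonneg (pd (eX 1) w p)
    have := mul_self_nonneg (pd (eX 2) w p)
    have := mul_self_nonneg (w p)
    linarith)
  have hE0 : En 0 = 0 := by
    have : ∀ x, F (0, x) = 0 := by
      intro x
      have hz : ∀ i, pd (eX i) w (0, x) = 0 := fun i => by
        rw [← fderiv_slice_space (differentiableAt_of_slab hw (hI (left_mem_Icc.2 ht₀))) i]
        simp [h0]
      simp [hF, he, hz, h0, h1]
    simp [hEn, this]
  have hanti : AntitoneOn (fun t => Real.exp (-(M + 1) * t) * En t) (Icc 0 t₀) := by
    have hd : ∀ t ∈ Icc 0 t₀, HasDerivAt (fun t => Real.exp (-(M + 1) * t) * En t)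
        (Real.exp (-(M + 1) * t) * (-(M + 1) * 1) * En t
          + Real.exp (-(M + 1) * t) * ∫ x, pd eT F (t, x)) t := fun t ht =>
      (((hasDerivAt_id t).const_mul _).exp).mul (hEd t ht)
    refine antitoneOn_of_deriv_nonpos (convex_Icc _ _)
      (fun t ht => (hd t ht).continuousAt.continuousWithinAt)
      (fun t ht => (hd t (interior_subset ht)).differentiableAt.differentiableWithinAt)
      fun t ht => ?_
    rw [(hd t (interior_subset ht)).deriv]
    have := hEle t (interior_subset ht)
    nlinarith [Real.exp_pos (-(M + 1) * t)]
  have hEt : En t₀ ≤ 0 := by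
    have := hanti (left_mem_Icc.2 ht₀) (right_mem_Icc.2 ht₀) ht₀
    simp only [hE0, mul_zero] at this
    exact nonpos_of_mul_nonpos_right this (Real.exp_pos _)
  have ht₀I := hI (right_mem_Icc.2 ht₀)
  obtain ⟨hFc, hFi⟩ := integrable_slice hFs.continuousOn hK hFsupp ht₀I
  have hz : (fun x => F (t₀, x)) = 0 := by
    have h := (integral_eq_zero_iff_of_nonneg (fun x => hpos (t₀, x)) hFi).1
      (le_antisymm hEt (integral_nonneg fun x => hpos (t₀, x)))
    exact (hFc.ae_eq_iff_eq volume continuous_zero).1 h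
  have hzx : χ (t₀, x) * e (t₀, x) = 0 := congrFun hz x
  have hex := (mul_eq_zero.1 hzx).resolve_left hx
  simp only [he] at hex
  have := mul_self_nonneg (pd eT w (t₀, x))
  have := mul_self_nonneg (pd (eX 0) w (t₀, x))
  have := mul_self_nonneg (pd (eX 1) w (t₀, x))
  have := mul_self_nonneg (pd (eX 2) w (t₀, x))
  have := mul_self_nonneg (w (t₀, x))
  exact mul_self_eq_zero.1 (by linarith)

/-! The weight supported in a backward light cone -/

/-- A smooth weight that vanishes outside a backward light cone with apex near `(c, x₀)`. -/
def coneWeight (δ c : ℝ) (x₀ : Space) (p : ℝ × Space) : ℝ :=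
  expNegInvGlue (c - p.1 - √(δ ^ 2 + ‖p.2 - x₀‖ ^ 2))

/-- The `δ²` under the root removes the singularity of the norm at `x₀`, and keeps the gradient of
the root below `1`, as the cone condition demands. -/
theorem contDiff_coneWeight {δ : ℝ} (hδ : 0 < δ) (c : ℝ) (x₀ : Space) :
    ContDiff ℝ ∞ (coneWeight δ c x₀) := by
  have h1 : ContDiff ℝ ∞ fun p : ℝ × Space => δ ^ 2 + ‖p.2 - x₀‖ ^ 2 :=
    contDiff_const.add ((contDiff_snd.sub contDiff_const).norm_sq ℝ)
  exact expNegInvGlue.contDiff.comp ((contDiff_const.sub contDiff_fst).sub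
    (h1.sqrt fun p => by positivity))

theorem hasDerivAt_coneWeight_line {δ : ℝ} (hδ : 0 < δ) (c : ℝ) (x₀ : Space) (p : ℝ × Space)
    (i : Fin 3) : pd (eX i) (coneWeight δ c x₀) p =
      -(deriv expNegInvGlue (c - p.1 - √(δ ^ 2 + ‖p.2 - x₀‖ ^ 2)) * ((p.2 - x₀) i
        / √(δ ^ 2 + ‖p.2 - x₀‖ ^ 2))) := by
  have hd : DifferentiableAt ℝ (coneWeight δ c x₀) p :=
    (contDiff_coneWeight hδ c x₀).differentiable (by simp) p
  obtain ⟨t, x⟩ := p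
  rw [← fderiv_slice_space hd i]
  have hpos : 0 < δ ^ 2 + ‖x - x₀‖ ^ 2 := by positivity
  refine fderiv_apply_eq_of_hasDerivAt (hd.comp x (by fun_prop)) ?_
  have h1 := hasDerivAt_norm_sq_line (x - x₀) i
  have h2 := ((h1.const_add (δ ^ 2)).sqrt (by simpa using hpos.ne')).const_sub (c - t)
  have h3 : HasDerivAt expNegInvGlue _ (c - t - √(δ ^ 2 + ‖x - x₀
      + (0 : ℝ) • EuclideanSpace.single i (1 : ℝ)‖ ^ 2)) :=
    ((expNegInvGlue.contDiff (n := 1)).differentiable (by simp) _).hasDerivAt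
  have h4 := h3.comp 0 h2
  simp only [zero_smul, add_zero] at h4
  convert! h4 using 1
  · ext σ
    simp only [coneWeight, Function.comp]
    rw [add_sub_right_comm]
  · have := Real.sqrt_pos.2 hpos
    field_simp

theorem pd_time_coneWeight {δ : ℝ} (hδ : 0 < δ) (c : ℝ) (x₀ : Space) (p : ℝ × Space) :
    pd eT (coneWeight δ c x₀) p =
      -deriv expNegInvGlue (c - p.1 - √(δ ^ 2 + ‖p.2 - x₀‖ ^ 2)) := by
  have hd : DifferentiableAt ℝ (coneWeight δ c x₀) p :=
    (contDiff_coneWeight hδ c x₀).differentiable (by simp) p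
  obtain ⟨t, x⟩ := p
  refine (hasDerivAt_slice_time hd).unique ?_
  have h2 := ((hasDerivAt_id t).const_sub c).sub_const √(δ ^ 2 + ‖x - x₀‖ ^ 2)
  have h3 : HasDerivAt expNegInvGlue _ (c - id t - √(δ ^ 2 + ‖x - x₀‖ ^ 2)) :=
    ((expNegInvGlue.contDiff (n := 1)).differentiable (by simp) _).hasDerivAt
  have h4 := h3.comp t h2
  convert! h4 using 1
  simp

theorem deriv_expNegInvGlue_nonneg (s : ℝ) : 0 ≤ deriv expNegInvGlue s :=
  expNegInvGlue.monotone.deriv_nonneg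

theorem IsSolution.mono {X Y : ℝ} {I J : Set ℝ} {u : ℝ → Space → ℝ} (h : IsSolution X Y I u)
    (hJI : J ⊆ I) : IsSolution X Y J u :=
  { h with
    smooth := h.smooth.mono (prod_mono hJI Subset.rfl)
    wave_eq := fun t ht => h.wave_eq t (hJI ht) }

theorem IsSolution.pd_eq {X Y a b : ℝ} {u : ℝ → Space → ℝ} (h : IsSolution X Y (Ioo a b) u)
    {t : ℝ} (ht : t ∈ Ioo a b) (x : Space) :
    pd eT (pd eT fun p => u p.1 p.2) (t, x)
      - ∑ i, pd (eX i) (pd (eX i) fun p => u p.1 p.2) (t, x) = u t x ^ 3 := by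
  rw [← h.wave_eq t ht x]
  have hs := h.smooth
  congr 1
  · have h1 : deriv (fun s => u s x) =ᶠ[𝓝 t] fun s => pd eT (fun p => u p.1 p.2) (s, x) := by
      filter_upwards [isOpen_Ioo.mem_nhds ht] with s hs'
      exact (hasDerivAt_slice_time (F := fun p => u p.1 p.2) (differentiableAt_of_slab hs hs')).deriv
    rw [iteratedDeriv_succ, iteratedDeriv_one, h1.deriv_eq]
    exact (hasDerivAt_slice_time (differentiableAt_of_slab (contDiffOn_pd hs eT) ht)).deriv.symm
  · rw [laplacian_eq_sum_fderiv ((contDiff_slice hs ht).contDiffAt.of_le (by norm_cast))]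
    refine Finset.sum_congr rfl fun i _ => ?_
    have h1 : (fun y => fderiv ℝ (u t) y (EuclideanSpace.single i 1))
        = fun y => pd (eX i) (fun p => u p.1 p.2) (t, y) := funext fun y =>
      fderiv_slice_space (F := fun p => u p.1 p.2) (differentiableAt_of_slab hs ht) i
    rw [h1]
    exact (fderiv_slice_space (differentiableAt_of_slab (contDiffOn_pd hs (eX i)) ht) i).symm

/-- The difference satisfies `(∂ₜ² - Δ)w = (u² + uv + v²) w`, with a bounded coefficient on the
relevant compact set. The estimate being local to a cone, no decay at infinity is required. -/
theorem IsSolution.eq_of_nonneg {X Y a b : ℝ} {u v : ℝ → Space → ℝ} (ha : a < 0)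
    (hu : IsSolution X Y (Ioo a b) u) (hv : IsSolution X Y (Ioo a b) v) {t₀ : ℝ} (h0 : 0 ≤ t₀)
    (hb : t₀ < b) (x₀ : Space) : u t₀ x₀ = v t₀ x₀ := by
  have hI : Icc 0 t₀ ⊆ Ioo a b := fun s hs => ⟨ha.trans_le hs.1, hs.2.trans_lt hb⟩
  have h0I : (0 : ℝ) ∈ Ioo a b := hI (left_mem_Icc.2 h0)
  set u' : ℝ × Space → ℝ := fun p => u p.1 p.2 with hu'
  set v' : ℝ × Space → ℝ := fun p => v p.1 p.2 with hv'
  have hus : ContDiffOn ℝ ∞ u' (Ioo a b ×ˢ univ) := hu.smooth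
  have hvs : ContDiffOn ℝ ∞ v' (Ioo a b ×ˢ univ) := hv.smooth
  set w : ℝ × Space → ℝ := fun p => u' p - v' p with hw
  have hws : ContDiffOn ℝ ∞ w (Ioo a b ×ˢ univ) := hus.sub hvs
  have hpd : ∀ d p, p.1 ∈ Ioo a b → pd d w p = pd d u' p - pd d v' p := fun d p hp => by
    unfold pd
    rw [hw, fderiv_fun_sub (differentiableAt_of_slab hus hp) (differentiableAt_of_slab hvs hp)]
    rfl
  have hpd2 : ∀ d p, p.1 ∈ Ioo a b → pd d (pd d w) p = pd d (pd d u') p - pd d (pd d v') p := by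
    intro d p hp
    have he : pd d w =ᶠ[𝓝 p] fun p => pd d u' p - pd d v' p := by
      filter_upwards [isOpen_slab.mem_nhds (show p ∈ Ioo a b ×ˢ univ from ⟨hp, mem_univ _⟩)]
        with y hy using hpd d y hy.1
    rw [pd, he.fderiv_eq, fderiv_fun_sub (differentiableAt_of_slab (contDiffOn_pd hus d) hp)
      (differentiableAt_of_slab (contDiffOn_pd hvs d) hp)]
    rfl
  -- With `δ = 1` the argument of the weight at `(t₀, x₀)` is `c - t₀ - 1 = 1 > 0`. For `t > a` the
  -- weight vanishes outside the ball of radius `c - a`.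
  set c := t₀ + 2 with hc
  set K : Set Space := Metric.closedBall x₀ (c - a) with hKd
  have hK : IsCompact K := isCompact_closedBall _ _
  have hsub : Icc 0 t₀ ×ˢ K ⊆ Ioo a b ×ˢ (univ : Set Space) := prod_mono hI (subset_univ _)
  obtain ⟨M, hM⟩ := ((isCompact_Icc (a := 0) (b := t₀)).prod hK).exists_bound_of_continuousOn
    (f := fun p => u' p ^ 2 + u' p * v' p + v' p ^ 2)
    ((((hus.continuousOn.pow 2).add (hus.continuousOn.mul hvs.continuousOn)).add
      (hvs.continuousOn.pow 2)).mono hsub)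
  have hM0 : 0 ≤ M := (norm_nonneg _).trans (hM (0, x₀) ⟨left_mem_Icc.2 h0,
    Metric.mem_closedBall_self (by linarith)⟩)
  have hx : coneWeight 1 c x₀ (t₀, x₀) ≠ 0 := by
    refine (expNegInvGlue.pos_of_pos ?_).ne'
    simp only [sub_self, norm_zero, hc]
    norm_num
  have key := eq_zero_of_weighted_energy (χ := coneWeight 1 c x₀) ha h0 hb hM0 hws
    (contDiff_coneWeight one_pos c x₀) (fun p => expNegInvGlue.nonneg _) hK ?_ ?_ ?_ ?_ ?_ ?_ hx
  · exact sub_eq_zero.1 key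
  · intro p hp hpK
    refine expNegInvGlue.zero_of_nonpos ?_
    have h1 : c - a < ‖p.2 - x₀‖ := by
      rw [hKd, Metric.mem_closedBall, not_le, dist_eq_norm] at hpK
      exact hpK
    have h2 : ‖p.2 - x₀‖ ≤ √(1 ^ 2 + ‖p.2 - x₀‖ ^ 2) := Real.le_sqrt_of_sq_le (by linarith)
    linarith [hp.1]
  · intro p
    rw [pd_time_coneWeight one_pos]
    exact neg_nonpos.2 (deriv_expNegInvGlue_nonneg _)
  · intro p
    simp_rw [hasDerivAt_coneWeight_line one_pos, pd_time_coneWeight one_pos, neg_sq, mul_pow]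
    rw [← Finset.mul_sum]
    refine mul_le_of_le_one_right (sq_nonneg _) ?_
    have hpos : 0 < 1 ^ 2 + ‖p.2 - x₀‖ ^ 2 := by positivity
    simp_rw [div_pow]
    rw [← Finset.sum_div, Real.sq_sqrt hpos.le, ← EuclideanSpace.real_norm_sq_eq, div_le_one hpos]
    linarith
  · intro t ht x hxK
    have e : pd eT (pd eT w) (t, x) - ∑ i, pd (eX i) (pd (eX i) w) (t, x)
        = (u' (t, x) ^ 2 + u' (t, x) * v' (t, x) + v' (t, x) ^ 2) * w (t, x) := by
      have h1 := hu.pd_eq (hI ht) x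
      have h2 := hv.pd_eq (hI ht) x
      simp_rw [hpd2 _ (t, x) (hI ht)]
      rw [Finset.sum_sub_distrib]
      simp only [hw, hu', hv'] at h1 h2 ⊢
      linear_combination h1 - h2
    rw [e, abs_mul]
    exact mul_le_mul_of_nonneg_right (hM (t, x) ⟨ht, hxK⟩) (abs_nonneg _)
  · intro x
    simp only [hw, hu', hv']
    rw [hu.init_pos, hv.init_pos, sub_self]
  · intro x
    rw [hpd eT (0, x) h0I, ← (hasDerivAt_slice_time (differentiableAt_of_slab hus h0I)).deriv,
      ← (hasDerivAt_slice_time (differentiableAt_of_slab hvs h0I)).deriv]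
    exact sub_eq_zero.2 ((hu.init_vel x).trans (hv.init_vel x).symm)

/-! ### Comparison with the singular part near the blow-up time -/

/-- The coefficient `T / (1 + T²)`. -/
def kap (T : ℝ) : ℝ := T / (1 + T ^ 2)

/-- The singular part of the solution is `√2 / den T t |x|²`. -/
def den (T t q : ℝ) : ℝ := (T - t) * (1 - kap T * (T - t)) + kap T * q

theorem kap_pos {T : ℝ} (hT : 0 < T) : 0 < kap T := by unfold kap; positivity

theorem one_sub_kap_mul_pos {T t : ℝ} (hT : 0 < T) (ht : 0 ≤ t) : 0 < 1 - kap T * (T - t) := by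
  have : 1 - kap T * (T - t) = (1 + T * t) / (1 + T ^ 2) := by
    unfold kap; field_simp; ring
  rw [this]; positivity

theorem den_pos {T t q : ℝ} (hT : 0 < T) (ht : t ∈ Ico 0 T) (hq : 0 ≤ q) : 0 < den T t q := by
  have := mul_pos (sub_pos.2 ht.2) (one_sub_kap_mul_pos hT ht.1)
  have := mul_nonneg (kap_pos hT).le hq
  unfold den; linarith

theorem sin_cos_of_tan_half {τ : ℝ} (h0 : 0 < τ) (hπ : τ < Real.pi) :
    Real.sin τ = 2 * Real.tan (τ / 2) / (1 + Real.tan (τ / 2) ^ 2) ∧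
      Real.cos τ = (1 - Real.tan (τ / 2) ^ 2) / (1 + Real.tan (τ / 2) ^ 2) := by
  have hc : 0 < Real.cos (τ / 2) := Real.cos_pos_of_mem_Ioo ⟨by linarith, by linarith⟩
  have h1 : Real.sin τ = 2 * Real.sin (τ / 2) * Real.cos (τ / 2) := by
    rw [← Real.sin_two_mul]; ring_nf
  have h2 : Real.cos τ = Real.cos (τ / 2) ^ 2 - Real.sin (τ / 2) ^ 2 := by
    rw [← Real.cos_two_mul']; ring_nf
  have h3 := Real.sin_sq_add_cos_sq (τ / 2)
  rw [h1, h2, Real.tan_eq_sin_div_cos]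
  have h4 : 1 + (Real.sin (τ / 2) / Real.cos (τ / 2)) ^ 2 = 1 / Real.cos (τ / 2) ^ 2 := by
    field_simp; linarith
  rw [h4]
  constructor <;> field_simp

/-- This is the reason for comparing with `√2/sin (τ - s)` instead of `√2/(τ - s)`: the conformal
factor cancels and leaves a quadratic polynomial in `t` and `|x|`. -/
theorem sin_sub_confTime {τ t q : ℝ} (h0 : 0 < τ) (hπ : τ < Real.pi) (hq : 0 ≤ q) :
    Real.sin (τ - confTime t q) = confFactor t q * den (Real.tan (τ / 2)) t q := by
  obtain ⟨hs, hc⟩ := sin_cos_of_tan_half h0 hπ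
  rw [Real.sin_sub, sin_confTime hq, cos_confTime hq, hs, hc, den, kap]
  field_simp
  ring

theorem cos_sub_confTime {τ t q : ℝ} (h0 : 0 < τ) (hπ : τ < Real.pi) (hq : 0 ≤ q) :
    Real.cos (τ - confTime t q) = confFactor t q *
      (((1 - Real.tan (τ / 2) ^ 2) * (1 - t ^ 2 + q) / 2 + 2 * Real.tan (τ / 2) * t)
        / (1 + Real.tan (τ / 2) ^ 2)) := by
  obtain ⟨hs, hc⟩ := sin_cos_of_tan_half h0 hπ
  rw [Real.cos_sub, sin_confTime hq, cos_confTime hq, hs, hc]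
  field_simp

/-- It rests on `(1 + t² + q)² ≤ (1 + t²) S`, where the difference of the two sides is `t² (1 + t² -
q)²`. -/
theorem confFactor_le {T t q : ℝ} (ht : t ∈ Ico 0 T) (hq : 0 ≤ q) :
    confFactor t q ≤ 2 * (1 + T) / (1 + q) := by
  have hD := sqrt_confS_pos (t := t) hq
  rw [confFactor, div_le_div_iff₀ hD (by linarith)]
  have h1 : (1 + t ^ 2 + q) ^ 2 ≤ confS t q * (1 + t ^ 2) := by
    unfold confS
    nlinarith [mul_nonneg (sq_nonneg t) (sq_nonneg (1 + t ^ 2 - q))]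
  have h2 : 1 + q ≤ √(confS t q) * (1 + T) := by
    have hT : 0 ≤ T := ht.1.trans ht.2.le
    refine le_of_sq_le_sq ?_ (by positivity)
    rw [mul_pow, sqrt_confS_sq hq]
    have h3 : (1 + q) ^ 2 ≤ (1 + t ^ 2 + q) ^ 2 := by
      have := sq_nonneg t
      gcongr
      linarith
    have h4 : 1 + t ^ 2 ≤ (1 + T) ^ 2 := by nlinarith [ht.1, ht.2]
    have := (confS_pos (t := t) hq).le
    calc (1 + q) ^ 2 ≤ confS t q * (1 + t ^ 2) := h3.trans h1
      _ ≤ _ := by gcongr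
  linarith

/-- The right-hand side is `-∂ₜ den`: the time derivative of the transformed zero-energy solution is
that of `√2/den`. The next identity plays the same role for the space derivatives. -/
theorem penroseDt_main {T t q w : ℝ} (hw : w ^ 2 * confS t q = 4) :
    w ^ 2 / 2 * ((1 + t ^ 2 + q) * (((1 - T ^ 2) * (1 - t ^ 2 + q) / 2 + 2 * T * t) / (1 + T ^ 2))
      - t * (1 + t ^ 2 - q) * den T t q) = 1 - 2 * kap T * (T - t) := by
  rw [confS] at hw
  unfold den kap
  field_simp
  linear_combination (1 - T ^ 2 + 2 * T * t) * hw

theorem penroseDx_main {T t q w : ℝ} (hw : w ^ 2 * confS t q = 4) :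
    w ^ 2 / 2 * ((1 - t ^ 2 + q) * den T t q
      + 2 * t * (((1 - T ^ 2) * (1 - t ^ 2 + q) / 2 + 2 * T * t) / (1 + T ^ 2))) = 2 * kap T := by
  rw [confS] at hw
  unfold den kap
  field_simp
  linear_combination T * hw

/-- The remainders `b₀`, `b₁` of `U`, `U'` enter linearly. Three powers of `w = O(1/(1 + q))`
against one factor `1 + t² + q` leave `(1 + q)⁻²`. -/
theorem remainder_bounds {T t q w m B b₀ b₁ : ℝ} (ht : t ∈ Ico 0 T) (hq : 0 ≤ q) (hw0 : 0 < w)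
    (hm : 0 ≤ m) (hwm : w ≤ m / (1 + q)) (hb₀ : |b₀| ≤ B) (hb₁ : |b₁| ≤ B) :
    w * |b₀| ≤ m * B / (1 + q) ∧
    |w ^ 3 / 2 * ((1 + t ^ 2 + q) * b₁ - t * (1 + t ^ 2 - q) * b₀)|
      ≤ m ^ 3 * (1 + T) * (1 + T ^ 2) * B / (1 + q) ^ 2 ∧
    |w ^ 3 / 2 * ((1 - t ^ 2 + q) * b₀ + 2 * t * b₁)|
      ≤ m ^ 3 * (1 + T) * (1 + T ^ 2) * B / (1 + q) ^ 2 := by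
  have ht0 := ht.1
  have hT : 0 ≤ T := ht0.trans ht.2.le
  have hq1 : 0 < 1 + q := by linarith
  have hB0 : 0 ≤ B := (abs_nonneg _).trans hb₀
  have hP : 1 + t ^ 2 + q ≤ (1 + T ^ 2) * (1 + q) := by nlinarith [ht.2, sq_nonneg T]
  have hP0 : 0 ≤ 1 + t ^ 2 + q := by positivity
  have hMP : |1 + t ^ 2 - q| ≤ 1 + t ^ 2 + q := by rw [abs_le]; constructor <;> nlinarith
  have hAP : |1 - t ^ 2 + q| ≤ 1 + t ^ 2 + q := by rw [abs_le]; constructor <;> nlinarith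
  have hw3 : w ^ 3 / 2 * ((1 + t ^ 2 + q) * ((1 + T) * B)) * 2
      ≤ m ^ 3 * (1 + T) * (1 + T ^ 2) * B / (1 + q) ^ 2 := by
    calc w ^ 3 / 2 * ((1 + t ^ 2 + q) * ((1 + T) * B)) * 2
        ≤ (m / (1 + q)) ^ 3 / 2 * (((1 + T ^ 2) * (1 + q)) * ((1 + T) * B)) * 2 := by gcongr
      _ = _ := by field_simp
  have hw3' : 0 ≤ w ^ 3 / 2 * ((1 + t ^ 2 + q) * ((1 + T) * B)) := by positivity
  have hw30 : 0 < w ^ 3 / 2 := by positivity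
  refine ⟨?_, ?_, ?_⟩
  · calc w * |b₀| ≤ m / (1 + q) * B := by gcongr
      _ = m * B / (1 + q) := by ring
  · rw [abs_mul, abs_of_pos hw30]
    have : |(1 + t ^ 2 + q) * b₁ - t * (1 + t ^ 2 - q) * b₀| ≤ (1 + t ^ 2 + q) * ((1 + T) * B) := by
      calc _ ≤ |(1 + t ^ 2 + q) * b₁| + |t * (1 + t ^ 2 - q) * b₀| := abs_sub _ _
        _ = (1 + t ^ 2 + q) * |b₁| + t * |1 + t ^ 2 - q| * |b₀| := by
          rw [abs_mul, abs_mul, abs_mul, abs_of_nonneg hP0, abs_of_nonneg ht0]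
        _ ≤ (1 + t ^ 2 + q) * B + T * (1 + t ^ 2 + q) * B := by
          have := ht.2.le
          gcongr
        _ = _ := by ring
    have := mul_le_mul_of_nonneg_left this hw30.le
    linarith
  · rw [abs_mul, abs_of_pos hw30]
    have h2t : 2 * t ≤ 1 + t ^ 2 + q := by nlinarith [sq_nonneg (t - 1)]
    have : |(1 - t ^ 2 + q) * b₀ + 2 * t * b₁| ≤ (1 + t ^ 2 + q) * ((1 + T) * B) * 2 := by
      calc _ ≤ |(1 - t ^ 2 + q) * b₀| + |2 * t * b₁| := abs_add_le _ _
        _ = |1 - t ^ 2 + q| * |b₀| + 2 * t * |b₁| := by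
          rw [abs_mul, abs_mul, abs_of_nonneg (by positivity : 0 ≤ 2 * t)]
        _ ≤ (1 + t ^ 2 + q) * B + (1 + t ^ 2 + q) * B := by gcongr
        _ = (1 + t ^ 2 + q) * (1 * B) * 2 := by ring
        _ ≤ _ := by gcongr; linarith
    have := mul_le_mul_of_nonneg_left this hw30.le
    linarith

theorem IsProfile.bounds {X Y ε τ : ℝ} {U : ℝ → ℝ} (h : IsProfile X Y ε τ U) :
    ∃ C, 0 ≤ C ∧ ∀ t ∈ Ico 0 (Real.tan (τ / 2)), ∀ q, 0 ≤ q →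
      |confFactor t q * U (confTime t q) - √2 / den (Real.tan (τ / 2)) t q| ≤ C / (1 + q) ∧
      |penroseDt U t q - √2 * (1 - 2 * kap (Real.tan (τ / 2)) * (Real.tan (τ / 2) - t))
        / den (Real.tan (τ / 2)) t q ^ 2| ≤ C / (1 + q) ^ 2 ∧
      |penroseDx U t q + √2 * (2 * kap (Real.tan (τ / 2)))
        / den (Real.tan (τ / 2)) t q ^ 2| ≤ C / (1 + q) ^ 2 := by
  obtain ⟨B, hB⟩ := h.bound
  have hτ := h.pos
  have hπ := h.lt_pi
  have hT : 0 < Real.tan (τ / 2) := Real.tan_pos_of_pos_of_lt_pi_div_two (by linarith) (by linarith)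
  set T := Real.tan (τ / 2) with hTd
  have hB0 : 0 ≤ B := (abs_nonneg _).trans (hB 0 ⟨le_rfl, hτ⟩).1
  set m := 2 * (1 + T) with hm
  have hm2 : 2 ≤ m := by linarith
  have hC : 0 ≤ m ^ 3 * (1 + T) * (1 + T ^ 2) * B := by positivity
  refine ⟨m * B + m ^ 3 * (1 + T) * (1 + T ^ 2) * B, by positivity, fun t ht q hq => ?_⟩
  have ht0 := ht.1
  have hq1 : 0 < 1 + q := by linarith
  have hw0 := confFactor_pos (t := t) hq
  have hwm := confFactor_le ht hq
  have hS := confFactor_sq_mul (t := t) hq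
  have hd := den_pos hT ht hq
  have hmem : confTime t q ∈ Ico 0 τ := by
    refine ⟨confTime_nonneg hq ht0, (confTime_le hq ht0).trans_lt ?_⟩
    conv_rhs => rw [← two_mul_arctan_tan_half hτ hπ]
    exact mul_lt_mul_of_pos_left (Real.arctan_strictMono ht.2) two_pos
  obtain ⟨h1, h2⟩ := hB _ hmem
  rw [sin_sub_confTime hτ hπ hq] at h1 h2
  rw [cos_sub_confTime hτ hπ hq] at h2
  have ePt := penroseDt_main (T := T) hS
  have ePx := penroseDx_main (T := T) hS
  rw [penroseDt, penroseDx]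
  rw [← hTd] at h1 h2
  set w := confFactor t q
  set d := den T t q
  set c := ((1 - T ^ 2) * (1 - t ^ 2 + q) / 2 + 2 * T * t) / (1 + T ^ 2)
  set U₀ := U (confTime t q)
  set U₁ := deriv U (confTime t q)
  set b₀ := U₀ - √2 / (w * d) with hb₀
  set b₁ := U₁ - √2 * (w * c) / (w * d) ^ 2 with hb₁
  obtain ⟨r₀, r₁, r₂⟩ := remainder_bounds ht hq hw0 (by linarith) hwm h1 h2
  have hC' : 0 ≤ m * B := by positivity
  refine ⟨?_, ?_, ?_⟩
  · have e : w * U₀ - √2 / d = w * b₀ := by rw [hb₀]; field_simp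
    rw [e, abs_mul, abs_of_pos hw0]
    exact r₀.trans (by gcongr; linarith)
  · have e : w ^ 3 / 2 * ((1 + t ^ 2 + q) * U₁ - t * (1 + t ^ 2 - q) * U₀)
        - √2 * (1 - 2 * kap T * (T - t)) / d ^ 2
        = w ^ 3 / 2 * ((1 + t ^ 2 + q) * b₁ - t * (1 + t ^ 2 - q) * b₀) := by
      rw [← ePt, hb₀, hb₁]; field_simp; ring
    rw [e]
    exact r₁.trans (by gcongr; linarith)
  · have e : -(w ^ 3 / 2) * ((1 - t ^ 2 + q) * U₀ + 2 * t * U₁) + √2 * (2 * kap T) / d ^ 2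
        = -(w ^ 3 / 2 * ((1 - t ^ 2 + q) * b₀ + 2 * t * b₁)) := by
      rw [← ePx, hb₀, hb₁]; field_simp; ring
    rw [e, abs_neg]
    exact r₂.trans (by gcongr; linarith)

/-! ### Fourier transform and estimates of homogeneous Sobolev norms -/

theorem integrable_mul_schwartz {f : Space → ℂ} (hf : MemLp f 2 volume) (φ : 𝓢(Space, ℂ)) :
    Integrable (fun x => f x * φ x) :=
  MemLp.integrable_mul (p := 2) (q := 2) hf (φ.memLp 2 volume)

/-- The `L²` Fourier transform agrees with the distributional one, and Plancherel preserves the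
norm. -/
theorem exists_isFourierTransform {f : Space → ℂ} (hf : MemLp f 2 volume) :
    ∃ g, IsFourierTransform f g ∧ MemLp g 2 volume ∧ eLpNorm g 2 volume = eLpNorm f 2 volume := by
  set F := hf.toLp f
  have hF : ∀ φ : 𝓢(Space, ℂ), ∫ x, φ x • F x = ∫ x, f x * φ x := fun φ => by
    refine integral_congr_ae ?_
    filter_upwards [hf.coeFn_toLp] with x hx
    rw [hx, smul_eq_mul, mul_comm]
  refine ⟨(𝓕 F : Lp ℂ 2 volume), ⟨integrable_mul_schwartz hf,
    integrable_mul_schwartz (Lp.memLp _), fun φ => ?_⟩, Lp.memLp _, ?_⟩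
  · rw [← hF]
    have h := congrArg (fun D : 𝓢'(Space, ℂ) => D φ) (Lp.fourier_toTemperedDistribution_eq F)
    simp only [TemperedDistribution.fourier_apply, Lp.toTemperedDistribution_apply] at h
    rw [h]
    exact integral_congr_ae (.of_forall fun x => by simp [mul_comm])
  · have h := Lp.norm_fourier_eq F
    rw [Lp.norm_def, Lp.norm_def, ENNReal.toReal_eq_toReal_iff' (Lp.eLpNorm_ne_top _)
      (Lp.eLpNorm_ne_top _)] at h
    rw [h]
    exact eLpNorm_congr_ae hf.coeFn_toLp

theorem ae_eq_of_integral_mul_schwartz {g h : Space → ℂ} (hg : LocallyIntegrable g)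
    (hh : LocallyIntegrable h)
    (H : ∀ φ : 𝓢(Space, ℂ), ∫ x, g x * φ x = ∫ x, h x * φ x) : g =ᵐ[volume] h := by
  refine ae_eq_of_integral_contDiff_smul_eq hg hh fun k hk hc => ?_
  have hc' : HasCompactSupport (fun x => (k x : ℂ)) := hc.comp_left (g := fun r : ℝ => (r : ℂ)) rfl
  have hk' : ContDiff ℝ ∞ (fun x => (k x : ℂ)) := Complex.ofRealCLM.contDiff.comp hk
  simpa [mul_comm] using H (hc'.toSchwartzMap hk')

theorem IsFourierTransform.enorm_le {f g : Space → ℂ} (h : IsFourierTransform f g)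
    (hg : MemLp g 2 volume) (hf : Integrable f) :
    ∀ᵐ ξ, ‖g ξ‖ ≤ ∫ x, ‖f x‖ := by
  have hc : Continuous (𝓕 f) := 
    VectorFourier.fourierIntegral_continuous Real.continuous_fourierChar (by exact continuous_inner) hf
  have e : g =ᵐ[volume] 𝓕 f := by
    refine ae_eq_of_integral_mul_schwartz (hg.locallyIntegrable (by norm_num))
      hc.locallyIntegrable fun φ => ?_
    rw [← h.2.2 φ]
    have := VectorFourier.integral_fourierIntegral_smul_eq_flip (μ := volume) (ν := volume)
      (L := innerₗ Space) Real.continuous_fourierChar (by exact continuous_inner) hf φ.integrable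
    rw [flip_innerₗ] at this
    exact this.symm
  filter_upwards [e] with ξ hξ
  rw [hξ]
  exact VectorFourier.norm_fourierIntegral_le_integral_norm _ _ _ _ _

/-- Tested against `φ`, the derivative moves by parts onto `𝓕 φ`, whose derivative along `m` is the
transform of `-2πi⟨ξ, m⟩φ`; the defining relation of `g` then returns to the frequency side. -/
theorem IsFourierTransform.fderiv_ae {f : Space → ℂ} {g g' : Space → ℂ} {m : Space}
    (hf : MemLp f 2 volume) (hf' : MemLp (fun x => fderiv ℝ f x m) 2 volume)
    (hd : Differentiable ℝ f)
    (h : IsFourierTransform f g) (h' : IsFourierTransform (fun x => fderiv ℝ f x m) g')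
    (hg : MemLp g 2 volume) (hg' : MemLp g' 2 volume) :
    g' =ᵐ[volume] fun ξ => 2 * Real.pi * Complex.I * (inner ℝ ξ m : ℝ) * g ξ := by
  have hcont : Continuous fun ξ : Space => 2 * Real.pi * Complex.I * ((inner ℝ ξ m : ℝ) : ℂ) := by
    fun_prop
  refine ae_eq_of_integral_mul_schwartz (hg'.locallyIntegrable (by norm_num)) ?_ fun φ => ?_
  · rw [← locallyIntegrableOn_univ]
    exact ((hg.locallyIntegrable (by norm_num)).locallyIntegrableOn univ).continuousOn_mul
      hcont.continuousOn isOpen_univ.isLocallyClosed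
  set ψ : 𝓢(Space, ℂ) := -(2 * Real.pi * Complex.I) • SchwartzMap.smulLeftCLM ℂ (inner ℝ · m) φ
    with hψ
  have hψa : ∀ ξ, ψ ξ = -(2 * Real.pi * Complex.I * (inner ℝ ξ m : ℝ) * φ ξ) := fun ξ => by
    rw [hψ, _root_.smul_apply, SchwartzMap.smulLeftCLM_apply_apply (by fun_prop)]
    simp [mul_assoc]
  have e : ∀ x, fderiv ℝ (𝓕 φ : 𝓢(Space, ℂ)) x m = (𝓕 ψ) x := fun x =>
    congrArg (fun D : 𝓢(Space, ℂ) => D x) (SchwartzMap.lineDerivOp_fourier_eq φ m)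
  rw [← h'.2.2 φ]
  have ibp := integral_mul_fderiv_eq_neg_fderiv_mul_of_integrable (μ := volume) (f := f) (g := (𝓕 φ : 𝓢(Space, ℂ)))
    (v := m) (integrable_mul_schwartz hf' _) (by simpa only [e] using integrable_mul_schwartz hf (𝓕 ψ))
    (integrable_mul_schwartz hf _) (fun x _ => hd x) (fun x _ => (𝓕 φ : 𝓢(Space, ℂ)).differentiableAt)
  simp only [e] at ibp
  rw [h.2.2 ψ] at ibp
  rw [← neg_eq_iff_eq_neg.mpr ibp, ← integral_neg]
  refine integral_congr_ae (.of_forall fun ξ => ?_)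
  simp only [hψa]
  ring


theorem lintegral_enorm_sq_eq (g : Space → ℂ) : ∫⁻ ξ, ‖g ξ‖ₑ ^ 2 = eLpNorm g 2 volume ^ 2 := by
  have h := eLpNorm_nnreal_pow_eq_lintegral (f := g) (μ := volume) (p := 2) two_ne_zero
  simp only [NNReal.coe_ofNat, ENNReal.rpow_ofNat] at h
  exact h.symm

theorem volume_real_ball {r : ℝ} (hr : 0 ≤ r) :
    volume.real (Metric.ball (0 : Space) r) = r ^ 3 * (Real.pi * 4 / 3) := by
  rw [Measure.real, EuclideanSpace.volume_ball_fin_three, ENNReal.toReal_mul, ENNReal.toReal_pow,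
    ENNReal.toReal_ofReal hr, ENNReal.toReal_ofReal (by positivity)]

theorem lintegral_ball_inv_norm {ρ : ℝ} (hρ : 0 < ρ) :
    ∫⁻ ξ in Metric.ball (0 : Space) ρ, ENNReal.ofReal ‖ξ‖⁻¹ = ENNReal.ofReal (2 * Real.pi * ρ ^ 2) := by
  set F : ℝ → ℝ := (Iio ρ).indicator fun r => r⁻¹ with hF
  have h0 : ∀ y ∈ Ioi (0 : ℝ), y ^ (Module.finrank ℝ Space - 1) • F y = (Ioo 0 ρ).indicator id y := by
    intro y hy
    have hy' : y ≠ 0 := ne_of_gt hy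
    by_cases hyρ : y < ρ
    · simp [hF, indicator, hyρ, mem_Ioi.1 hy, pow_two, hy']
    · simp [hF, indicator, hyρ]
  have hint : IntegrableOn (Ioo 0 ρ |>.indicator (id : ℝ → ℝ)) (Ioi 0) :=
    ((continuous_id.integrableOn_Ioc (a := 0) (b := ρ)).mono_set Ioo_subset_Ioc_self
      |>.integrable_indicator measurableSet_Ioo).integrableOn
  have hi : Integrable (fun ξ : Space => F ‖ξ‖) := by
    rw [integrable_fun_norm_addHaar]
    exact hint.congr_fun (fun y hy => (h0 y hy).symm) measurableSet_Ioi
  have he : ∫ ξ : Space, F ‖ξ‖ = 2 * Real.pi * ρ ^ 2 := by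
    rw [integral_fun_norm_addHaar, setIntegral_congr_fun measurableSet_Ioi h0,
      setIntegral_indicator measurableSet_Ioo, volume_real_ball zero_le_one]
    have : Ioi (0 : ℝ) ∩ Ioo 0 ρ = Ioo 0 ρ := inter_eq_right.2 fun y hy => hy.1
    rw [this, ← integral_Ioc_eq_integral_Ioo, ← intervalIntegral.integral_of_le hρ.le]
    simp only [id, integral_id, finrank_euclideanSpace, Fintype.card_fin, nsmul_eq_mul, smul_eq_mul]
    push_cast
    ring
  rw [← he, ofReal_integral_eq_lintegral_ofReal hi
    (.of_forall fun ξ => by simp only [hF, indicator]; split_ifs <;> simp),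
    ← lintegral_indicator Metric.isOpen_ball.measurableSet]
  refine lintegral_congr fun ξ => ?_
  by_cases h : ‖ξ‖ < ρ <;> simp [hF, indicator, h]

/-- Low frequencies use the sup bound, as `|ξ|⁻¹` has integral `2πρ²` over the ball; high
frequencies use `|ξ|⁻¹ ≤ ρ⁻¹`. The radius stays free to balance the two. -/
theorem lintegral_inv_norm_mul_le {g : Space → ℂ} {A ρ : ℝ} 
    (hA : ∀ᵐ ξ, ‖g ξ‖ ≤ A) (hρ : 0 < ρ) :
    ∫⁻ ξ, ENNReal.ofReal ‖ξ‖⁻¹ * ‖g ξ‖ₑ ^ 2 ≤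
      ENNReal.ofReal (A ^ 2 * (2 * Real.pi * ρ ^ 2)) + ENNReal.ofReal ρ⁻¹ * eLpNorm g 2 volume ^ 2 := by
  rw [← lintegral_add_compl _ (Metric.isOpen_ball (x := (0 : Space)) (ε := ρ)).measurableSet]
  refine add_le_add ?_ ?_
  · rw [ENNReal.ofReal_mul (sq_nonneg _), ← lintegral_ball_inv_norm hρ,
      ← lintegral_const_mul _ (by fun_prop)]
    refine lintegral_mono_ae ((ae_restrict_of_ae hA).mono fun ξ h => ?_)
    rw [mul_comm, ← ofReal_norm, ← ENNReal.ofReal_pow (norm_nonneg _)]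
    gcongr
  · rw [← lintegral_enorm_sq_eq, ← lintegral_const_mul' _ _ ENNReal.ofReal_ne_top]
    refine (lintegral_mono_ae ?_).trans (setLIntegral_le_lintegral _ _)
    filter_upwards [ae_restrict_mem Metric.isOpen_ball.measurableSet.compl] with ξ hξ
    have : ρ ≤ ‖ξ‖ := by simpa using hξ
    gcongr

theorem homSobolevNorm_neg_half_le {f : Space → ℝ} (hf : Integrable f) (hf2 : MemLp f 2 volume)
    {ρ : ℝ} (hρ : 0 < ρ) :
    homSobolevNorm (-(1 / 2)) f ≤ (ENNReal.ofReal ((∫ x, |f x|) ^ 2 * (2 * Real.pi * ρ ^ 2))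
      + ENNReal.ofReal ρ⁻¹ * eLpNorm f 2 volume ^ 2) ^ (1 / 2 : ℝ) := by
  have hc : MemLp (fun x => (f x : ℂ)) 2 volume := hf2.ofReal
  obtain ⟨g, hg, hg2, he⟩ := exists_isFourierTransform hc
  refine (iInf₂_le g hg).trans ?_
  have hn : eLpNorm (fun x => (f x : ℂ)) 2 volume = eLpNorm f 2 volume :=
    eLpNorm_congr_norm_ae (.of_forall fun x => by simp)
  rw [← hn, ← he]
  gcongr
  have h := lintegral_inv_norm_mul_le (hg.enorm_le hg2 hf.ofReal) hρ
  norm_num [Real.rpow_neg_one] at h ⊢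
  exact h

theorem norm_le_sum_abs (ξ : Space) : ‖ξ‖ ≤ ∑ i, |ξ i| := by
  rw [EuclideanSpace.norm_eq]
  refine Real.sqrt_le_iff.2 ⟨Finset.sum_nonneg fun i _ => abs_nonneg _, ?_⟩
  simpa using Finset.sum_sq_le_sq_sum_of_nonneg (s := Finset.univ) (f := fun i => |ξ i|)
    fun i _ => abs_nonneg _

theorem lintegral_enorm_mul_enorm_le {f g : Space → ℂ} (hf : MemLp f 2 volume)
    (hg : MemLp g 2 volume) :
    ∫⁻ ξ, ‖f ξ‖ₑ * ‖g ξ‖ₑ ≤ eLpNorm f 2 volume * eLpNorm g 2 volume := by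
  have h := ENNReal.lintegral_mul_le_Lp_mul_Lq volume Real.HolderConjugate.two_two hf.1.enorm hg.1.enorm
  simp only [eLpNorm_eq_lintegral_rpow_enorm_toReal two_ne_zero ENNReal.ofNat_ne_top]
  exact h

/-- Interpolation: `|ξ||f̂|² ≤ ∑ |2πξᵢ f̂||f̂|`, then Cauchy–Schwarz and Plancherel for each `i`. -/
theorem homSobolevNorm_half_le {f : Space → ℝ} (hf : MemLp f 2 volume) (hd : Differentiable ℝ f)
    (hf' : ∀ i, MemLp (fun x => fderiv ℝ f x (EuclideanSpace.single i 1)) 2 volume) :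
    homSobolevNorm (1 / 2) f ≤ ((∑ i, eLpNorm (fun x => fderiv ℝ f x (EuclideanSpace.single i 1))
      2 volume) * eLpNorm f 2 volume) ^ (1 / 2 : ℝ) := by
  have hc : MemLp (fun x => (f x : ℂ)) 2 volume := hf.ofReal
  have hder : ∀ i, (fun x => fderiv ℝ (fun x => (f x : ℂ)) x (EuclideanSpace.single i 1)) =
      fun x => ((fderiv ℝ f x (EuclideanSpace.single i 1) : ℝ) : ℂ) := fun i => by
    funext x
    exact congrArg (fun L : Space →L[ℝ] ℂ => L (EuclideanSpace.single i 1))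
      (Complex.ofRealCLM.hasFDerivAt.comp x (hd x).hasFDerivAt).fderiv
  have hc' : ∀ i, MemLp (fun x => fderiv ℝ (fun x => (f x : ℂ)) x (EuclideanSpace.single i 1)) 2
      volume := fun i => by
    rw [hder]
    exact (hf' i).ofReal
  obtain ⟨g, hg, hg2, he⟩ := exists_isFourierTransform hc
  choose G hG hG2 hGe using fun i => exists_isFourierTransform (hc' i)
  refine (iInf₂_le g hg).trans ?_
  have hn : eLpNorm (fun x => (f x : ℂ)) 2 volume = eLpNorm f 2 volume :=
    eLpNorm_congr_norm_ae (.of_forall fun x => by simp)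
  have hn' : ∀ i, eLpNorm (G i) 2 volume
      = eLpNorm (fun x => fderiv ℝ f x (EuclideanSpace.single i 1)) 2 volume := fun i => by
    rw [hGe, hder]
    exact eLpNorm_congr_norm_ae (.of_forall fun x => by simp)
  have key : ∀ᵐ ξ, ∀ i, G i ξ = 2 * Real.pi * Complex.I * (inner ℝ ξ (EuclideanSpace.single i 1) : ℝ) * g ξ :=
    ae_all_iff.2 fun i => IsFourierTransform.fderiv_ae hc (hc' i)
      (Complex.ofRealCLM.differentiable.comp hd) hg (hG i) hg2 (hG2 i)
  gcongr
  calc ∫⁻ ξ, ENNReal.ofReal (‖ξ‖ ^ (2 * (1 / 2) : ℝ)) * ‖g ξ‖ₑ ^ 2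
      ≤ ∫⁻ ξ, ∑ i, ‖G i ξ‖ₑ * ‖g ξ‖ₑ := by
        refine lintegral_mono_ae (key.mono fun ξ h => ?_)
        rw [← Finset.sum_mul, pow_two, ← mul_assoc]
        gcongr
        rw [mul_one_div_cancel two_ne_zero, Real.rpow_one]
        have e : ∀ i, ‖G i ξ‖ₑ = ENNReal.ofReal (2 * Real.pi * |ξ i| * ‖g ξ‖) := fun i => by
          rw [h i, ← ofReal_norm]
          simp [abs_of_pos Real.pi_pos, EuclideanSpace.inner_single_right]
        simp only [e]
        rw [← ENNReal.ofReal_sum_of_nonneg fun i _ => by positivity, ← ofReal_norm,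
          ← ENNReal.ofReal_mul (norm_nonneg _), ← Finset.sum_mul, ← Finset.mul_sum]
        gcongr
        refine (norm_le_sum_abs ξ).trans (le_mul_of_one_le_left (Finset.sum_nonneg fun i _ => abs_nonneg _) ?_)
        linarith [Real.pi_gt_three]
    _ = ∑ i, ∫⁻ ξ, ‖G i ξ‖ₑ * ‖g ξ‖ₑ :=
        lintegral_finsetSum' _ fun i _ => (hG2 i).1.enorm.mul hg2.1.enorm
    _ ≤ _ := by
        rw [Finset.sum_mul]
        refine Finset.sum_le_sum fun i _ => ?_
        rw [← hn', ← hn, ← he]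
        exact lintegral_enorm_mul_enorm_le (hG2 i) hg2

/-- A smooth cutoff at scale `l`. -/
def cutoff {l : ℝ} (hl : 0 < l) : ContDiffBump (0 : Space) := ⟨l, 2 * l, hl, by linarith⟩

theorem integral_norm_pow_cutoff_le {l : ℝ} (hl : 0 < l) {n : ℕ} (hn : n ≠ 0) :
    ∫ x, (cutoff hl x) ^ n ≤ 32 * Real.pi / 3 * l ^ 3 := by
  have h : ∀ x, (cutoff hl x) ^ n ≤ (Metric.ball (0 : Space) (2 * l)).indicator 1 x := fun x => by
    by_cases hx : x ∈ Metric.ball (0 : Space) (2 * l)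
    · rw [indicator_of_mem hx]
      exact pow_le_one₀ (cutoff hl).nonneg (cutoff hl).le_one
    · rw [indicator_of_notMem hx, (cutoff hl).zero_of_le_dist (not_lt.1 hx), zero_pow hn]
  refine (integral_mono_of_nonneg (.of_forall fun x => pow_nonneg (cutoff hl).nonneg n) 
    ((integrable_indicator_iff measurableSet_ball).2 
      (integrableOn_const (C := (1 : ℝ)) measure_ball_lt_top.ne)) (.of_forall h)).trans ?_
  rw [integral_indicator measurableSet_ball, setIntegral_const, volume_real_ball (by linarith), smul_eq_mul, mul_one]
  linarith

/-- The cutoff as a Schwartz function. -/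
def cutoffSchwartz {l : ℝ} (hl : 0 < l) : 𝓢(Space, ℂ) :=
  ((cutoff hl).hasCompactSupport.comp_left (g := fun r : ℝ => (r : ℂ)) rfl).toSchwartzMap
    (Complex.ofRealCLM.contDiff.comp (cutoff hl).contDiff)

@[simp]
theorem cutoffSchwartz_apply {l : ℝ} (hl : 0 < l) (x : Space) :
    cutoffSchwartz hl x = (cutoff hl x : ℂ) := rfl

/-- Frequencies are split at `ρ = 1/l`, where both parts are of order `l⁴`: the sup norm and the
squared `L²` norm are at most the volume `32πl³/3` of the ball of radius `2l`. -/
theorem lintegral_inv_norm_fourierInv_cutoff_le {l : ℝ} (hl : 0 < l) :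
    ∫⁻ ξ, ENNReal.ofReal ‖ξ‖⁻¹ * ‖(𝓕⁻ (cutoffSchwartz hl) : 𝓢(Space, ℂ)) ξ‖ₑ ^ 2 ≤
      ENNReal.ofReal (((32 * Real.pi / 3) ^ 2 * (2 * Real.pi) + 32 * Real.pi / 3) * l ^ 4) := by
  set φ : 𝓢(Space, ℂ) := 𝓕⁻ (cutoffSchwartz hl) with hφ
  have hφψ : 𝓕 φ = cutoffSchwartz hl := FourierTransform.fourier_fourierInv_eq _
  have h1 : ∀ ξ, ‖φ ξ‖ ≤ 32 * Real.pi / 3 * l ^ 3 := fun ξ => by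
    have : φ ξ = 𝓕⁻ (cutoffSchwartz hl : Space → ℂ) ξ := by rw [hφ, SchwartzMap.fourierInv_coe]
    rw [this, Real.fourierInv_eq]
    refine (norm_integral_le_integral_norm _).trans ?_
    have := integral_norm_pow_cutoff_le hl one_ne_zero
    simpa [Circle.norm_smul, abs_of_nonneg (cutoff hl).nonneg] using this
  have h2 : eLpNorm φ 2 volume ^ 2 ≤ ENNReal.ofReal (32 * Real.pi / 3 * l ^ 3) := by
    have e := SchwartzMap.integral_norm_sq_fourier φ
    rw [hφψ] at e
    rw [← lintegral_enorm_sq_eq]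
    have : ∀ ξ, ‖φ ξ‖ₑ ^ 2 = ENNReal.ofReal (‖φ ξ‖ ^ 2) := fun ξ => by
      rw [← ofReal_norm, ENNReal.ofReal_pow (norm_nonneg _)]
    simp only [this]
    rw [← ofReal_integral_eq_lintegral_ofReal _ (.of_forall fun ξ => by positivity), ← e]
    · refine ENNReal.ofReal_le_ofReal ?_
      simpa [abs_of_nonneg (cutoff hl).nonneg] using integral_norm_pow_cutoff_le hl two_ne_zero
    · exact (memLp_two_iff_integrable_sq_norm φ.continuous.aestronglyMeasurable).1
        (φ.memLp 2 volume)
  refine (lintegral_inv_norm_mul_le (.of_forall h1) (inv_pos.2 hl)).trans ?_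
  rw [inv_inv]
  refine (add_le_add_right (mul_le_mul_right h2 _) _).trans_eq ?_
  rw [← ENNReal.ofReal_mul hl.le, ← ENNReal.ofReal_add (by positivity) (by positivity)]
  congr 1
  field_simp

/-- Duality with a bump whose `Ḣ^{-1/2}` norm is `O(l²)`: a pairing of size `a l` forces a norm of
order `a/l`. As the norm is an infimum, the bound is proved for every admissible transform `g`. -/
theorem exists_le_homSobolevNorm_half : ∃ k > 0, ∀ (f : Space → ℝ) (a l : ℝ) (hl : 0 < l), 0 < a →
    a * l ≤ ∫ x, f x * cutoff hl x → ENNReal.ofReal (k * a / l) ≤ homSobolevNorm (1 / 2) f := by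
  set K := (32 * Real.pi / 3) ^ 2 * (2 * Real.pi) + 32 * Real.pi / 3 with hK
  have hKpos : 0 < K := by positivity
  refine ⟨(√(4 * K))⁻¹ , by positivity, fun f a l hl ha h => le_iInf₂ fun g hg => ?_⟩
  set φ : 𝓢(Space, ℂ) := 𝓕⁻ (cutoffSchwartz hl) with hφ
  have hφψ : 𝓕 φ = cutoffSchwartz hl := FourierTransform.fourier_fourierInv_eq _
  -- With this `M`, the inequality `|gφ| ≤ M|ξ||g|² + |ξ|⁻¹|φ|²/(4M)` has a second term whose
  -- integral is at most `a l/8`, which the left-hand side absorbs.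
  have hM : 0 < 2 * K / a * l ^ 3 := by positivity
  have e := hg.2.2 φ
  rw [hφψ] at e
  have e1 : ENNReal.ofReal (a * l) ≤ ∫⁻ ξ, ‖g ξ‖ₑ * ‖φ ξ‖ₑ := by
    have e2 : ∫ x, (f x : ℂ) * cutoffSchwartz hl x = ((∫ x, f x * cutoff hl x : ℝ) : ℂ) := by
      rw [← integral_complex_ofReal]
      simp
    refine (ENNReal.ofReal_le_ofReal h).trans ?_
    refine (ENNReal.ofReal_le_ofReal (le_abs_self _)).trans ?_
    rw [← Real.norm_eq_abs, ← Complex.norm_real, ← e2, e, ofReal_norm]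
    simpa only [enorm_mul] using enorm_integral_le_lintegral_enorm (fun ξ => g ξ * φ ξ)
  set H := ∫⁻ ξ, ENNReal.ofReal (‖ξ‖ ^ (2 * (1 / 2) : ℝ)) * ‖g ξ‖ₑ ^ 2 with hH
  rcases eq_or_ne H ⊤ with hT | hT
  · rw [hT]; simp
  have e3 : ENNReal.ofReal (a * l) ≤ ENNReal.ofReal (2 * K / a * l ^ 3) * H
      + ENNReal.ofReal (a / (8 * K) / l ^ 3 * (K * l ^ 4)) := by
    refine e1.trans ?_
    rw [ENNReal.ofReal_mul (p := a / (8 * K) / l ^ 3) (by positivity)]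
    refine le_trans ?_ (add_le_add_right (mul_le_mul_right (lintegral_inv_norm_fourierInv_cutoff_le hl) _) _)
    rw [hH, ← lintegral_const_mul' _ _ ENNReal.ofReal_ne_top,
      ← lintegral_const_mul' _ _ ENNReal.ofReal_ne_top, ← lintegral_add_right']
    · refine lintegral_mono_ae ?_
      have : ∀ᵐ ξ : Space, ξ ≠ 0 := by simp [ae_iff]
      filter_upwards [this] with ξ hξ
      have hξ' : 0 < ‖ξ‖ := norm_pos_iff.2 hξ
      rw [← ofReal_norm, ← ofReal_norm, ← ENNReal.ofReal_mul (norm_nonneg _),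
        ← ENNReal.ofReal_pow (norm_nonneg _), ← ENNReal.ofReal_pow (norm_nonneg _),
        ← ENNReal.ofReal_mul (by positivity), ← ENNReal.ofReal_mul (by positivity),
        ← ENNReal.ofReal_mul (by positivity), ← ENNReal.ofReal_mul (by positivity),
        ← ENNReal.ofReal_add (by positivity) (by positivity)]
      refine ENNReal.ofReal_le_ofReal ?_
      rw [mul_one_div_cancel two_ne_zero, Real.rpow_one]
      set M := 2 * K / a * l ^ 3
      have eM : a / (8 * K) / l ^ 3 = 1 / (4 * M) := by simp only [M]; field_simp; ring
      rw [eM]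
      have := sq_nonneg (2 * M * ‖ξ‖ * ‖g ξ‖ - ‖φ ξ‖)
      have e4 : M * (‖ξ‖ * ‖g ξ‖ ^ 2) + 1 / (4 * M) * (‖ξ‖⁻¹ * ‖φ ξ‖ ^ 2) - ‖g ξ‖ * ‖φ ξ‖
          = (2 * M * ‖ξ‖ * ‖g ξ‖ - ‖φ ξ‖) ^ 2 / (4 * M * ‖ξ‖) := by
        field_simp; ring
      have : 0 ≤ (2 * M * ‖ξ‖ * ‖g ξ‖ - ‖φ ξ‖) ^ 2 / (4 * M * ‖ξ‖) := by positivity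
      linarith
    · have := φ.continuous
      fun_prop
  have e5 : a * l ≤ 2 * K / a * l ^ 3 * H.toReal + a * l / 8 := by
    rw [← ENNReal.ofReal_toReal hT, ← ENNReal.ofReal_mul hM.le,
      ← ENNReal.ofReal_add (by positivity) (by positivity),
      ENNReal.ofReal_le_ofReal_iff (by positivity)] at e3
    refine e3.trans_eq ?_
    congr 1
    field_simp
  have e6 : a ^ 2 / (4 * K * l ^ 2) ≤ H.toReal := by
    rw [div_le_iff₀ (by positivity)]
    have : a * (2 * K / a * l ^ 3 * H.toReal) = 2 * K * l ^ 3 * H.toReal := by field_simp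
    have h7 : 0 < a * l := by positivity
    have h8 : a * l ≤ 2 * (2 * K / a * l ^ 3 * H.toReal) := by linarith
    have h9 := mul_le_mul_of_nonneg_left h8 (by positivity : 0 ≤ a / l)
    have h10 : a / l * (a * l) = a ^ 2 := by field_simp
    have h11 : a / l * (2 * (2 * K / a * l ^ 3 * H.toReal)) = H.toReal * (4 * K * l ^ 2) := by
      field_simp; ring
    linarith
  rw [← ENNReal.ofReal_toReal hT, ENNReal.ofReal_rpow_of_nonneg ENNReal.toReal_nonneg (by norm_num),
    ← Real.sqrt_eq_rpow]
  refine ENNReal.ofReal_le_ofReal (Real.le_sqrt_of_sq_le (le_of_eq_of_le ?_ e6))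
  rw [div_pow, mul_pow, inv_pow, Real.sq_sqrt (by positivity)]
  field_simp

/-! ### Lebesgue norms of powers of `c + κ|x|²` -/

/-- The integral `∫ (1 + κ|y|²)^{-r} dy` over `ℝ³`. -/
def bracketIntegral (κ r : ℝ) : ℝ := ∫ y : Space, (1 + κ * ‖y‖ ^ 2) ^ (-r)

theorem bracketIntegral_nonneg {κ : ℝ} (hκ : 0 < κ) (r : ℝ) : 0 ≤ bracketIntegral κ r :=
  integral_nonneg fun y => by positivity

theorem continuous_quad_rpow {κ c : ℝ} (hκ : 0 < κ) (hc : 0 < c) (r : ℝ) :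
    Continuous fun x : Space => (c + κ * ‖x‖ ^ 2) ^ r :=
  Continuous.rpow_const (by fun_prop) fun x => Or.inl (by positivity)

theorem integrable_quad_rpow {κ c r : ℝ} (hκ : 0 < κ) (hc : 0 < c) (hr : 3 / 2 < r) :
    Integrable fun x : Space => (c + κ * ‖x‖ ^ 2) ^ (-r) := by
  have h : Integrable fun x : Space => ((1 : ℝ) + ‖x‖ ^ 2) ^ (-(2 * r) / 2) :=
    integrable_rpow_neg_one_add_norm_sq (by simp; linarith)
  have hm : 0 < min c κ := lt_min hc hκ
  refine (h.const_mul (min c κ ^ (-r))).mono' (continuous_quad_rpow hκ hc _).aestronglyMeasurable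
    (.of_forall fun x => ?_)
  rw [Real.norm_of_nonneg (by positivity), show -(2 * r) / 2 = -r by ring,
    ← Real.mul_rpow hm.le (by positivity)]
  refine Real.rpow_le_rpow_of_nonpos (by positivity) ?_ (by linarith)
  have h1 : min c κ ≤ c := min_le_left _ _
  have h2 : min c κ ≤ κ := min_le_right _ _
  nlinarith [mul_le_mul_of_nonneg_right h2 (sq_nonneg ‖x‖)]

/-- Rescaling by `√c`. The power of `c` extracted here is the source of the Lebesgue blow-up rates.
-/
theorem integral_quad_rpow {κ c : ℝ} (hκ : 0 < κ) (hc : 0 < c) (r : ℝ) :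
    ∫ x : Space, (c + κ * ‖x‖ ^ 2) ^ (-r) = c ^ (3 / 2 - r) * bracketIntegral κ r := by
  have h := Measure.integral_comp_smul (volume : Measure Space)
    (fun x : Space => (c + κ * ‖x‖ ^ 2) ^ (-r)) (√c)
  have e : ∀ x : Space, (c + κ * ‖√c • x‖ ^ 2) ^ (-r) = c ^ (-r) * (1 + κ * ‖x‖ ^ 2) ^ (-r) :=
    fun x => by
      rw [← Real.mul_rpow hc.le (by positivity), norm_smul, mul_pow, Real.norm_of_nonneg
        (Real.sqrt_nonneg c), Real.sq_sqrt hc.le]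
      ring_nf
  simp only [e] at h
  rw [integral_const_mul, finrank_euclideanSpace, Fintype.card_fin, smul_eq_mul,
    abs_of_nonneg (by positivity)] at h
  have h3 : √c ^ 3 = c ^ (3 / 2 : ℝ) := by
    rw [Real.sqrt_eq_rpow, ← Real.rpow_natCast, ← Real.rpow_mul hc.le]
    norm_num
  rw [h3, eq_inv_mul_iff_mul_eq₀ (by positivity)] at h
  rw [← h, ← mul_assoc, ← Real.rpow_add hc, bracketIntegral]
  rfl

theorem memLp_quad_rpow {κ c k p : ℝ} (hκ : 0 < κ) (hc : 0 < c) (hp : 0 < p) (hkp : 3 / 2 < k * p) :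
    MemLp (fun x : Space => (c + κ * ‖x‖ ^ 2) ^ (-k)) (ENNReal.ofReal p) volume := by
  rw [← integrable_norm_rpow_iff (continuous_quad_rpow hκ hc _).aestronglyMeasurable
    (by simpa using hp) ENNReal.ofReal_ne_top, ENNReal.toReal_ofReal hp.le]
  refine (integrable_quad_rpow hκ hc hkp).congr (.of_forall fun x => ?_)
  dsimp only
  rw [Real.norm_of_nonneg (by positivity), ← Real.rpow_mul (by positivity), neg_mul]

theorem eLpNorm_quad_rpow {κ c k p : ℝ} (hκ : 0 < κ) (hc : 0 < c) (hp : 0 < p)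
    (hkp : 3 / 2 < k * p) :
    (eLpNorm (fun x : Space => (c + κ * ‖x‖ ^ 2) ^ (-k)) (ENNReal.ofReal p) volume).toReal =
      c ^ (3 / 2 * p⁻¹ - k) * bracketIntegral κ (k * p) ^ p⁻¹ := by
  rw [MemLp.eLpNorm_eq_integral_rpow_norm (by simpa using hp) ENNReal.ofReal_ne_top
    (memLp_quad_rpow hκ hc hp hkp), ENNReal.toReal_ofReal hp.le, ENNReal.toReal_ofReal (by positivity)]
  have e : ∀ x : Space, ‖(c + κ * ‖x‖ ^ 2) ^ (-k)‖ ^ p = (c + κ * ‖x‖ ^ 2) ^ (-(k * p)) := fun x => by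
    rw [Real.norm_of_nonneg (by positivity), ← Real.rpow_mul (by positivity), neg_mul]
  simp only [e]
  rw [integral_quad_rpow hκ hc, Real.mul_rpow (by positivity) (bracketIntegral_nonneg hκ _),
    ← Real.rpow_mul hc.le]
  congr 2
  field_simp

/-- In polar coordinates the area `4π` of the unit sphere accounts for the passage from `2^{7/2} π`
to `2^{3/2}`. -/
theorem C₀_eq {T : ℝ} : C₀ T = 2 ^ (3 / 2 : ℝ) * bracketIntegral (T / (1 + T ^ 2)) 3 := by
  rw [C₀, bracketIntegral, integral_fun_norm_addHaar (volume : Measure Space)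
    (fun y => (1 + T / (1 + T ^ 2) * y ^ 2) ^ (-3 : ℝ)), volume_real_ball zero_le_one]
  have e : ∫ ρ in Ioi (0 : ℝ), (1 + ρ ^ 2 * T / (1 + T ^ 2)) ^ (-3 : ℤ) * ρ ^ 2
      = ∫ y in Ioi (0 : ℝ), y ^ (Module.finrank ℝ Space - 1) • (1 + T / (1 + T ^ 2) * y ^ 2) ^ (-3 : ℝ) := by
    refine setIntegral_congr_fun measurableSet_Ioi fun y _ => ?_
    simp only [finrank_euclideanSpace, Fintype.card_fin, smul_eq_mul, Nat.add_one_sub_one]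
    rw [mul_comm, show (-3 : ℝ) = ((-3 : ℤ) : ℝ) by norm_num, Real.rpow_intCast]
    congr 3
    ring
  rw [e]
  have e2 : (2 : ℝ) ^ (7 / 2 : ℝ) = 2 ^ (3 / 2 : ℝ) * 4 := by
    rw [show (7 / 2 : ℝ) = 3 / 2 + 2 by norm_num, Real.rpow_add two_pos]
    norm_num
  simp only [e2, finrank_euclideanSpace, Fintype.card_fin, smul_eq_mul, nsmul_eq_mul]
  push_cast
  ring

/-! ### Perturbation of Lebesgue norms -/

theorem memLp_and_abs_eLpNorm_sub_le {f m b : Space → ℝ} {p : ℝ≥0∞} (hp : 1 ≤ p)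
    (hf : AEStronglyMeasurable f volume) (hm : MemLp m p volume) (hb : MemLp b p volume)
    (h : ∀ x, |f x - m x| ≤ b x) :
    MemLp f p volume ∧
      |(eLpNorm f p volume).toReal - (eLpNorm m p volume).toReal| ≤ (eLpNorm b p volume).toReal := by
  have hd : MemLp (f - m) p volume := hb.of_le (hf.sub hm.1) (.of_forall fun x => by
    simpa using (h x).trans (le_abs_self _))
  have hle : (eLpNorm (f - m) p volume).toReal ≤ (eLpNorm b p volume).toReal :=
    ENNReal.toReal_mono hb.2.ne (eLpNorm_mono_real fun x => by simpa using h x)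
  have hfm : MemLp f p volume := by simpa using hd.add hm
  refine ⟨hfm, le_trans ?_ hle⟩
  have : Fact (1 ≤ p) := ⟨hp⟩
  have := abs_norm_sub_norm_le (hfm.toLp f) (hm.toLp m)
  rwa [← MemLp.toLp_sub, Lp.norm_toLp, Lp.norm_toLp, Lp.norm_toLp] at this

/-! ### Norms of functions close to multiples of powers of `c + κ|x|²` -/

/-- Reverse triangle inequality in `L^p`. The bound on the error does not involve `c`, so the main
term determines the norm up to `O(1)` as `c → 0`. -/
theorem abs_eLpNorm_sub_quad_le {κ c k p a C : ℝ} {f : Space → ℝ} (hκ : 0 < κ) (hc : 0 < c)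
    (hp : 1 ≤ p) (hkp : 3 / 2 < k * p) (hC : 0 ≤ C) (hf : AEStronglyMeasurable f volume)
    (h : ∀ x, |f x - a * (c + κ * ‖x‖ ^ 2) ^ (-k)| ≤ C * (1 + 1 * ‖x‖ ^ 2) ^ (-k)) :
    MemLp f (ENNReal.ofReal p) volume ∧
      |(eLpNorm f (ENNReal.ofReal p) volume).toReal
        - |a| * (c ^ (3 / 2 * p⁻¹ - k) * bracketIntegral κ (k * p) ^ p⁻¹)| ≤
      C * bracketIntegral 1 (k * p) ^ p⁻¹ := by
  have hp0 : 0 < p := by linarith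
  have h1 := memLp_and_abs_eLpNorm_sub_le (p := ENNReal.ofReal p) (by simpa using hp) hf
    ((memLp_quad_rpow hκ hc hp0 hkp).const_mul a)
    ((memLp_quad_rpow one_pos one_pos hp0 hkp).const_mul C) h
  have e : ∀ (b κ' c' : ℝ), 0 < κ' → 0 < c' →
      (eLpNorm (fun x : Space => b * (c' + κ' * ‖x‖ ^ 2) ^ (-k)) (ENNReal.ofReal p) volume).toReal
      = |b| * (c' ^ (3 / 2 * p⁻¹ - k) * bracketIntegral κ' (k * p) ^ p⁻¹) := fun b κ' c' hκ' hc' => by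
    have := eLpNorm_const_smul b (fun x : Space => (c' + κ' * ‖x‖ ^ 2) ^ (-k)) (ENNReal.ofReal p)
      volume
    rw [← eLpNorm_quad_rpow hκ' hc' hp0 hkp, ← Real.norm_eq_abs, ← toReal_enorm,
      ← ENNReal.toReal_mul, ← this]
    rfl
  rw [e _ _ _ hκ hc, e _ _ _ one_pos one_pos, abs_of_nonneg hC, Real.one_rpow, one_mul] at h1
  exact h1

/-- The exponent `3/(2p) - k` is nonpositive: `c` may be replaced by `s/2`, and the bounded error is
swallowed by the same power of `s ≤ 1`. The constant is then uniform in time. -/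
theorem exists_eLpNorm_le (κ a₀ C k p : ℝ) (hκ : 0 < κ) (hC : 0 ≤ C) (hp : 1 ≤ p)
    (hkp : 3 / 2 < k * p) :
    ∃ B, 0 ≤ B ∧ ∀ (s c a : ℝ) (f : Space → ℝ), 0 < s → s ≤ 1 → s / 2 ≤ c → |a| ≤ a₀ →
      AEStronglyMeasurable f volume →
      (∀ x, |f x - a * (c + κ * ‖x‖ ^ 2) ^ (-k)| ≤ C * (1 + 1 * ‖x‖ ^ 2) ^ (-k)) →
      MemLp f (ENNReal.ofReal p) volume ∧
        eLpNorm f (ENNReal.ofReal p) volume ≤ ENNReal.ofReal (B * s ^ (3 / 2 * p⁻¹ - k)) := by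
  have hp0 : 0 < p := by linarith
  set e := 3 / 2 * p⁻¹ - k with he
  have hneg : e ≤ 0 := by
    have : e * p = 3 / 2 - k * p := by rw [he]; field_simp
    exact nonpos_of_mul_nonpos_left (by linarith) hp0
  have hJ := bracketIntegral_nonneg hκ (k * p)
  have hJ1 := bracketIntegral_nonneg one_pos (k * p)
  refine ⟨|a₀| * ((1 / 2) ^ e * bracketIntegral κ (k * p) ^ p⁻¹)
    + C * bracketIntegral 1 (k * p) ^ p⁻¹, by positivity, fun s c a f hs hs1 hc ha hf h => ?_⟩
  have hc0 : 0 < c := by linarith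
  obtain ⟨h1, h2⟩ := abs_eLpNorm_sub_quad_le hκ hc0 hp hkp hC hf h
  refine ⟨h1, (ENNReal.le_ofReal_iff_toReal_le h1.2.ne (by positivity)).2 ?_⟩
  have h3 : c ^ e ≤ (1 / 2) ^ e * s ^ e := by
    rw [← Real.mul_rpow (by norm_num) hs.le]
    exact Real.rpow_le_rpow_of_nonpos (by positivity) (by linarith) hneg
  have h4 : 1 ≤ s ^ e := Real.one_le_rpow_of_pos_of_le_one_of_nonpos hs hs1 hneg
  have h5 := (abs_le.1 h2).2
  calc (eLpNorm f (ENNReal.ofReal p) volume).toReal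
      ≤ |a| * (c ^ e * bracketIntegral κ (k * p) ^ p⁻¹) + C * bracketIntegral 1 (k * p) ^ p⁻¹ := by
        linarith
    _ ≤ |a₀| * ((1 / 2) ^ e * s ^ e * bracketIntegral κ (k * p) ^ p⁻¹)
        + C * bracketIntegral 1 (k * p) ^ p⁻¹ * s ^ e := by
        refine add_le_add ?_ (le_mul_of_one_le_right (by positivity) h4)
        have ha' : |a| ≤ |a₀| := ha.trans (le_abs_self _)
        gcongr
    _ = _ := by ring

/-! ### The solution near the blow-up time -/

/-- The properties of `penrose U` at times `t` close to the blow-up time `T`. -/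
structure NearBlowup (T C : ℝ) (U : ℝ → ℝ) (t : ℝ) : Prop where
  pos : 0 < T - t
  le_one : T - t ≤ 1
  kap_mul_le : kap T * (T - t) ≤ 1 / 2
  smooth : ContDiff ℝ ∞ (penrose U t)
  continuous_dt : Continuous fun x : Space => penroseDt U t (‖x‖ ^ 2)
  fderiv_eq : ∀ (x : Space) (i : Fin 3),
    fderiv ℝ (penrose U t) x (EuclideanSpace.single i 1) = x i * penroseDx U t (‖x‖ ^ 2)
  bound : ∀ x : Space, |penrose U t x - √2 / den T t (‖x‖ ^ 2)| ≤ C / (1 + ‖x‖ ^ 2)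
  bound_dt : ∀ x : Space, |penroseDt U t (‖x‖ ^ 2) - √2 * (1 - 2 * kap T * (T - t))
    / den T t (‖x‖ ^ 2) ^ 2| ≤ C / (1 + ‖x‖ ^ 2) ^ 2
  bound_dx : ∀ x : Space, |penroseDx U t (‖x‖ ^ 2) + √2 * (2 * kap T) / den T t (‖x‖ ^ 2) ^ 2|
    ≤ C / (1 + ‖x‖ ^ 2) ^ 2

theorem continuous_deriv_time {a b t : ℝ} {u : ℝ → Space → ℝ}
    (h : ContDiffOn ℝ ∞ (fun p : ℝ × Space => u p.1 p.2) (Ioo a b ×ˢ univ)) (ht : t ∈ Ioo a b) :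
    Continuous fun x => deriv (fun s => u s x) t := by
  have e : (fun x => deriv (fun s => u s x) t)
      = fun x => pd eT (fun p : ℝ × Space => u p.1 p.2) (t, x) := by
    funext x
    exact (hasDerivAt_slice_time (differentiableAt_of_slab h (p := (t, x)) ht)).deriv
  have h1 : ContinuousOn (fderiv ℝ (fun p : ℝ × Space => u p.1 p.2)) (Ioo a b ×ˢ univ) :=
    h.continuousOn_fderiv_of_isOpen (isOpen_Ioo.prod isOpen_univ) (by simp)
  rw [e]
  refine continuous_iff_continuousAt.2 fun x => ?_
  have h2 := h1.continuousAt ((isOpen_Ioo.prod isOpen_univ).mem_nhds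
    (⟨ht, mem_univ x⟩ : ((t, x) : ℝ × Space) ∈ Ioo a b ×ˢ univ))
  exact (h2.comp (f := fun x : Space => (t, x)) (by fun_prop)).clm_apply continuousAt_const

theorem IsProfile.eventually_nearBlowup {X Y ε τ : ℝ} {U : ℝ → ℝ} (h : IsProfile X Y ε τ U)
    (hε : ε < Real.pi) :
    ∃ C, 0 ≤ C ∧ ∀ᶠ t in 𝓝[<] Real.tan (τ / 2), NearBlowup (Real.tan (τ / 2)) C U t := by
  have hsol := h.isSolution hε
  obtain ⟨C, hC, hb⟩ := h.bounds
  have hτ := h.pos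
  have hπ := h.lt_pi
  have hε0 := h.eps_pos
  have hT : 0 < Real.tan (τ / 2) := Real.tan_pos_of_pos_of_lt_pi_div_two (by linarith) (by linarith)
  have hE : 0 < Real.tan (ε / 2) := Real.tan_pos_of_pos_of_lt_pi_div_two (by linarith) (by linarith)
  set T := Real.tan (τ / 2) with hTd
  have hκ := kap_pos hT
  refine ⟨C, hC, ?_⟩
  have h0 : max (max 0 (T - 1)) (T - 1 / (2 * kap T)) < T := by
    simp only [max_lt_iff, sub_lt_self_iff]
    exact ⟨⟨hT, one_pos⟩, by positivity⟩
  filter_upwards [Ioo_mem_nhdsLT h0] with t ht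
  obtain ⟨⟨⟨ht0, ht1⟩, ht2⟩, htT⟩ : ((0 < t ∧ T - 1 < t) ∧ T - 1 / (2 * kap T) < t) ∧ t < T := by
    simpa only [mem_Ioo, max_lt_iff] using ht
  have htI : t ∈ Ioo (-Real.tan (ε / 2)) T := ⟨by linarith, htT⟩
  have hd : ∀ x : Space, DifferentiableAt ℝ U (confTime t (‖x‖ ^ 2)) := fun x =>
    h.differentiableAt (confTime_mem h.eps_pos hε h.pos h.lt_pi (sq_nonneg _) htI)
  have hb' := fun x : Space => hb t ⟨ht0.le, htT⟩ (‖x‖ ^ 2) (sq_nonneg _)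
  have hsm := contDiff_slice hsol.smooth htI
  refine ⟨by linarith, by linarith, ?_, hsm, ?_, fun x i => ?_, fun x => (hb' x).1,
    fun x => (hb' x).2.1, fun x => (hb' x).2.2⟩
  · have h3 : T - t < 1 / (2 * kap T) := by linarith
    rw [lt_div_iff₀ (by positivity)] at h3
    linarith
  · refine (continuous_deriv_time hsol.smooth htI).congr fun x => ?_
    exact (hasDerivAt_penrose_time (hd x)).deriv
  · exact fderiv_apply_eq_of_hasDerivAt (hsm.differentiable (by simp) x)
      (hasDerivAt_penrose_line i (hd x))

namespace NearBlowup

variable {T C t : ℝ} {U : ℝ → ℝ}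

theorem half_le (h : NearBlowup T C U t) :
    (T - t) / 2 ≤ (T - t) * (1 - kap T * (T - t)) := by
  have := mul_le_mul_of_nonneg_left h.kap_mul_le h.pos.le
  linarith

theorem const_pos (h : NearBlowup T C U t) : 0 < (T - t) * (1 - kap T * (T - t)) := by
  have := h.half_le
  have := h.pos
  linarith

theorem bound' (h : NearBlowup T C U t) (x : Space) :
    |penrose U t x - √2 * ((T - t) * (1 - kap T * (T - t)) + kap T * ‖x‖ ^ 2) ^ (-1 : ℝ)|
      ≤ C * (1 + 1 * ‖x‖ ^ 2) ^ (-1 : ℝ) := by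
  rw [Real.rpow_neg_one, Real.rpow_neg_one, one_mul]
  exact h.bound x

theorem bound_dt' (h : NearBlowup T C U t) (hκ : 0 < kap T) (x : Space) :
    |penroseDt U t (‖x‖ ^ 2) - √2 * (1 - 2 * kap T * (T - t)) *
      ((T - t) * (1 - kap T * (T - t)) + kap T * ‖x‖ ^ 2) ^ (-2 : ℝ)|
      ≤ C * (1 + 1 * ‖x‖ ^ 2) ^ (-2 : ℝ) := by
  have hc := h.const_pos
  rw [Real.rpow_neg (by positivity), Real.rpow_neg (by positivity), Real.rpow_ofNat,
    Real.rpow_ofNat, one_mul]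
  exact h.bound_dt x

/-- From `√κ ‖x‖ ≤ √(c + κ‖x‖²)`, a coordinate costs half a power of `c + κ‖x‖²`. -/
theorem abs_coord_mul_rpow_le {c κ : ℝ} (hc : 0 ≤ c) (hκ : 0 < κ) (hpos : ∀ q, 0 ≤ q → 0 < c + κ * q)
    (x : Space) (i : Fin 3) :
    |x i| * ((c + κ * ‖x‖ ^ 2) ^ 2)⁻¹ ≤ (√κ)⁻¹ * (c + κ * ‖x‖ ^ 2) ^ (-(3 / 2) : ℝ) := by
  have hd := hpos (‖x‖ ^ 2) (sq_nonneg _)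
  set d := c + κ * ‖x‖ ^ 2 with hdd
  have h1 : |x i| ≤ ‖x‖ := by simpa using PiLp.norm_apply_le x i
  have h2 : √κ * ‖x‖ ≤ √d := by
    refine Real.le_sqrt_of_sq_le ?_
    rw [mul_pow, Real.sq_sqrt hκ.le]
    linarith
  have h3 : d ^ (-(3 / 2) : ℝ) = √d * (d ^ 2)⁻¹ := by
    rw [Real.sqrt_eq_rpow, ← Real.rpow_natCast, ← Real.rpow_neg hd.le, ← Real.rpow_add hd]
    norm_num
  rw [h3, ← mul_assoc]
  gcongr
  rw [inv_mul_eq_div, le_div_iff₀ (by positivity), mul_comm]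
  exact (mul_le_mul_of_nonneg_left h1 (Real.sqrt_nonneg _)).trans h2

theorem abs_fderiv_le (h : NearBlowup T C U t) (hκ : 0 < kap T) (hC : 0 ≤ C) (x : Space) (i : Fin 3) :
    |fderiv ℝ (penrose U t) x (EuclideanSpace.single i 1)| ≤
      √2 * (2 * kap T) * (√(kap T))⁻¹ *
        ((T - t) * (1 - kap T * (T - t)) + kap T * ‖x‖ ^ 2) ^ (-(3 / 2) : ℝ)
      + C * (1 + 1 * ‖x‖ ^ 2) ^ (-(3 / 2) : ℝ) := by
  have hc := h.const_pos
  rw [h.fderiv_eq, abs_mul]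
  have h1 := abs_coord_mul_rpow_le hc.le hκ (fun q hq => by positivity) x i
  have h2 := abs_coord_mul_rpow_le zero_le_one one_pos (fun q hq => by positivity) x i
  simp only [Real.sqrt_one, inv_one, one_mul] at h2
  have h3 : |penroseDx U t (‖x‖ ^ 2)| ≤ √2 * (2 * kap T) / den T t (‖x‖ ^ 2) ^ 2
      + C / (1 + ‖x‖ ^ 2) ^ 2 := by
    have h4 := h.bound_dx x
    have h5 : 0 ≤ √2 * (2 * kap T) / den T t (‖x‖ ^ 2) ^ 2 := by positivity
    rw [abs_le] at h4 ⊢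
    constructor <;> linarith [h4.1, h4.2]
  calc |x i| * |penroseDx U t (‖x‖ ^ 2)|
      ≤ |x i| * (√2 * (2 * kap T) / den T t (‖x‖ ^ 2) ^ 2 + C / (1 + ‖x‖ ^ 2) ^ 2) := by gcongr
    _ = √2 * (2 * kap T) * (|x i| * (((T - t) * (1 - kap T * (T - t)) + kap T * ‖x‖ ^ 2) ^ 2)⁻¹)
        + C * (|x i| * ((1 + 1 * ‖x‖ ^ 2) ^ 2)⁻¹) := by
        rw [den, one_mul]
        ring
    _ ≤ _ := by
        rw [mul_assoc (√2 * (2 * kap T)), one_mul]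
        gcongr

end NearBlowup

/-! ### Blow-up rates -/

theorem C₀_rpow {T q : ℝ} (hT : 0 < T) :
    C₀ T ^ q = 2 ^ (3 / 2 * q) * bracketIntegral (kap T) 3 ^ q := by
  have h : C₀ T = 2 ^ (3 / 2 : ℝ) * bracketIntegral (kap T) 3 := C₀_eq
  rw [h, Real.mul_rpow (by positivity) (bracketIntegral_nonneg (kap_pos hT) _),
    ← Real.rpow_mul two_pos.le]

theorem abs_rpow_neg_half_sub_le {s y : ℝ} (hs : 0 < s) (hs1 : s ≤ 1) (hy : 0 ≤ y)
    (hy1 : y * s ≤ 1 / 2) : |(s * (1 - y * s)) ^ (-(1 / 2) : ℝ) - s ^ (-(1 / 2) : ℝ)| ≤ 2 * y := by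
  have h1 : 0 < 1 - y * s := by linarith
  have hys : 0 ≤ y * s := by positivity
  rw [Real.mul_rpow hs.le h1.le]
  have h2 : 1 ≤ (1 - y * s) ^ (-(1 / 2) : ℝ) :=
    Real.one_le_rpow_of_pos_of_le_one_of_nonpos h1 (by linarith) (by norm_num)
  have h3 : (1 - y * s) ^ (-(1 / 2) : ℝ) ≤ 1 + 2 * (y * s) := by
    calc (1 - y * s) ^ (-(1 / 2) : ℝ) ≤ (1 - y * s) ^ (-1 : ℝ) :=
          Real.rpow_le_rpow_of_exponent_ge h1 (by linarith) (by norm_num)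
      _ ≤ 1 + 2 * (y * s) := by
          rw [Real.rpow_neg_one, inv_eq_one_div, div_le_iff₀ h1]
          nlinarith
  have h4 : 0 < s ^ (-(1 / 2) : ℝ) := by positivity
  have h5 : s ^ (-(1 / 2) : ℝ) * s ≤ 1 := by
    rw [← Real.rpow_add_one hs.ne']
    exact Real.rpow_le_one hs.le hs1 (by norm_num)
  rw [abs_of_nonneg (by nlinarith)]
  calc s ^ (-(1 / 2) : ℝ) * (1 - y * s) ^ (-(1 / 2) : ℝ) - s ^ (-(1 / 2) : ℝ)
      ≤ s ^ (-(1 / 2) : ℝ) * (1 + 2 * (y * s)) - s ^ (-(1 / 2) : ℝ) := by gcongr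
    _ = 2 * y * (s ^ (-(1 / 2) : ℝ) * s) := by ring
    _ ≤ 2 * y := mul_le_of_le_one_right (by positivity) h5

namespace NearBlowup

variable {T C : ℝ} {U : ℝ → ℝ}

theorem exists_abs_eLpNorm_three_sub_le (hT : 0 < T) (hC : 0 ≤ C) :
    ∃ A, ∀ t, NearBlowup T C U t → MemLp (penrose U t) 3 volume ∧
      |(eLpNorm (penrose U t) 3 volume).toReal - C₀ T ^ (1 / 3 : ℝ) / (T - t) ^ (1 / 2 : ℝ)| ≤ A := by
  have hκ := kap_pos hT
  refine ⟨C * bracketIntegral 1 3 ^ (3⁻¹ : ℝ)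
    + √2 * bracketIntegral (kap T) 3 ^ (3⁻¹ : ℝ) * (2 * kap T), fun t h => ?_⟩
  have hs := h.pos
  have h1 := abs_eLpNorm_sub_quad_le (p := 3) hκ h.const_pos (by norm_num) (by norm_num) hC
    h.smooth.continuous.aestronglyMeasurable h.bound'
  rw [show ENNReal.ofReal 3 = 3 by norm_num] at h1
  refine ⟨h1.1, ?_⟩
  have h2 := h1.2
  rw [abs_of_nonneg (Real.sqrt_nonneg 2), one_mul] at h2
  norm_num only at h2
  have h3 := abs_rpow_neg_half_sub_le hs h.le_one hκ.le h.kap_mul_le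
  rw [C₀_rpow hT]
  set J := bracketIntegral (kap T) 3 ^ (1 / 3 : ℝ) with hJ
  have hJ0 : 0 ≤ J := Real.rpow_nonneg (bracketIntegral_nonneg hκ _) _
  have e : 2 ^ (3 / 2 * (1 / 3) : ℝ) * J / (T - t) ^ (1 / 2 : ℝ)
      = √2 * J * (T - t) ^ (-(1 / 2) : ℝ) := by
    rw [Real.rpow_neg hs.le, Real.sqrt_eq_rpow]
    norm_num
    ring
  rw [e, show (3⁻¹ : ℝ) = 1 / 3 by norm_num]
  have h4 : |√2 * (((T - t) * (1 - kap T * (T - t))) ^ (-(1 / 2) : ℝ) * J)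
      - √2 * J * (T - t) ^ (-(1 / 2) : ℝ)| ≤ √2 * J * (2 * kap T) := by
    rw [mul_comm _ J, ← mul_assoc, ← mul_sub, abs_mul, abs_of_nonneg (by positivity)]
    gcongr
  exact (abs_sub_le _ _ _).trans (add_le_add h2 h4)

theorem exists_abs_eLpNorm_dt_sub_le (hT : 0 < T) (hC : 0 ≤ C) :
    ∃ A, ∀ t, NearBlowup T C U t →
      MemLp (fun x : Space => penroseDt U t (‖x‖ ^ 2)) (3 / 2) volume ∧
      |(eLpNorm (fun x : Space => penroseDt U t (‖x‖ ^ 2)) (3 / 2) volume).toReal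
        - 2 ^ (-(1 / 2) : ℝ) * C₀ T ^ (2 / 3 : ℝ) / (T - t)| ≤ A := by
  have hκ := kap_pos hT
  refine ⟨C * bracketIntegral 1 3 ^ (2 / 3 : ℝ)
    + √2 * bracketIntegral (kap T) 3 ^ (2 / 3 : ℝ) * (2 * kap T), fun t h => ?_⟩
  have hs := h.pos
  have hy := h.kap_mul_le
  have h1 := abs_eLpNorm_sub_quad_le (p := 3 / 2) hκ h.const_pos (by norm_num) (by norm_num) hC
    h.continuous_dt.aestronglyMeasurable (h.bound_dt' hκ)
  rw [show ENNReal.ofReal (3 / 2) = 3 / 2 by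
    rw [ENNReal.ofReal_div_of_pos two_pos]; norm_num] at h1
  refine ⟨h1.1, ?_⟩
  have h2 := h1.2
  have hq : 0 < 1 - kap T * (T - t) := by linarith
  rw [abs_of_nonneg (mul_nonneg (Real.sqrt_nonneg 2) (by linarith))] at h2
  norm_num only at h2
  rw [C₀_rpow hT]
  set J := bracketIntegral (kap T) 3 ^ (2 / 3 : ℝ) with hJ
  have hJ0 : 0 ≤ J := Real.rpow_nonneg (bracketIntegral_nonneg hκ _) _
  have e : (2 : ℝ) ^ (-(1 / 2) : ℝ) * (2 ^ (3 / 2 * (2 / 3) : ℝ) * J) / (T - t)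
      = √2 * J * (T - t)⁻¹ := by
    have : (2 : ℝ) ^ (-(1 / 2) : ℝ) * 2 ^ (3 / 2 * (2 / 3) : ℝ) = √2 := by
      rw [← Real.rpow_add two_pos, Real.sqrt_eq_rpow]
      norm_num
    rw [← mul_assoc, this, div_eq_mul_inv]
  rw [e]
  rw [show (-1 : ℝ) = ((-1 : ℤ) : ℝ) by norm_num, Real.rpow_intCast, zpow_neg_one] at h2
  have h4 : |√2 * (1 - 2 * kap T * (T - t)) * (((T - t) * (1 - kap T * (T - t)))⁻¹ * J)
      - √2 * J * (T - t)⁻¹| ≤ √2 * J * (2 * kap T) := by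
    have e2 : √2 * (1 - 2 * kap T * (T - t)) * (((T - t) * (1 - kap T * (T - t)))⁻¹ * J)
      - √2 * J * (T - t)⁻¹ = -(√2 * J * (kap T / (1 - kap T * (T - t)))) := by
      field_simp
      ring
    rw [e2, abs_neg, abs_of_nonneg (by positivity)]
    gcongr
    rw [div_le_iff₀ hq]
    nlinarith
  exact (abs_sub_le _ _ _).trans (add_le_add h2 h4)

theorem exists_homSobolevNorm_half_le (hT : 0 < T) (hC : 0 ≤ C) :
    ∃ A, ∀ t, NearBlowup T C U t →
      homSobolevNorm (1 / 2) (penrose U t) ≤ ENNReal.ofReal (A * (1 / (T - t) ^ (1 / 2 : ℝ))) := by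
  have hκ := kap_pos hT
  obtain ⟨B₀, hB₀, h₀⟩ := exists_eLpNorm_le (kap T) √2 C 1 2 hκ hC (by norm_num) (by norm_num)
  obtain ⟨B₁, hB₁, h₁⟩ := exists_eLpNorm_le (kap T) (√2 * (2 * kap T) * (√(kap T))⁻¹) C (3 / 2) 2 hκ
    hC (by norm_num) (by norm_num)
  refine ⟨(3 * B₁ * B₀) ^ (1 / 2 : ℝ), fun t h => ?_⟩
  have hs := h.pos
  have e0 := h₀ _ _ √2 _ hs h.le_one h.half_le (abs_of_nonneg (Real.sqrt_nonneg _)).le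
    h.smooth.continuous.aestronglyMeasurable h.bound'
  have hc := h.const_pos
  -- The gradient is dominated by such powers without being close to a multiple of one, so the
  -- estimate is applied to the dominating function. The `L²` bounds are of order `s^{-1/4}` for `u`
  -- and `s^{-3/4}` for its gradient, with `s = T - t`.
  have e1 := h₁ _ _ (√2 * (2 * kap T) * (√(kap T))⁻¹)
    (fun x => √2 * (2 * kap T) * (√(kap T))⁻¹ *
        ((T - t) * (1 - kap T * (T - t)) + kap T * ‖x‖ ^ 2) ^ (-(3 / 2) : ℝ)
      + C * (1 + 1 * ‖x‖ ^ 2) ^ (-(3 / 2) : ℝ)) hs h.le_one h.half_le (abs_of_nonneg (by positivity)).le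
    (((continuous_quad_rpow hκ hc _).const_mul _).add
      ((continuous_quad_rpow one_pos one_pos _).const_mul _)).aestronglyMeasurable
    (fun x => by
      rw [add_sub_cancel_left, abs_of_nonneg (by positivity)])
  rw [show ENNReal.ofReal 2 = 2 by norm_num] at e0 e1
  have hmeas : ∀ i : Fin 3, AEStronglyMeasurable
      (fun x => fderiv ℝ (penrose U t) x (EuclideanSpace.single i 1)) volume := fun i =>
    ((h.smooth.continuous_fderiv (by simp)).clm_apply continuous_const).aestronglyMeasurable
  have hle := fun (i : Fin 3) (x : Space) => h.abs_fderiv_le hκ hC x i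
  have e2 : ∀ i : Fin 3, eLpNorm (fun x => fderiv ℝ (penrose U t) x (EuclideanSpace.single i 1)) 2
      volume ≤ ENNReal.ofReal (B₁ * (T - t) ^ (3 / 2 * 2⁻¹ - 3 / 2 : ℝ)) := fun i =>
    (eLpNorm_mono_real fun x => hle i x).trans e1.2
  refine (homSobolevNorm_half_le e0.1 (h.smooth.differentiable (by simp)) fun i =>
    e1.1.of_le (hmeas i) (.of_forall fun x => (hle i x).trans (le_abs_self _))).trans ?_
  calc _ ≤ ((∑ _i : Fin 3, ENNReal.ofReal (B₁ * (T - t) ^ (3 / 2 * 2⁻¹ - 3 / 2 : ℝ)))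
        * ENNReal.ofReal (B₀ * (T - t) ^ (3 / 2 * 2⁻¹ - 1 : ℝ))) ^ (1 / 2 : ℝ) := by
        gcongr with i
        · exact e2 i
        · exact e0.2
    _ = _ := by
        rw [← ENNReal.ofReal_sum_of_nonneg fun i _ => by positivity, ← ENNReal.ofReal_mul
          (by positivity), ENNReal.ofReal_rpow_of_nonneg (by positivity) (by norm_num)]
        congr 1
        rw [Finset.sum_const, Finset.card_univ, Fintype.card_fin, nsmul_eq_mul]
        have : ((3 : ℕ) : ℝ) * (B₁ * (T - t) ^ (3 / 2 * 2⁻¹ - 3 / 2 : ℝ)) *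
            (B₀ * (T - t) ^ (3 / 2 * 2⁻¹ - 1 : ℝ)) = 3 * B₁ * B₀ * (T - t)⁻¹ := by
          have : (T - t) ^ (3 / 2 * 2⁻¹ - 3 / 2 : ℝ) * (T - t) ^ (3 / 2 * 2⁻¹ - 1 : ℝ) = (T - t)⁻¹ := by
            rw [← Real.rpow_add hs, ← Real.rpow_neg_one (T - t)]
            congr 1
            norm_num
          rw [← this]
          push_cast
          ring
        rw [this, Real.mul_rpow (by positivity) (by positivity), Real.inv_rpow hs.le, one_div]
        norm_num

theorem exists_homSobolevNorm_dt_le (hT : 0 < T) (hC : 0 ≤ C) :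
    ∃ A, ∀ t, NearBlowup T C U t →
      homSobolevNorm (-(1 / 2)) (fun x : Space => penroseDt U t (‖x‖ ^ 2))
        ≤ ENNReal.ofReal (A * (1 / (T - t))) := by
  have hκ := kap_pos hT
  obtain ⟨B₁, hB₁, h₁⟩ := exists_eLpNorm_le (kap T) √2 C 2 1 hκ hC (by norm_num) (by norm_num)
  obtain ⟨B₂, hB₂, h₂⟩ := exists_eLpNorm_le (kap T) √2 C 2 2 hκ hC (by norm_num) (by norm_num)
  refine ⟨(B₁ ^ 2 * (2 * Real.pi) + B₂ ^ 2) ^ (1 / 2 : ℝ), fun t h => ?_⟩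
  have hs := h.pos
  have hy := h.kap_mul_le
  have hκs : 0 ≤ kap T * (T - t) := by positivity
  have ha : |√2 * (1 - 2 * kap T * (T - t))| ≤ √2 := by
    rw [abs_of_nonneg (mul_nonneg (Real.sqrt_nonneg _) (by linarith))]
    exact mul_le_of_le_one_right (Real.sqrt_nonneg _) (by linarith)
  have e1 := h₁ _ _ _ _ hs h.le_one h.half_le ha h.continuous_dt.aestronglyMeasurable (h.bound_dt' hκ)
  have e2 := h₂ _ _ _ _ hs h.le_one h.half_le ha h.continuous_dt.aestronglyMeasurable (h.bound_dt' hκ)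
  rw [show ENNReal.ofReal 2 = 2 by norm_num] at e2
  rw [ENNReal.ofReal_one] at e1
  have hint := memLp_one_iff_integrable.1 e1.1
  have e3 : ∫ x : Space, |penroseDt U t (‖x‖ ^ 2)| ≤ B₁ * (T - t) ^ (3 / 2 * 1⁻¹ - 2 : ℝ) := by
    have := e1.2
    rw [eLpNorm_one_eq_lintegral_enorm, ← ofReal_integral_norm_eq_lintegral_enorm hint,
      ENNReal.ofReal_le_ofReal_iff (by positivity)] at this
    exact this
  have hI : 0 ≤ ∫ x : Space, |penroseDt U t (‖x‖ ^ 2)| := integral_nonneg fun x => abs_nonneg _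
  -- With `s = T - t`, the `L¹` norm is `O(s^{-1/2})` and the `L²` norm `O(s^{-5/4})`; the radius `ρ
  -- = s^{-1/2}` balances both frequency ranges at `s^{-2}`.
  refine (homSobolevNorm_neg_half_le hint e2.1 (ρ := (T - t) ^ (-(1 / 2) : ℝ)) (by positivity)).trans ?_
  calc _ ≤ (ENNReal.ofReal ((B₁ * (T - t) ^ (3 / 2 * 1⁻¹ - 2 : ℝ)) ^ 2 *
          (2 * Real.pi * ((T - t) ^ (-(1 / 2) : ℝ)) ^ 2))
        + ENNReal.ofReal ((T - t) ^ (-(1 / 2) : ℝ))⁻¹ *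
          ENNReal.ofReal (B₂ * (T - t) ^ (3 / 2 * 2⁻¹ - 2 : ℝ)) ^ 2) ^ (1 / 2 : ℝ) := by
        gcongr
        exact e2.2
    _ = _ := by
        rw [← ENNReal.ofReal_pow (by positivity), ← ENNReal.ofReal_mul (by positivity),
          ← ENNReal.ofReal_add (by positivity) (by positivity),
          ENNReal.ofReal_rpow_of_nonneg (by positivity) (by norm_num)]
        congr 1
        have p1 : ((T - t) ^ (3 / 2 * 1⁻¹ - 2 : ℝ)) ^ 2 * ((T - t) ^ (-(1 / 2) : ℝ)) ^ 2
            = ((T - t) ^ 2)⁻¹ := by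
          rw [← Real.rpow_natCast, ← Real.rpow_natCast, ← Real.rpow_natCast, ← Real.rpow_mul hs.le,
            ← Real.rpow_mul hs.le, ← Real.rpow_add hs, ← Real.rpow_neg hs.le]
          norm_num
        have p2 : ((T - t) ^ (-(1 / 2) : ℝ))⁻¹ * ((T - t) ^ (3 / 2 * 2⁻¹ - 2 : ℝ)) ^ 2
            = ((T - t) ^ 2)⁻¹ := by
          rw [← Real.rpow_natCast, ← Real.rpow_natCast, ← Real.rpow_neg hs.le, ← Real.rpow_mul hs.le,
            ← Real.rpow_add hs, ← Real.rpow_neg hs.le]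
          norm_num
        have : (B₁ * (T - t) ^ (3 / 2 * 1⁻¹ - 2 : ℝ)) ^ 2 *
          (2 * Real.pi * ((T - t) ^ (-(1 / 2) : ℝ)) ^ 2) + ((T - t) ^ (-(1 / 2) : ℝ))⁻¹ *
          (B₂ * (T - t) ^ (3 / 2 * 2⁻¹ - 2 : ℝ)) ^ 2
          = (B₁ ^ 2 * (2 * Real.pi) + B₂ ^ 2) * ((T - t) ^ 2)⁻¹ := by
          have q1 := congrArg (fun z => B₁ ^ 2 * (2 * Real.pi) * z) p1
          have q2 := congrArg (fun z => B₂ ^ 2 * z) p2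
          rw [add_mul, ← q1, ← q2]
          ring
        rw [this, Real.mul_rpow (by positivity) (by positivity), ← inv_pow, ← Real.sqrt_eq_rpow
          (((T - t)⁻¹) ^ 2), Real.sqrt_sq (by positivity), one_div (T - t)]

/-- On the ball of radius `√s`, `s = T - t`, the singular part is at least of order `1/s`, so its
integral against the bump of that scale is at least of order `√s`. The remainder contributes
`O(s^{3/2})`, which is at most half of this once `s < s₀`. -/
theorem exists_le_homSobolevNorm_half (hT : 0 < T) (hC : 0 ≤ C) :
    ∃ k > 0, ∃ s₀ > 0, ∀ t, NearBlowup T C U t → T - t < s₀ →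
      ENNReal.ofReal (k * (1 / (T - t) ^ (1 / 2 : ℝ))) ≤ homSobolevNorm (1 / 2) (penrose U t) := by
  have hκ := kap_pos hT
  obtain ⟨k, hk, H⟩ := CubicWave.exists_le_homSobolevNorm_half
  set a := √2 / (1 + kap T) * (Real.pi * 4 / 3) with ha
  have ha0 : 0 < a := by positivity
  refine ⟨k * (a / 2), by positivity, a / (2 * (C * (32 * Real.pi / 3) + 1)), by positivity,
    fun t h hts => ?_⟩
  have hs := h.pos
  set s := T - t with hsd
  have hl : 0 < √s := Real.sqrt_pos.2 hs
  have hl2 : √s ^ 2 = s := Real.sq_sqrt hs.le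
  have hc := h.const_pos
  rw [← Real.sqrt_eq_rpow, mul_one_div]
  refine H _ _ _ hl (by positivity) ?_
  have hcut : Integrable (fun x : Space => cutoff hl x) := (cutoff hl).integrable
  have hball : Integrable ((Metric.ball (0 : Space) √s).indicator fun _ => √2 / ((1 + kap T) * s)) :=
    (integrable_indicator_iff measurableSet_ball).2 (integrableOn_const measure_ball_lt_top.ne)
  have hint : Integrable fun x : Space => penrose U t x * cutoff hl x :=
    (h.smooth.continuous.mul (cutoff hl).continuous).integrable_of_hasCompactSupport
      (cutoff hl).hasCompactSupport.mul_left
  have key : ∀ x : Space, (Metric.ball (0 : Space) √s).indicator (fun _ => √2 / ((1 + kap T) * s)) x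
      - C * cutoff hl x ≤ penrose U t x * cutoff hl x := fun x => by
    have h0 : 0 ≤ cutoff hl x := (cutoff hl).nonneg
    have hb := (abs_le.1 (h.bound x)).1
    have hd : 0 < den T t (‖x‖ ^ 2) := by rw [den]; positivity
    have hC1 : C / (1 + ‖x‖ ^ 2) ≤ C := div_le_self hC (by nlinarith [sq_nonneg ‖x‖])
    have h1 : √2 / den T t (‖x‖ ^ 2) - C ≤ penrose U t x := by linarith
    have h2 := mul_le_mul_of_nonneg_right h1 h0
    refine le_trans ?_ h2
    rw [sub_mul]
    refine sub_le_sub_right ?_ _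
    by_cases hx : x ∈ Metric.ball (0 : Space) √s
    · rw [indicator_of_mem hx, (cutoff hl).one_of_mem_closedBall (Metric.ball_subset_closedBall hx),
        mul_one]
      have hx' : ‖x‖ ^ 2 ≤ s := by
        rw [← hl2]
        have : ‖x‖ < √s := by simpa using hx
        gcongr
      refine div_le_div_of_nonneg_left (Real.sqrt_nonneg _) hd ?_
      rw [den, ← hsd]
      nlinarith [mul_le_mul_of_nonneg_left hx' hκ.le, mul_pos hκ hs]
    · rw [indicator_of_notMem hx]
      positivity
  have hI := integral_mono (hball.sub (hcut.const_mul C)) hint key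
  have hI2 := integral_norm_pow_cutoff_le hl one_ne_zero
  simp only [pow_one] at hI2
  have e : ∫ x : Space, ((Metric.ball (0 : Space) √s).indicator (fun _ => √2 / ((1 + kap T) * s)) x
      - C * cutoff hl x) = √s * a - C * ∫ x, cutoff hl x := by
    rw [integral_sub hball (hcut.const_mul C), integral_const_mul,
      integral_indicator measurableSet_ball, setIntegral_const, volume_real_ball hl.le, smul_eq_mul]
    congr 1
    rw [ha, show √s ^ 3 = s * √s by rw [pow_succ, hl2]]
    field_simp
  refine le_trans ?_ (e.symm.le.trans hI)
  have h5 : C * ∫ x, cutoff hl x ≤ a / 2 * √s := by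
    calc C * ∫ x, cutoff hl x ≤ C * (32 * Real.pi / 3 * √s ^ 3) := by gcongr
      _ = (C * (32 * Real.pi / 3) * s) * √s := by
          rw [show √s ^ 3 = s * √s by rw [pow_succ, hl2]]; ring
      _ ≤ a / 2 * √s := by
          gcongr
          rw [lt_div_iff₀ (by positivity)] at hts
          nlinarith
  linarith

end NearBlowup

/-- The blow-up rates at time `T` of a solution whose value and velocity at time `t` are `f t`
and `g t`. -/
def BlowupRates (T : ℝ) (f g : ℝ → Space → ℝ) : Prop :=
  (∀ᶠ t in 𝓝[<] T, MemLp (f t) 3 volume ∧ homSobolevNorm (1 / 2) (f t) < ⊤ ∧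
    MemLp (g t) (3 / 2) volume ∧ homSobolevNorm (-(1 / 2)) (g t) < ⊤) ∧
  ((fun t => (eLpNorm (f t) 3 volume).toReal - C₀ T ^ (1 / 3 : ℝ) / (T - t) ^ (1 / 2 : ℝ))
    =O[𝓝[<] T] fun _ => (1 : ℝ)) ∧
  ((fun t => (homSobolevNorm (1 / 2) (f t)).toReal)
    =Θ[𝓝[<] T] fun t => 1 / (T - t) ^ (1 / 2 : ℝ)) ∧
  ((fun t => (eLpNorm (g t) (3 / 2) volume).toReal
      - (2 : ℝ) ^ (-(1 / 2) : ℝ) * C₀ T ^ (2 / 3 : ℝ) / (T - t))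
    =O[𝓝[<] T] fun _ => (1 : ℝ)) ∧
  ((fun t => (homSobolevNorm (-(1 / 2)) (g t)).toReal) =O[𝓝[<] T] fun t => 1 / (T - t))

theorem BlowupRates.of_nearBlowup {T C : ℝ} {U : ℝ → ℝ} {f g : ℝ → Space → ℝ} (hT : 0 < T)
    (hC : 0 ≤ C) (h : ∀ᶠ t in 𝓝[<] T, NearBlowup T C U t)
    (hfg : ∀ᶠ t in 𝓝[<] T, f t = penrose U t ∧ g t = fun x => penroseDt U t (‖x‖ ^ 2)) :
    BlowupRates T f g := by
  obtain ⟨A₁, H₁⟩ := NearBlowup.exists_abs_eLpNorm_three_sub_le (U := U) hT hC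
  obtain ⟨A₂, H₂⟩ := NearBlowup.exists_homSobolevNorm_half_le (U := U) hT hC
  obtain ⟨A₃, H₃⟩ := NearBlowup.exists_abs_eLpNorm_dt_sub_le (U := U) hT hC
  obtain ⟨A₄, H₄⟩ := NearBlowup.exists_homSobolevNorm_dt_le (U := U) hT hC
  obtain ⟨k, hk, s₀, hs₀, H₅⟩ := NearBlowup.exists_le_homSobolevNorm_half (U := U) hT hC
  have hnear : ∀ᶠ t in 𝓝[<] T, T - t < s₀ := by
    filter_upwards [Ioo_mem_nhdsLT (show T - s₀ < T by linarith)] with t ht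
    linarith [ht.1]
  have hpos : ∀ {t : ℝ}, NearBlowup T C U t → 0 < 1 / (T - t) ^ (1 / 2 : ℝ) := fun h =>
    one_div_pos.2 (Real.rpow_pos_of_pos h.pos _)
  refine ⟨?_, IsBigO.of_bound A₁ ?_, ⟨IsBigO.of_bound |A₂| ?_, IsBigO.of_bound k⁻¹ ?_⟩,
    IsBigO.of_bound A₃ ?_, IsBigO.of_bound |A₄| ?_⟩
  · filter_upwards [h, hfg] with t ht he
    rw [he.1, he.2]
    exact ⟨(H₁ t ht).1, (H₂ t ht).trans_lt ENNReal.ofReal_lt_top, (H₃ t ht).1,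
      (H₄ t ht).trans_lt ENNReal.ofReal_lt_top⟩
  · filter_upwards [h, hfg] with t ht he
    rw [he.1, norm_one, mul_one]
    exact (H₁ t ht).2
  · filter_upwards [h, hfg] with t ht he
    have hp := hpos ht
    rw [he.1, Real.norm_of_nonneg ENNReal.toReal_nonneg, Real.norm_of_nonneg hp.le]
    refine ENNReal.toReal_le_of_le_ofReal (by positivity)
      ((H₂ t ht).trans (ENNReal.ofReal_le_ofReal ?_))
    gcongr
    exact le_abs_self _
  · filter_upwards [h, hfg, hnear] with t ht he hn
    have hp := hpos ht
    rw [he.1, Real.norm_of_nonneg ENNReal.toReal_nonneg, Real.norm_of_nonneg hp.le,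
      inv_mul_eq_div, le_div_iff₀ hk, mul_comm]
    exact (ENNReal.ofReal_le_iff_le_toReal ((H₂ t ht).trans_lt ENNReal.ofReal_lt_top).ne).1
      (H₅ t ht hn)
  · filter_upwards [h, hfg] with t ht he
    rw [he.2, norm_one, mul_one]
    exact (H₃ t ht).2
  · filter_upwards [h, hfg] with t ht he
    have hp : 0 < 1 / (T - t) := one_div_pos.2 ht.pos
    rw [he.2, Real.norm_of_nonneg ENNReal.toReal_nonneg, Real.norm_of_nonneg hp.le]
    refine ENNReal.toReal_le_of_le_ofReal (by positivity)
      ((H₄ t ht).trans (ENNReal.ofReal_le_ofReal ?_))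
    gcongr
    exact le_abs_self _

/-! ### Reflection `u ↦ -u` -/

theorem IsFourierTransform.neg {f g : Space → ℂ} (h : IsFourierTransform f g) :
    IsFourierTransform (fun x => -f x) (fun ξ => -g ξ) := by
  refine ⟨fun φ => ?_, fun φ => ?_, fun φ => ?_⟩
  · simpa only [neg_mul] using! (h.1 φ).neg
  · simpa only [neg_mul] using! (h.2.1 φ).neg
  · simpa only [neg_mul, integral_neg, neg_inj] using h.2.2 φ

theorem homSobolevNorm_neg_le (s : ℝ) (f : Space → ℝ) :
    homSobolevNorm s (fun x => -f x) ≤ homSobolevNorm s f := by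
  refine le_iInf₂ fun g hg => ?_
  have h : IsFourierTransform (fun x => ((-f x : ℝ) : ℂ)) fun ξ => -g ξ := by
    simpa only [Complex.ofReal_neg] using hg.neg
  exact (iInf₂_le _ h).trans_eq (by simp only [enorm_neg])

theorem homSobolevNorm_neg (s : ℝ) (f : Space → ℝ) :
    homSobolevNorm s (fun x => -f x) = homSobolevNorm s f :=
  le_antisymm (homSobolevNorm_neg_le s f)
    (by simpa only [neg_neg] using homSobolevNorm_neg_le s fun x => -f x)

theorem BlowupRates.neg {T : ℝ} {f g : ℝ → Space → ℝ} (h : BlowupRates T f g) :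
    BlowupRates T (fun t x => -f t x) (fun t x => -g t x) := by
  have e : ∀ (F : Space → ℝ) (p : ℝ≥0∞), eLpNorm (fun x => -F x) p volume = eLpNorm F p volume :=
    fun F p => eLpNorm_neg F p volume
  have m : ∀ (F : Space → ℝ) (p : ℝ≥0∞), MemLp (fun x => -F x) p volume ↔ MemLp F p volume :=
    fun F p => memLp_neg_iff
  simpa only [BlowupRates, homSobolevNorm_neg, e, m] using h

theorem IsSolution.neg {X Y : ℝ} {I : Set ℝ} {u : ℝ → Space → ℝ} (h : IsSolution X Y I u) :
    IsSolution (-X) (-Y) I fun t x => -u t x where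
  smooth := h.smooth.neg
  wave_eq t ht x := by
    have h1 : iteratedDeriv 2 (fun s => -u s x) t = -iteratedDeriv 2 (fun s => u s x) t :=
      iteratedDeriv_fun_neg 2 _ t
    have h2 : Δ (fun x => -u t x) x = -Δ (u t) x :=
      congrFun (InnerProductSpace.laplacian_neg (f := u t)) x
    rw [h1, h2]
    linear_combination -h.wave_eq t ht x
  init_pos x := by rw [h.init_pos]; ring
  init_vel x := by rw [deriv.fun_neg, h.init_vel]; ring

theorem maximalTime_neg_le (X Y : ℝ) : maximalTime (-X) (-Y) ≤ maximalTime X Y := by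
  refine sSup_le_sSup ?_
  rintro _ ⟨a, b, ha, hb, rfl, u, hu⟩
  exact ⟨a, b, ha, hb, rfl, _, by simpa only [neg_neg] using hu.neg⟩

theorem maximalTime_neg (X Y : ℝ) : maximalTime (-X) (-Y) = maximalTime X Y :=
  le_antisymm (maximalTime_neg_le X Y) (by simpa only [neg_neg] using maximalTime_neg_le (-X) (-Y))

/-! ### The blow-up theorem -/

theorem IsSolution.eq_of_mem_Ico {X Y a a' b : ℝ} {u v : ℝ → Space → ℝ} (ha : a < 0) (ha' : a' < 0)
    (hu : IsSolution X Y (Ioo a b) u) (hv : IsSolution X Y (Ioo a' b) v) {t : ℝ}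
    (ht : t ∈ Ico 0 b) : u t = v t :=
  funext fun x => IsSolution.eq_of_nonneg (a := max a a') (max_lt ha ha')
    (hu.mono (Ioo_subset_Ioo_left (le_max_left _ _)))
    (hv.mono (Ioo_subset_Ioo_left (le_max_right _ _))) ht.1 ht.2 x

theorem NearBlowup.tendsto_atTop {T C : ℝ} {U : ℝ → ℝ} (hT : 0 < T)
    (h : ∀ᶠ t in 𝓝[<] T, NearBlowup T C U t) :
    Tendsto (fun t => penrose U t 0) (𝓝[<] T) atTop := by
  have h1 : Tendsto (fun t => T - t) (𝓝[<] T) (𝓝[>] 0) := by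
    refine tendsto_nhdsWithin_iff.2 ⟨?_, by filter_upwards [h] with t ht using ht.pos⟩
    have : Tendsto (fun t => T - t) (𝓝 T) (𝓝 (T - T)) := tendsto_const_nhds.sub tendsto_id
    rw [sub_self] at this
    exact this.mono_left nhdsWithin_le_nhds
  have h2 := (tendsto_inv_nhdsGT_zero.comp h1)
  refine tendsto_atTop_mono' _ ?_ (tendsto_atTop_add_const_right _ (-C) h2)
  filter_upwards [h] with t ht
  have hs := ht.pos
  have hc := ht.const_pos
  have hb := (abs_le.1 (ht.bound 0)).1
  have hκ := kap_pos hT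
  simp only [norm_zero, ne_eq, OfNat.ofNat_ne_zero, not_false_eq_true, zero_pow, add_zero, div_one,
    den, mul_zero] at hb
  have h3 : (T - t)⁻¹ ≤ √2 / ((T - t) * (1 - kap T * (T - t))) := by
    rw [inv_eq_one_div]
    refine div_le_div₀ (Real.sqrt_nonneg _) (Real.one_le_sqrt.2 one_le_two) hc ?_
    exact mul_le_of_le_one_right hs.le (by nlinarith [mul_pos hκ hs])
  simp only [Function.comp_apply]
  linarith

theorem blowup_of_threshold_lt {X Y : ℝ} (h : threshold X < Y) :
    ∃ T : ℝ, 0 < T ∧ maximalTime X Y = (T : EReal) ∧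
      (∃ a < (0 : ℝ), ∃ u : ℝ → Space → ℝ, IsSolution X Y (Ioo a T) u) ∧
      ∀ a < (0 : ℝ), ∀ u : ℝ → Space → ℝ, IsSolution X Y (Ioo a T) u →
        BlowupRates T u fun t x => deriv (fun s => u s x) t := by
  obtain ⟨ε', τ, U, hp'⟩ := exists_isProfile h
  have hε' := hp'.eps_pos
  -- The initial time `-tan (ε/2)` is meaningful only for `ε < π`, hence the truncation at `1`.
  have hp := hp'.mono (ε' := min ε' 1) (lt_min hε' one_pos) (min_le_left _ _)
  have hε : min ε' 1 < Real.pi := (min_le_right _ _).trans_lt (by linarith [Real.pi_gt_three])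
  obtain ⟨C, hC, hnear⟩ := hp.eventually_nearBlowup hε
  have hsol := hp.isSolution hε
  have hτ := hp.pos
  have hπ := hp.lt_pi
  have hε0 := hp.eps_pos
  have hT : 0 < Real.tan (τ / 2) := Real.tan_pos_of_pos_of_lt_pi_div_two (by linarith) (by linarith)
  have hE : 0 < Real.tan (min ε' 1 / 2) :=
    Real.tan_pos_of_pos_of_lt_pi_div_two (by linarith) (by linarith)
  set T := Real.tan (τ / 2) with hTd
  set a₀ := -Real.tan (min ε' 1 / 2) with ha₀
  have ha₀' : a₀ < 0 := by linarith
  have hmem : ∀ᶠ t in 𝓝[<] T, t ∈ Ioo 0 T := Ioo_mem_nhdsLT hT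
  refine ⟨T, hT, le_antisymm (sSup_le ?_) (le_sSup ⟨a₀, T, ha₀', hT, rfl, _, hsol⟩),
    ⟨a₀, ha₀', _, hsol⟩, fun a ha u hu => ?_⟩
  · rintro _ ⟨a, b, ha, hb, rfl, v, hv⟩
    rw [EReal.coe_le_coe_iff]
    -- A solution living past `T` would agree with the Penrose solution on `[0, T)`, hence be
    -- unbounded at `x = 0`, against its continuity at `(T, 0)`.
    by_contra! hTb
    have hcont : ContinuousAt (fun t => v t 0) T :=
      (hasDerivAt_slice_time (differentiableAt_of_slab hv.smooth (p := (T, 0))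
        ⟨ha.trans hT, hTb⟩)).continuousAt
    refine not_tendsto_nhds_of_tendsto_atTop (NearBlowup.tendsto_atTop hT hnear) (v T 0) ?_
    refine (hcont.tendsto.mono_left nhdsWithin_le_nhds).congr' ?_
    filter_upwards [hmem] with t ht
    rw [(hv.mono (Ioo_subset_Ioo_right hTb.le)).eq_of_mem_Ico ha ha₀' hsol ⟨ht.1.le, ht.2⟩]
  · refine BlowupRates.of_nearBlowup hT hC hnear ?_
    filter_upwards [hmem] with t ht
    refine ⟨hu.eq_of_mem_Ico ha ha₀' hsol ⟨ht.1.le, ht.2⟩, funext fun x => ?_⟩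
    have e : (fun s => u s x) =ᶠ[𝓝 t] fun s => penrose U s x := by
      filter_upwards [isOpen_Ioo.mem_nhds ht] with s hs
      rw [hu.eq_of_mem_Ico ha ha₀' hsol ⟨hs.1.le, hs.2⟩]
    rw [e.deriv_eq]
    exact (hasDerivAt_penrose_time (hp.differentiableAt (confTime_mem hε0 hε hτ hπ (sq_nonneg _)
      ⟨ha₀'.trans ht.1, ht.2⟩))).deriv

theorem blowup_of_lt_neg_threshold {X Y : ℝ} (h : Y < -threshold (-X)) :
    ∃ T : ℝ, 0 < T ∧ maximalTime X Y = (T : EReal) ∧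
      (∃ a < (0 : ℝ), ∃ u : ℝ → Space → ℝ, IsSolution X Y (Ioo a T) u) ∧
      ∀ a < (0 : ℝ), ∀ u : ℝ → Space → ℝ, IsSolution X Y (Ioo a T) u →
        BlowupRates T u fun t x => deriv (fun s => u s x) t := by
  obtain ⟨T, hT, hmax, ⟨a, ha, u, hu⟩, H⟩ := blowup_of_threshold_lt (X := -X) (Y := -Y) (by linarith)
  refine ⟨T, hT, by rw [← maximalTime_neg, hmax], ⟨a, ha, _, by simpa only [neg_neg] using hu.neg⟩,
    fun a ha v hv => ?_⟩
  simpa only [deriv.fun_neg, neg_neg] using (H a ha _ hv.neg).neg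

end CubicWave

end

theorem theorem1p5 (X Y : ℝ)
    (h : CubicWave.threshold X < Y ∨ Y < -CubicWave.threshold (-X)) :
    ∃ T : ℝ, 0 < T ∧ CubicWave.maximalTime X Y = (T : EReal) ∧
      (∃ a < (0 : ℝ), ∃ u : ℝ → CubicWave.Space → ℝ, CubicWave.IsSolution X Y (Ioo a T) u) ∧
      ∀ a < (0 : ℝ), ∀ u : ℝ → CubicWave.Space → ℝ, CubicWave.IsSolution X Y (Ioo a T) u →
        -- all the norms below are finite for `t < T` close to `T`
        (∀ᶠ t in 𝓝[<] T,
          MemLp (u t) 3 volume ∧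
          CubicWave.homSobolevNorm (1 / 2) (u t) < ⊤ ∧
          MemLp (fun x => deriv (fun s => u s x) t) (3 / 2) volume ∧
          CubicWave.homSobolevNorm (-(1 / 2)) (fun x => deriv (fun s => u s x) t) < ⊤) ∧
        ((fun t => (eLpNorm (u t) 3 volume).toReal
            - CubicWave.C₀ T ^ (1 / 3 : ℝ) / (T - t) ^ (1 / 2 : ℝ))
          =O[𝓝[<] T] fun _ => (1 : ℝ)) ∧
        ((fun t => (CubicWave.homSobolevNorm (1 / 2) (u t)).toReal)
          =Θ[𝓝[<] T] fun t => 1 / (T - t) ^ (1 / 2 : ℝ)) ∧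
        ((fun t => (eLpNorm (fun x => deriv (fun s => u s x) t) (3 / 2) volume).toReal
            - (2 : ℝ) ^ (-(1 / 2) : ℝ) * CubicWave.C₀ T ^ (2 / 3 : ℝ) / (T - t))
          =O[𝓝[<] T] fun _ => (1 : ℝ)) ∧
        ((fun t => (CubicWave.homSobolevNorm (-(1 / 2))
              (fun x => deriv (fun s => u s x) t)).toReal)
          =O[𝓝[<] T] fun t => 1 / (T - t)) := by
  rcases h with h | h
  · exact CubicWave.blowup_of_threshold_lt h
  · exact CubicWave.blowup_of_lt_neg_threshold h
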